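/- Let $K$ be a number field, $E/K$ an elliptic curve given by a Weierstrass equation $y^2+a_1xy+a_3y=x^3+a_2x^2+a_4x+a_6$ with discriminant $\Delta$, $\mathfrak p$ a nonzero prime ideal of $\mathcal O_K$, $\nu$ the normalised discrete valuation of $\mathfrak p$ and $K_\nu$ the completion. Let $\lambda\colon E(K_\nu)\setminus\{O\}\to\mathbb R$ be the local Néron height function, i.e. the unique function that (i) is continuous and is bounded on the complement of every $\nu$-adic neighbourhood of $O$; (ii) is such that $\lim_{P\to O}\bigl(\lambda(P)+\tfrac12\nu(x(P))\bigr)$ exists; (iii) satisfies $\lambda(2P)=4\lambda(P)+\nu\bigl((2y+a_1x+a_3)(P)\bigr)-\tfrac14\nu(\Delta)$ whenever $2P\ne O$. Put $\widetilde\lambda=\lambda-\tfrac1{12}\nu(\Delta)$. For $P=(x_1,y_1)$ and $Q=(x_2,y_2)$ in $E(K)$ with $x_1\neq x_2$, let $\Psi_{(a,b)}(P,Q)$, $(a,b)\in\mathbb Z^2$, be the values of the net polynomials, i.e. of the rank two elliptic net with $\Psi_{(1,0)}=\Psi_{(0,1)}=\Psi_{(1,1)}=1$, $\Psi_{(2,0)}=2y_1+a_1x_1+a_3$,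 $\Psi_{(0,2)}=2y_2+a_1x_2+a_3$, $\Psi_{(2,1)}=2x_1+x_2-\ell^2-a_1\ell+a_2$ and $\Psi_{(1,2)}=2x_2+x_1-\ell^2-a_1\ell+a_2$, where $\ell=\frac{y_2-y_1}{x_2-x_1}$. (1) For all $P,Q\in E(K)\setminus\{O\}$ with $P\ne\pm Q$ and all $(a,b)\in\mathbb Z^2$ with $aP+bQ\neq O$, we have $\Psi_{(a,b)}(P,Q)\ne0$ and $$\widetilde\lambda(aP+bQ)=a^2\widetilde\lambda(P)+b^2\widetilde\lambda(Q)+ab\bigl(\widetilde\lambda(P+Q)-\widetilde\lambda(P)-\widetilde\lambda(Q)\bigr)+\nu\bigl(\Psi_{(a,b)}(P,Q)\bigr).$$ (2) Suppose moreover that $E$ has complex multiplication by an order $\mathbb Z[\omega]$ of an imaginary quadratic field, $\mathbb Z[\omega]\cong\mathrm{End}(E)$, $\alpha\mapsto[\alpha]$. Let $P\in E(K)$ be a non-torsion point with $[\omega]P\in E(K)$, and let $\alpha=a+b\omega\in\mathbb Z[\omega]$ be nonzero. Then $[\alpha]P,[1+\omega]P\in E(K)$, $\Psi_{(a,b)}(P,[\omega]P)\neq0$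 and $$\widetilde\lambda([\alpha]P)=a^2\widetilde\lambda(P)+b^2\widetilde\lambda([\omega]P)+ab\bigl(\widetilde\lambda([1+\omega]P)-\widetilde\lambda(P)-\widetilde\lambda([\omega]P)\bigr)+\nu\bigl(\Psi_{(a,b)}(P,[\omega]P)\bigr).$$ -/

import Mathlib

open scoped Polynomial.Bivariate
open Polynomial IsDedekindDomain NumberField WeierstrassCurve

/-! ### Elliptic nets of rank two and net polynomials -/

/-- An elliptic net on a free abelian group `A` with values in an integral domain `R`. -/
def IsEllipticNetOn {A R : Type*} [AddCommGroup A] [CommRing R] (N : A → R) : Prop :=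
  N 0 = 0 ∧ ∀ p q r s : A,
    N (p + q + s) * N (p - q) * N (r + s) * N r
      + N (q + r + s) * N (q - r) * N (p + s) * N p
      + N (r + p + s) * N (r - p) * N (q + s) * N q = 0

/-- Values of a rank two net on one half of the square `|a|, |b| ≤ 2` (and `0` elsewhere), in terms
of `d = Ψ(1,-1)`, `c₁ = Ψ(2,0)`, `c₂ = Ψ(0,2)`, `t₁ = Ψ(2,1)`, `t₂ = Ψ(1,2)`, `s = Ψ(2,2)`. -/
def netHalf {R : Type*} [CommRing R] (d c₁ c₂ t₁ t₂ s : R) : ℤ → ℤ → R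
  | 1, 0 => 1
  | 0, 1 => 1
  | 1, 1 => 1
  | 1, -1 => d
  | 2, 0 => c₁
  | 0, 2 => c₂
  | 2, 1 => t₁
  | 1, 2 => t₂
  | 2, 2 => s
  | 2, -1 => c₁ * c₂ - t₁ * d ^ 2
  | 1, -2 => t₂ * d ^ 2 - c₁ * c₂
  | 2, -2 => d * (c₂ * (c₁ * c₂ - t₁ * d ^ 2) - c₁ * (t₂ * d ^ 2 - c₁ * c₂))
  | _, _ => 0

/-- The rank two elliptic net generated by its initial values.  Every clause outside the square
`|a|, |b| ≤ 2` is an instance of the elliptic net recurrence in which the coefficient of the value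
being computed is a product of values at `(1,0)`, `(0,1)` and `(1,1)`, all of them equal to `1`.
(Integer division rounds down.) -/
def netRec {R : Type*} [CommRing R] (d c₁ c₂ t₁ t₂ s : R) (a b : ℤ) : R :=
  if h : |a| ≤ 2 ∧ |b| ≤ 2 then
    netHalf d c₁ c₂ t₁ t₂ s a b - netHalf d c₁ c₂ t₁ t₂ s (-a) (-b)
  else
    if a % 2 = 0 then
      if b % 2 = 0 then
        netRec d c₁ c₂ t₁ t₂ s (a / 2) (b / 2) *
          (netRec d c₁ c₂ t₁ t₂ s (a / 2 + 1) (b / 2 + 1)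
              * netRec d c₁ c₂ t₁ t₂ s (a / 2 - 1) (b / 2)
              * netRec d c₁ c₂ t₁ t₂ s (a / 2) (b / 2 - 1)
            - netRec d c₁ c₂ t₁ t₂ s (a / 2 + 1) (b / 2)
              * netRec d c₁ c₂ t₁ t₂ s (a / 2) (b / 2 + 1)
              * netRec d c₁ c₂ t₁ t₂ s (a / 2 - 1) (b / 2 - 1))
      else
        netRec d c₁ c₂ t₁ t₂ s (a / 2 + 1) (b / 2 + 1)
            * netRec d c₁ c₂ t₁ t₂ s (a / 2 - 1) (b / 2 + 1)
            * netRec d c₁ c₂ t₁ t₂ s (a / 2) (b / 2) ^ 2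
          - netRec d c₁ c₂ t₁ t₂ s (a / 2 + 1) (b / 2)
            * netRec d c₁ c₂ t₁ t₂ s (a / 2 - 1) (b / 2)
            * netRec d c₁ c₂ t₁ t₂ s (a / 2) (b / 2 + 1) ^ 2
    else
      if b % 2 = 0 then
        netRec d c₁ c₂ t₁ t₂ s (a / 2 + 1) (b / 2 + 1)
            * netRec d c₁ c₂ t₁ t₂ s (a / 2 + 1) (b / 2 - 1)
            * netRec d c₁ c₂ t₁ t₂ s (a / 2) (b / 2) ^ 2
          - netRec d c₁ c₂ t₁ t₂ s (a / 2) (b / 2 + 1)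
            * netRec d c₁ c₂ t₁ t₂ s (a / 2) (b / 2 - 1)
            * netRec d c₁ c₂ t₁ t₂ s (a / 2 + 1) (b / 2) ^ 2
      else
        if a.natAbs ≤ b.natAbs then
          netRec d c₁ c₂ t₁ t₂ s (a / 2 + 2) (b / 2 + 1)
              * netRec d c₁ c₂ t₁ t₂ s (a / 2) (b / 2 + 1)
              * netRec d c₁ c₂ t₁ t₂ s (a / 2) (b / 2) ^ 2
            - netRec d c₁ c₂ t₁ t₂ s (a / 2 + 1) (b / 2)
              * netRec d c₁ c₂ t₁ t₂ s (a / 2 - 1) (b / 2)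
              * netRec d c₁ c₂ t₁ t₂ s (a / 2 + 1) (b / 2 + 1) ^ 2
        else
          netRec d c₁ c₂ t₁ t₂ s (a / 2 + 1) (b / 2 + 2)
              * netRec d c₁ c₂ t₁ t₂ s (a / 2 + 1) (b / 2)
              * netRec d c₁ c₂ t₁ t₂ s (a / 2) (b / 2) ^ 2
            - netRec d c₁ c₂ t₁ t₂ s (a / 2) (b / 2 + 1)
              * netRec d c₁ c₂ t₁ t₂ s (a / 2) (b / 2 - 1)
              * netRec d c₁ c₂ t₁ t₂ s (a / 2 + 1) (b / 2 + 1) ^ 2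
termination_by a.natAbs + b.natAbs + max a.natAbs b.natAbs
decreasing_by all_goals (simp only [abs_le] at *; omega)

/-- Value `Ψ_(a,b)(P, Q)` of the `(a,b)`-th net polynomial at two affine points with different
`x`-coordinates: the elliptic net with the standard initial values
`Ψ(1,0) = Ψ(0,1) = Ψ(1,1) = 1`, `Ψ(2,0) = 2y₁ + a₁x₁ + a₃`, `Ψ(0,2) = 2y₂ + a₁x₂ + a₃`,
`Ψ(2,1) = 2x₁ + x₂ - ℓ² - a₁ℓ + a₂` and `Ψ(1,2) = 2x₂ + x₁ - ℓ² - a₁ℓ + a₂`, where `ℓ` is the slope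
of the line `PQ`.  The recurrence then forces `Ψ(1,-1) = Ψ(1,2) - Ψ(2,1) = x₂ - x₁` and
`Ψ(2,2) Ψ(1,-1) = Ψ(2,1) Ψ(0,2) - Ψ(1,2) Ψ(2,0)`; see `netPolynomial_unique`.
The value is `0` by convention if `P` or `Q` is the point at infinity. -/
noncomputable def netPolynomial {F : Type*} [Field F] (W : Affine F) :
    W.Point → W.Point → ℤ → ℤ → F
  | .some x₁ y₁ _, .some x₂ y₂ _, a, b =>
    let l := (y₂ - y₁) / (x₂ - x₁)
    let c₁ := 2 * y₁ + W.a₁ * x₁ + W.a₃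
    let c₂ := 2 * y₂ + W.a₁ * x₂ + W.a₃
    let t₁ := 2 * x₁ + x₂ - l ^ 2 - W.a₁ * l + W.a₂
    let t₂ := 2 * x₂ + x₁ - l ^ 2 - W.a₁ * l + W.a₂
    netRec (x₂ - x₁) c₁ c₂ t₁ t₂ ((t₁ * c₂ - t₂ * c₁) / (x₂ - x₁)) a b
  | _, _, _, _ => 0

theorem IsEllipticNetOn.odd {A R : Type*} [AddCommGroup A] [CommRing R] [IsDomain R] {N : A → R}
    (hN : IsEllipticNetOn N) (u : A) : N (-u) = -N u := by
  have key : ∀ w : A, N w ^ 3 * (N w + N (-w)) = 0 := fun w ↦ by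
    have h := hN.2 w w 0 0
    simp only [add_zero, sub_zero, zero_add, zero_sub, sub_self, hN.1] at h
    linear_combination h
  rcases mul_eq_zero.1 (key u) with h | h
  · have h1 : N u = 0 := by simpa using h
    rcases mul_eq_zero.1 (key (-u)) with h' | h'
    · have h2 : N (-u) = 0 := by simpa using h'
      rw [h1, h2, neg_zero]
    · rw [neg_neg] at h'
      linear_combination h'
  · linear_combination h

theorem IsEllipticNetOn.eq_netRec {F : Type*} [Field F] {N : ℤ × ℤ → F}
    (hN : IsEllipticNetOn N) (h10 : N (1, 0) = 1) (h01 : N (0, 1) = 1) (h11 : N (1, 1) = 1)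
    (a b : ℤ) :
    N (a, b) = netRec (N (1, -1)) (N (2, 0)) (N (0, 2)) (N (2, 1)) (N (1, 2)) (N (2, 2)) a b := by
  have rel : ∀ a b c d e f g h : ℤ,
      N (a + c + g, b + d + h) * N (a - c, b - d) * N (e + g, f + h) * N (e, f)
      + N (c + e + g, d + f + h) * N (c - e, d - f) * N (a + g, b + h) * N (a, b)
      + N (e + a + g, f + b + h) * N (e - a, f - b) * N (c + g, d + h) * N (c, d) = 0 :=
    fun a b c d e f g h ↦ hN.2 (a, b) (c, d) (e, f) (g, h)
  have odd : ∀ a b : ℤ, N (-a, -b) = - N (a, b) := fun a b ↦ hN.odd (a, b)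
  have h00 : N (0, 0) = 0 := hN.1
  have h0m : N (0, -1) = -1 := by simpa [h01] using odd 0 1
  have h0m2 : N (0, -2) = -N (0, 2) := by simpa using odd 0 2
  have hm1 : N (-1, 0) = -1 := by simpa [h10] using odd 1 0
  have w1 : N (2, -1) = N (2, 0) * N (0, 2) - N (2, 1) * N (1, -1) ^ 2 := by
    have h := rel 1 0 1 (-1) 1 1 0 0
    norm_num at h
    rw [h0m2, h10, h01, h11] at h
    linear_combination h
  have w2 : N (1, -2) = N (1, 2) * N (1, -1) ^ 2 - N (2, 0) * N (0, 2) := by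
    have h := rel 0 1 (-1) 1 1 1 0 0
    have o1 := odd 1 (-2)
    have o2 := odd 2 0
    have o3 := odd 1 (-1)
    norm_num at h o1 o2 o3
    rw [o1, o2, o3, h10, h01, h11] at h
    linear_combination -h
  have w3 : N (2, -2) = N (1, -1) * (N (0, 2) * N (2, -1) - N (2, 0) * N (1, -2)) := by
    have h := rel 1 (-1) 1 (-2) 1 0 0 1
    norm_num at h
    rw [h0m2, h01, h10, h11] at h
    linear_combination h
  fun_induction netRec (N (1, -1)) (N (2, 0)) (N (0, 2)) (N (2, 1)) (N (1, 2)) (N (2, 2)) a b with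
  | case1 a b h =>
    obtain ⟨ha, hb⟩ := h
    rw [abs_le] at ha hb
    have hodd := odd a b
    obtain ⟨ha1, ha2⟩ := ha
    obtain ⟨hb1, hb2⟩ := hb
    interval_cases a <;> interval_cases b <;>
      try simp only [Int.reduceNeg, neg_neg, neg_zero, h00, h10, h01, h11, w1, w2, w3] at hodd
    all_goals simp [netHalf, h00, h10, h01, h11, h0m, h0m2, hm1, w1, w2, w3]
    all_goals linear_combination hodd
  | case2 a b h ha hb ih1 ih2 ih3 ih4 ih5 ih6 ih7 =>
    simp only [← ih1, ← ih2, ← ih3, ← ih4, ← ih5, ← ih6, ← ih7]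
    clear ih1 ih2 ih3 ih4 ih5 ih6 ih7
    have ea : a = 2 * (a / 2) := by omega
    have eb : b = 2 * (b / 2) := by omega
    generalize a / 2 = m at ea ⊢
    generalize b / 2 = n at eb ⊢
    subst ea eb
    have h := rel m n m (n - 1) 1 0 0 1
    have o := odd (m - 1) n
    simp only [sub_self, sub_sub_cancel, add_zero, zero_add, h10, h01, h11] at h
    linear_combination (norm := ring_nf) h - N (m+1,n+1) * N (m, n) * N (m, n-1) * o
  | case3 a b h ha hb ih1 ih2 ih3 ih4 ih5 ih6 =>
    simp only [← ih1, ← ih2, ← ih3, ← ih4, ← ih5, ← ih6]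
    clear ih1 ih2 ih3 ih4 ih5 ih6
    have ea : a = 2 * (a / 2) := by omega
    have eb : b = 2 * (b / 2) + 1 := by omega
    generalize a / 2 = m at ea ⊢
    generalize b / 2 = n at eb ⊢
    subst ea eb
    have h := rel m (n + 1) m n 1 0 0 0
    have o := odd (m - 1) (n + 1)
    simp only [sub_self, add_sub_cancel_left, add_zero, zero_add, h10, h01] at h
    linear_combination (norm := ring_nf) h - N (m + 1, n + 1) * N (m, n) ^ 2 * o
  | case4 a b h ha hb ih1 ih2 ih3 ih4 ih5 ih6 =>
    simp only [← ih1, ← ih2, ← ih3, ← ih4, ← ih5, ← ih6]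
    clear ih1 ih2 ih3 ih4 ih5 ih6
    have ea : a = 2 * (a / 2) + 1 := by omega
    have eb : b = 2 * (b / 2) := by omega
    generalize a / 2 = m at ea ⊢
    generalize b / 2 = n at eb ⊢
    subst ea eb
    have h := rel (m + 1) n m n 0 1 0 0
    have o := odd (m + 1) (n - 1)
    simp only [sub_self, add_sub_cancel_left, add_zero, zero_add, h10, h01] at h
    linear_combination (norm := ring_nf) h - N (m + 1, n + 1) * N (m, n) ^ 2 * o
  | case5 a b h ha hb hab ih1 ih2 ih3 ih4 ih5 ih6 =>
    simp only [← ih1, ← ih2, ← ih3, ← ih4, ← ih5, ← ih6]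
    clear ih1 ih2 ih3 ih4 ih5 ih6
    have ea : a = 2 * (a / 2) + 1 := by omega
    have eb : b = 2 * (b / 2) + 1 := by omega
    generalize a / 2 = m at ea ⊢
    generalize b / 2 = n at eb ⊢
    subst ea eb
    have h := rel (m + 1) (n + 1) m n 1 0 0 0
    have o := odd m (n + 1)
    simp only [add_sub_cancel_left, add_zero, zero_add, h10, h11] at h
    linear_combination (norm := ring_nf) h - N (m + 2, n + 1) * N (m, n) ^ 2 * o
  | case6 a b h ha hb hab ih1 ih2 ih3 ih4 ih5 ih6 =>
    simp only [← ih1, ← ih2, ← ih3, ← ih4, ← ih5, ← ih6]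
    clear ih1 ih2 ih3 ih4 ih5 ih6
    have ea : a = 2 * (a / 2) + 1 := by omega
    have eb : b = 2 * (b / 2) + 1 := by omega
    generalize a / 2 = m at ea ⊢
    generalize b / 2 = n at eb ⊢
    subst ea eb
    have h := rel (m + 1) (n + 1) m n 0 1 0 0
    have o := odd (m + 1) n
    simp only [add_sub_cancel_left, add_zero, zero_add, h01, h11] at h
    linear_combination (norm := ring_nf) h - N (m + 1, n + 2) * N (m, n) ^ 2 * o

/-- Any elliptic net with the standard initial values at `P` and `Q` is given by `netPolynomial`. -/
theorem netPolynomial_unique {F : Type*} [Field F] (W : Affine F) {x₁ y₁ x₂ y₂ : F}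
    (h₁ : W.Nonsingular x₁ y₁) (h₂ : W.Nonsingular x₂ y₂) (hx : x₁ ≠ x₂) {N : ℤ × ℤ → F}
    (hN : IsEllipticNetOn N) (h10 : N (1, 0) = 1) (h01 : N (0, 1) = 1) (h11 : N (1, 1) = 1)
    (h20 : N (2, 0) = 2 * y₁ + W.a₁ * x₁ + W.a₃) (h02 : N (0, 2) = 2 * y₂ + W.a₁ * x₂ + W.a₃)
    (h21 : N (2, 1) = 2 * x₁ + x₂ - ((y₂ - y₁) / (x₂ - x₁)) ^ 2
      - W.a₁ * ((y₂ - y₁) / (x₂ - x₁)) + W.a₂)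
    (h12 : N (1, 2) = 2 * x₂ + x₁ - ((y₂ - y₁) / (x₂ - x₁)) ^ 2
      - W.a₁ * ((y₂ - y₁) / (x₂ - x₁)) + W.a₂) (a b : ℤ) :
    N (a, b) = netPolynomial W (.some x₁ y₁ h₁) (.some x₂ y₂ h₂) a b := by
  have hd : N (1, -1) = x₂ - x₁ := by
    have h := hN.2 (1, 0) (0, 1) (1, 1) (0, 0)
    have o := hN.odd (1, 0)
    norm_num at h o
    rw [o, h10, h01, h11, h12, h21] at h
    linear_combination h
  have hx' : x₂ - x₁ ≠ 0 := sub_ne_zero.2 hx.symm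
  have hs : N (2, 2) = (N (2, 1) * N (0, 2) - N (1, 2) * N (2, 0)) / (x₂ - x₁) := by
    rw [eq_div_iff hx', ← hd]
    have h := hN.2 (2, 0) (1, 1) (1, 0) (-1, 1)
    have o := hN.odd (1, 0)
    norm_num at h o
    rw [o, h10, h01, h11] at h
    linear_combination h
  rw [hN.eq_netRec h10 h01 h11, hs, hd, h20, h02, h21, h12]
  rfl

/-! ### Local Néron heights -/

/-- The additive valuation attached to a `ℤᵐ⁰`-valued one (`exp (-n) ↦ n`).
Only its values at nonzero elements matter. -/
def addVal (z : WithZero (Multiplicative ℤ)) : ℤ := -WithZero.log z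

open WithZero in
/-- `lam` is the local Néron height function on the elliptic curve `W` over the (complete) discretely
valued field `L`, with additive valuation `u = addVal ∘ Valued.v`.  The value of `lam` at the point
`O` at infinity is irrelevant.  The `u`-adic neighbourhoods of `O` are the sets of points containing
`O` and all points `(x, y)` with `|x|` large enough. -/
structure IsLocalNeronHeight {L : Type*} [Field L] [DecidableEq L] [Valued L ℤᵐ⁰]
    (W : Affine L) (lam : W.Point → ℝ) : Prop where
  continuous : Continuous fun p : {p : L × L // W.Nonsingular p.1 p.2} ↦
    lam (.some p.1.1 p.1.2 p.2)
  bounded : ∀ N : ℤ, ∃ B : ℝ, ∀ (x y : L) (h : W.Nonsingular x y),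
    Valued.v x ≤ exp N → |lam (.some x y h)| ≤ B
  limit : ∃ c : ℝ, ∀ ε : ℝ, 0 < ε → ∃ N : ℤ, ∀ (x y : L) (h : W.Nonsingular x y),
    exp N < Valued.v x → |lam (.some x y h) + (1 / 2 : ℝ) * addVal (Valued.v x) - c| < ε
  duplication : ∀ (x y : L) (h : W.Nonsingular x y), 2 • Affine.Point.some x y h ≠ 0 →
    lam (2 • Affine.Point.some x y h) = 4 * lam (.some x y h)
      + addVal (Valued.v (2 * y + W.a₁ * x + W.a₃)) - (1 / 4 : ℝ) * addVal (Valued.v W.Δ)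

/-- The normalised height `lam(P) - u(Δ) / 12` of a `K`-rational point, for a function `lam` on the
points over the completion of `K` at `v`. -/
noncomputable def normalisedHeight {K : Type*} [Field K] [NumberField K] [DecidableEq K]
    (W : WeierstrassCurve K) (v : HeightOneSpectrum (𝓞 K)) [DecidableEq (v.adicCompletion K)]
    (lam : Affine.Point (W⁄(v.adicCompletion K)) → ℝ) (P : Affine.Point (W⁄K)) : ℝ :=
  lam (Affine.Point.baseChange K (v.adicCompletion K) P)
    - (1 / 12 : ℝ) * addVal (v.valuation K W.Δ)

/-! ### Endomorphisms and complex multiplication -/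

/-- `φ` is an endomorphism of the elliptic curve `W` over an algebraically closed field: a group
homomorphism that is zero or is given by rational functions of the coordinates at all but finitely
many points. -/
def IsCurveEndomorphism {L : Type*} [Field L] [IsAlgClosed L] [DecidableEq L] (W : Affine L)
    (φ : AddMonoid.End W.Point) : Prop :=
  φ = 0 ∨ ∃ f₁ g₁ f₂ g₂ : L[X][Y],
    {P : W.Point | ¬ ∃ (x y : L) (h : W.Nonsingular x y) (h' : W.Nonsingular
        (f₁.evalEval x y / g₁.evalEval x y) (f₂.evalEval x y / g₂.evalEval x y)),
      P = .some x y h ∧ g₁.evalEval x y ≠ 0 ∧ g₂.evalEval x y ≠ 0 ∧ φ P = .some _ _ h'}.Finite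

/-- `θ` is an isomorphism of the ring `R` with the endomorphism ring of `W`. -/
def IsEndIsomorphism {L : Type*} [Field L] [IsAlgClosed L] [DecidableEq L] (W : Affine L)
    {R : Type*} [CommRing R] (θ : R →+* AddMonoid.End W.Point) : Prop :=
  Function.Injective θ ∧ ∀ φ, IsCurveEndomorphism W φ ↔ ∃ r, θ r = φ

/-!
# Local heights and net polynomials

Let `P` and `Q` be independent points of a Weierstrass curve over a field, and write `x(a, b)` for
the `x`-coordinate of `aP + bQ`.

*The net.* The net of `P` and `Q` is constructed without function theory. The recurrences
`N(u + w) N(u - w) = N(u)² N(w)² (x(w) - x(u))` with `w = (1, 0)` and `w = (0, 1)` determine an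
array `N` from its initial values (`exists_isBasicNet`). They are compatible because
`(x_U - x_V)² (x_W - x_{U+V}) (x_W - x_{U-V})` is a symmetric polynomial in `x_U`, `x_V`, `x_W`
(`biquadratic`), and the same symmetry propagates the recurrence to all pairs `u`, `w`
(`IsBasicNet.rel`). This gives every instance of the elliptic net recurrence that enters the
definition of `netRec`, except for the formula for `N(2u)`, in which the sign of a square root
matters. That one comes from `N(u + p + q) N(u - p) N(u - q) = N(u)³ ℓ(uP)`, with `ℓ` the equation
of the line through `P` and `Q` (`IsBasicNet.chordRel`): the difference of the values of `ℓ` at two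
opposite points is the value of `ψ₂`. Hence `N` is the net polynomial
(`IsBasicNet.eq_netPolynomial`).

*The height of independent points.* Over a discretely valued field let `λ` be the normalised height
and let `F(A, B) = λ(A + B) + λ(A - B) - 2λ(A) - 2λ(B) - ν(x_A - x_B)`. The conditions on a local
height give `λ = ½ log max(1, |x|) + O(1)`, and the addition formulas then bound `F` from above.
By the duplication formula `F(A + B, A - B) = -2 F(A, B)`, so that `F` vanishes as long as all these
values are defined (`defect_eq_zero`). Therefore both sides of the asserted formula satisfy the same
second order recurrences in `a` and in `b`, and they agree (`tildeHeight_eq_of_independent`).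

*All points.* Over a complete nontrivially valued field of characteristic zero the torsion points
are countable (`countable_torsion`) whereas neighbourhoods of points are not, so every pair of
affine points is a limit of independent pairs (`nhdsIndependent_neBot`). The group law, the net
polynomials and the height are continuous, and the formula passes to the limit. There the net
polynomial does not vanish, because its valuation converges to a finite value (`tildeHeight_eq`).

*Complex multiplication.* A nonzero element of an order divides a nonzero integer and so does not
annihilate a point of infinite order (`ringHom_apply_ne_zero`). This verifies the hypotheses of the
general formula for `P` and `[ω]P`.
-/

/-! ### Addition formulas in coordinates -/

namespace WeierstrassCurve.Affine.Point

section Coordinates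

variable {F : Type*} [Field F] {W : Affine F}

/-- The `x`-coordinate of a point, with value `0` at the point at infinity. -/
def xCoord : W.Point → F
  | .zero => 0
  | .some x _ _ => x

/-- The `y`-coordinate of a point, with value `0` at the point at infinity. -/
def yCoord : W.Point → F
  | .zero => 0
  | .some _ y _ => y

/-- The function `ψ₂ = 2y + a₁x + a₃`, with value `0` at the point at infinity. -/
def psiTwo : W.Point → F
  | .zero => 0
  | .some x y _ => 2 * y + W.a₁ * x + W.a₃

@[simp] lemma xCoord_some {x y : F} (h : W.Nonsingular x y) : xCoord (.some x y h) = x := rfl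
@[simp] lemma yCoord_some {x y : F} (h : W.Nonsingular x y) : yCoord (.some x y h) = y := rfl
@[simp] lemma psiTwo_some {x y : F} (h : W.Nonsingular x y) :
    psiTwo (.some x y h) = 2 * y + W.a₁ * x + W.a₃ := rfl

@[simp] lemma xCoord_neg (A : W.Point) : xCoord (-A) = xCoord A := by
  cases A <;> rfl

@[simp] lemma psiTwo_neg (A : W.Point) : psiTwo (-A) = -psiTwo A := by
  rcases A with _ | ⟨x, y, h⟩
  · exact (_root_.neg_zero (G := F)).symm
  · simp only [neg_some, psiTwo_some, negY]
    ring

lemma nonsingular_coords {A : W.Point} (hA : A ≠ 0) : W.Nonsingular (xCoord A) (yCoord A) := by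
  rcases A with _ | ⟨x, y, h⟩
  · exact (hA rfl).elim
  · exact h

lemma eq_some {A : W.Point} (hA : A ≠ 0) :
    A = .some (xCoord A) (yCoord A) (nonsingular_coords hA) := by
  rcases A with _ | ⟨x, y, h⟩
  · exact (hA rfl).elim
  · rfl

lemma equation_coords {A : W.Point} (hA : A ≠ 0) :
    yCoord A ^ 2 + W.a₁ * xCoord A * yCoord A + W.a₃ * yCoord A
      = xCoord A ^ 3 + W.a₂ * xCoord A ^ 2 + W.a₄ * xCoord A + W.a₆ :=
  (W.equation_iff ..).1 (nonsingular_coords hA).1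

lemma psiTwo_eq {A : W.Point} (hA : A ≠ 0) :
    psiTwo A = 2 * yCoord A + W.a₁ * xCoord A + W.a₃ := by
  rcases A with _ | ⟨x, y, h⟩
  · exact (hA rfl).elim
  · rfl

lemma yCoord_neg {A : W.Point} (hA : A ≠ 0) :
    yCoord (-A) = -yCoord A - W.a₁ * xCoord A - W.a₃ := by
  rcases A with _ | ⟨x, y, h⟩
  · exact (hA rfl).elim
  · rfl

lemma xCoord_eq_iff {A B : W.Point} (hA : A ≠ 0) (hB : B ≠ 0) :
    xCoord A = xCoord B ↔ A = B ∨ A = -B := by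
  rcases A with _ | ⟨x, y, h⟩
  · exact (hA rfl).elim
  rcases B with _ | ⟨x', y', h'⟩
  · exact (hB rfl).elim
  exact X_eq_iff

lemma psiTwo_sq {A : W.Point} (hA : A ≠ 0) :
    psiTwo A ^ 2 = 4 * xCoord A ^ 3 + W.b₂ * xCoord A ^ 2 + 2 * W.b₄ * xCoord A + W.b₆ := by
  rw [psiTwo_eq hA, b₂, b₄, b₆]
  linear_combination 4 * equation_coords hA

/-- The form `(u - v)² (w - x(A + B)) (w - x(A - B))` for points `A`, `B` with `x`-coordinates `u`
and `v`; it is symmetric in `u`, `v`, `w`. -/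
def biquadratic (W : Affine F) (u v w : F) : F :=
  (u * v + v * w + w * u) ^ 2 - 4 * u * v * w * (u + v + w) - W.b₂ * (u * v * w)
    - W.b₄ * (u * v + v * w + w * u) - W.b₆ * (u + v + w) - W.b₈

lemma biquadratic_swap₂₃ (u v w : F) : biquadratic W u v w = biquadratic W u w v := by
  rw [biquadratic, biquadratic]; ring

lemma biquadratic_swap₁₂ (u v w : F) : biquadratic W u v w = biquadratic W v u w := by
  rw [biquadratic, biquadratic]; ring

/-- The value at `U` of the equation `y - y(P) - ℓ (x - x(P))` of the line through `P` and `Q`. -/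
def chord (P Q U : W.Point) : F :=
  yCoord U - yCoord P - (yCoord P - yCoord Q) / (xCoord P - xCoord Q) * (xCoord U - xCoord P)

lemma chord_comm {P Q U : W.Point} (h : xCoord P - xCoord Q ≠ 0) : chord P Q U = chord Q P U := by
  have h' : xCoord Q - xCoord P ≠ 0 := by rw [← neg_sub]; exact neg_ne_zero.2 h
  rw [chord, chord]
  field_simp
  ring

lemma chord_sub_chord_neg {P Q U : W.Point} (hU : U ≠ 0) :
    chord P Q U - chord P Q (-U) = psiTwo U := by
  rw [chord, chord, psiTwo_eq hU, yCoord_neg hU, xCoord_neg]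
  ring

lemma chord_neg_left {P Q : W.Point} (hP : P ≠ 0) : chord P Q (-P) = -psiTwo P := by
  rw [chord, psiTwo_eq hP, yCoord_neg hP, xCoord_neg]
  ring

variable [DecidableEq F]

lemma xCoord_sub_ne_zero {A B : W.Point} (hA : A ≠ 0) (hB : B ≠ 0) (h₁ : A - B ≠ 0)
    (h₂ : A + B ≠ 0) : xCoord A - xCoord B ≠ 0 := by
  rw [sub_ne_zero, Ne, xCoord_eq_iff hA hB, not_or]
  exact ⟨sub_ne_zero.1 h₁, fun h ↦ h₂ (by rw [h, neg_add_cancel])⟩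

lemma psiTwo_ne_zero {A : W.Point} (hA : A + A ≠ 0) : psiTwo A ≠ 0 := by
  have h0 : A ≠ 0 := by rintro rfl; exact hA (add_zero 0)
  intro h
  refine hA ?_
  rw [eq_some h0]
  refine add_of_Y_eq rfl ?_
  rw [psiTwo_eq h0] at h
  rw [negY]
  linear_combination h

section Secant

variable {A B : W.Point}

lemma add_ne_zero_of_xCoord (h : xCoord A - xCoord B ≠ 0) : A + B ≠ 0 := fun h0 ↦
  h (by rw [eq_neg_of_add_eq_zero_left h0, xCoord_neg, sub_self])

lemma sub_ne_zero_of_xCoord (h : xCoord A - xCoord B ≠ 0) : A - B ≠ 0 := fun h0 ↦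
  h (by rw [sub_eq_zero.1 h0, sub_self])

variable (hA : A ≠ 0) (hB : B ≠ 0) (h : xCoord A - xCoord B ≠ 0)
include hA hB h

lemma add_eq_some_secant : ∃ hn, A + B = .some
    (W.addX (xCoord A) (xCoord B) ((yCoord A - yCoord B) / (xCoord A - xCoord B)))
    (W.addY (xCoord A) (xCoord B) (yCoord A)
      ((yCoord A - yCoord B) / (xCoord A - xCoord B))) hn := by
  rcases A with _ | ⟨x, y, hxy⟩
  · exact (hA rfl).elim
  rcases B with _ | ⟨x', y', hxy'⟩
  · exact (hB rfl).elim
  have hx : x ≠ x' := sub_ne_zero.1 h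
  rw [add_of_X_ne hx]
  have hn := nonsingular_add hxy hxy' fun e ↦ hx e.1
  simp only [xCoord_some, yCoord_some]
  simp only [slope_of_X_ne hx] at hn ⊢
  exact ⟨hn, trivial⟩

lemma xCoord_add : xCoord (A + B) = ((yCoord A - yCoord B) / (xCoord A - xCoord B)) ^ 2
    + W.a₁ * ((yCoord A - yCoord B) / (xCoord A - xCoord B)) - W.a₂ - xCoord A - xCoord B := by
  obtain ⟨hn, e⟩ := add_eq_some_secant hA hB h
  rw [e]; rfl

lemma yCoord_add : yCoord (A + B) = -(yCoord A
    + (yCoord A - yCoord B) / (xCoord A - xCoord B) * (xCoord (A + B) - xCoord A))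
    - W.a₁ * xCoord (A + B) - W.a₃ := by
  obtain ⟨hn, e⟩ := add_eq_some_secant hA hB h
  rw [e]
  simp only [xCoord_some, yCoord_some, addY, negAddY, negY]
  ring

lemma xCoord_sub : xCoord (A - B) =
    ((yCoord A + yCoord B + W.a₁ * xCoord B + W.a₃) / (xCoord A - xCoord B)) ^ 2
    + W.a₁ * ((yCoord A + yCoord B + W.a₁ * xCoord B + W.a₃) / (xCoord A - xCoord B))
    - W.a₂ - xCoord A - xCoord B := by
  rw [sub_eq_add_neg, xCoord_add hA (neg_ne_zero.2 hB) (by rwa [xCoord_neg]), yCoord_neg hB,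
    xCoord_neg]
  ring

/-- The sum and, in `xCoord_add_mul_xCoord_sub`, the product of `x(A + B)` and `x(A - B)` are
symmetric rational functions of `x(A)` and `x(B)`. -/
lemma xCoord_add_add_xCoord_sub :
    (xCoord A - xCoord B) ^ 2 * (xCoord (A + B) + xCoord (A - B))
      = 2 * (xCoord A + xCoord B) * (xCoord A * xCoord B) + W.b₂ * (xCoord A * xCoord B)
        + W.b₄ * (xCoord A + xCoord B) + W.b₆ := by
  have e₁ := equation_coords hA
  have e₂ := equation_coords hB
  rw [xCoord_add hA hB h, xCoord_sub hA hB h, b₂, b₄, b₆]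
  field_simp
  linear_combination 2 * e₁ + 2 * e₂

/-- The difference of `x(A - B)` and `x(A + B)` is the only one of their basic combinations which
sees the `y`-coordinates; it links the recurrences for `N (u + w) N (u - w)` with `N (2u)`. -/
lemma xCoord_sub_sub_xCoord_add :
    (xCoord A - xCoord B) ^ 2 * (xCoord (A - B) - xCoord (A + B)) = psiTwo A * psiTwo B := by
  rw [xCoord_add hA hB h, xCoord_sub hA hB h, psiTwo_eq hA, psiTwo_eq hB]
  field_simp
  ring

lemma xCoord_add_mul_xCoord_sub :
    (xCoord A - xCoord B) ^ 2 * (xCoord (A + B) * xCoord (A - B))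
      = (xCoord A * xCoord B) ^ 2 - W.b₄ * (xCoord A * xCoord B) - W.b₆ * (xCoord A + xCoord B)
        - W.b₈ := by
  have e₁ := equation_coords hA
  have e₂ := equation_coords hB
  rw [xCoord_add hA hB h, xCoord_sub hA hB h, b₄, b₆, b₈]
  generalize xCoord A = x at *
  generalize yCoord A = y at *
  generalize xCoord B = x' at *
  generalize yCoord B = y' at *
  have h2 : (x - x') ^ 2 ≠ 0 := pow_ne_zero 2 h
  apply mul_left_cancel₀ h2
  field_simp
  linear_combination (W.a₁ ^ 2 * x * x' - W.a₁ ^ 2 * x' ^ 2 + W.a₁ * W.a₃ * x - W.a₁ * W.a₃ * x'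
    + W.a₁ * x * y - 2 * W.a₁ * x' * y' - W.a₂ * x ^ 2 + 4 * W.a₂ * x * x' - 2 * W.a₂ * x' ^ 2
    + W.a₃ * y - 2 * W.a₃ * y' + W.a₄ * x + W.a₆ - x ^ 3 + 2 * x ^ 2 * x' + 2 * x * x' ^ 2 + y ^ 2
    - 2 * x' ^ 3 - 2 * y' ^ 2) * e₁ + (-W.a₁ ^ 2 * x ^ 2 + W.a₁ ^ 2 * x * x' - W.a₁ * W.a₃ * x
    + W.a₁ * W.a₃ * x' + W.a₁ * x' * y' - 4 * W.a₂ * x ^ 2 + 4 * W.a₂ * x * x' - W.a₂ * x' ^ 2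
    + W.a₃ * y' - 2 * W.a₄ * x + W.a₄ * x' - W.a₆ - 4 * x ^ 3 + 2 * x ^ 2 * x' + 2 * x * x' ^ 2
    - x' ^ 3 + y' ^ 2) * e₂

/-- The three `x`-coordinates of the points `A + B`, `A - B` and of a third point enter a form which
is symmetric in all three arguments (see `biquadratic`). -/
lemma sub_xCoord_add_mul_sub_xCoord_sub (w : F) :
    (xCoord A - xCoord B) ^ 2 * ((w - xCoord (A + B)) * (w - xCoord (A - B)))
      = biquadratic W (xCoord A) (xCoord B) w := by
  rw [biquadratic]
  linear_combination xCoord_add_mul_xCoord_sub hA hB h - w * xCoord_add_add_xCoord_sub hA hB h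

end Secant

/-- The duplication formula, multiplied by the square of `ψ₂`. -/
lemma psiTwo_sq_mul_xCoord_add_self {A : W.Point} (hA : A + A ≠ 0) :
    psiTwo A ^ 2 * xCoord (A + A)
      = xCoord A ^ 4 - W.b₄ * xCoord A ^ 2 - 2 * W.b₆ * xCoord A - W.b₈ := by
  rcases A with _ | ⟨x, y, h⟩
  · exact (hA (add_zero _)).elim
  have hy : y ≠ W.negY x y := fun e ↦ hA (add_self_of_Y_eq e)
  have e := (W.equation_iff ..).1 h.1
  have hp : y - W.negY x y ≠ 0 := sub_ne_zero.2 hy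
  rw [add_self_of_Y_ne hy]
  simp only [psiTwo_some, xCoord_some, addX, b₄, b₆, b₈]
  rw [slope_of_Y_ne rfl hy]
  have hq : 2 * y + W.a₁ * x + W.a₃ = y - W.negY x y := by rw [negY]; ring
  rw [hq]
  field_simp
  rw [← hq]
  linear_combination -(8 * x + 4 * W.a₂ + W.a₁ ^ 2) * e

/-- The degenerate case of `sub_xCoord_add_mul_sub_xCoord_sub` and the symmetry of `biquadratic`. -/
lemma psiTwo_sq_mul_sub {A : W.Point} (hA : A + A ≠ 0) (w : F) :
    psiTwo A ^ 2 * (xCoord (A + A) - w) = biquadratic W (xCoord A) w (xCoord A) := by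
  have h0 : A ≠ 0 := by rintro rfl; exact hA (add_zero 0)
  rw [biquadratic, mul_sub, psiTwo_sq_mul_xCoord_add_self hA, psiTwo_sq h0]
  ring

section Chord

variable {P Q U : W.Point} (hP : P ≠ 0) (hQ : Q ≠ 0) (h : xCoord P - xCoord Q ≠ 0)

include hP hQ h

lemma chord_add : chord P Q (P + Q) = psiTwo (P + Q) := by
  rw [chord, psiTwo_eq (add_ne_zero_of_xCoord h), yCoord_add hP hQ h]
  ring

/-- The norm of the equation of a line vanishes at its three points of intersection. -/
lemma chord_mul_chord_neg (hU : U ≠ 0) : chord P Q U * chord P Q (-U)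
    = (xCoord P - xCoord U) * (xCoord Q - xCoord U) * (xCoord (P + Q) - xCoord U) := by
  have e₁ := equation_coords hP
  have e₂ := equation_coords hQ
  have e := equation_coords hU
  rw [chord, chord, yCoord_neg hU, xCoord_neg, xCoord_add hP hQ h]
  generalize xCoord P = x₁ at *
  generalize xCoord Q = x₂ at *
  field_simp
  linear_combination -(x₁ - x₂) ^ 2 * e + (xCoord U - x₂) * (x₁ - x₂) * e₁
    - (xCoord U - x₁) * (x₁ - x₂) * e₂

/-- The value of the line through `P` and `Q` at `P - Q`, a starting value for the relation
`ChordRel`. -/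
lemma chord_sub : (xCoord Q - xCoord P) * chord P Q (P - Q)
    = - psiTwo P * (xCoord Q - xCoord (P - Q)) := by
  have hx : xCoord P - xCoord (-Q) ≠ 0 := by rwa [xCoord_neg]
  rw [chord, sub_eq_add_neg P, yCoord_add hP (neg_ne_zero.2 hQ) hx, ← sub_eq_add_neg,
    xCoord_sub hP hQ h, psiTwo_eq hP, yCoord_neg hQ, xCoord_neg]
  field_simp
  ring

set_option maxRecDepth 4000 in
/-- How the value of the line through `P` and `Q` changes under translation by `P`. This carries
the relation between a net and the values of the line from one column to the next. -/
lemma chord_mul_shift (hU : U ≠ 0) (h₁ : xCoord U - xCoord P ≠ 0) (h₂ : xCoord U - xCoord Q ≠ 0) :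
    chord P Q U * ((xCoord P - xCoord (U - P)) * (xCoord Q - xCoord (U - P)))
      = chord P Q (U - P) * ((xCoord P - xCoord (U + Q)) * (xCoord Q - xCoord U)) := by
  have e₁ := equation_coords hP
  have e₂ := equation_coords hQ
  have e := equation_coords hU
  set σ := (-yCoord U - W.a₁ * xCoord U - W.a₃ - yCoord P) / (xCoord U - xCoord P) with hσ
  have k₁ : chord P Q U * (xCoord Q - xCoord (U - P))
      = -(σ - (yCoord P - yCoord Q) / (xCoord P - xCoord Q))
        * ((xCoord P - xCoord (U + Q)) * (xCoord Q - xCoord U)) := by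
    rw [chord, xCoord_sub hU hP h₁, xCoord_add hU hQ h₂, hσ]
    clear_value σ
    clear hσ
    generalize xCoord U = x at *
    generalize yCoord U = y at *
    generalize xCoord P = x₁ at *
    generalize yCoord P = y₁ at *
    generalize xCoord Q = x₂ at *
    generalize yCoord Q = y₂ at *
    field_simp
    linear_combination (x - x₂) * ((- W.a₁ * x ^ 2 * x₁ + W.a₁ * x ^ 2 * x₂
      + W.a₁ * x * x₁ * x₂ - W.a₁
      * x * x₂ ^ 2 - W.a₃ * x * x₁ + W.a₃ * x * x₂ + W.a₃ * x₁ * x₂ - W.a₃ * x₂ ^ 2 - 2 * x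
      * y * x₁ + 2 * x * y * x₂ - x * x₁ * y₁ + x * x₁ * y₂ + x * y₁ * x₂ - x * x₂ * y₂ + y
      * x₁ ^ 2 - y * x₂ ^ 2 - x₁ ^ 2 * y₂ + x₁ * y₁ * x₂ + x₁ * x₂ * y₂ - y₁ * x₂ ^ 2) * e +
      (W.a₁ * x ^ 3 - 2 * W.a₁ * x ^ 2 * x₂ + W.a₁ * x * x₂ ^ 2 + W.a₃ * x ^ 2 - 2 * W.a₃ *
      x * x₂ + W.a₃ * x₂ ^ 2 + 2 * x ^ 2 * y + x ^ 2 * y₁ - x ^ 2 * y₂ - x * y * x₁ - 3 * x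
      * y * x₂ + x * x₁ * y₂ - 2 * x * y₁ * x₂ + x * x₂ * y₂ + y * x₁ * x₂ + y * x₂ ^ 2 - x₁
      * x₂ * y₂ + y₁ * x₂ ^ 2) * e₁ + (- W.a₁ * x ^ 3 + W.a₁ * x ^ 2 * x₁ + W.a₁ * x ^ 2 *
      x₂ - W.a₁ * x * x₁ * x₂ - W.a₃ * x ^ 2 + W.a₃ * x * x₁ + W.a₃ * x * x₂ - W.a₃ * x₁ *
      x₂ - 2 * x ^ 2 * y - x ^ 2 * y₁ + x ^ 2 * y₂ + 3 * x * y * x₁ + x * y * x₂ + x * x₁ *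
      y₁ - 2 * x * x₁ * y₂ + x * y₁ * x₂ - y * x₁ ^ 2 - y * x₁ * x₂ + x₁ ^ 2 * y₂ - x₁ * y₁
      * x₂) * e₂)
  have hx : xCoord U - xCoord (-P) ≠ 0 := by rwa [xCoord_neg]
  have k₂ : chord P Q (U - P) = (σ - (yCoord P - yCoord Q) / (xCoord P - xCoord Q))
      * (xCoord (U - P) - xCoord P) := by
    rw [chord, sub_eq_add_neg U, yCoord_add hU (neg_ne_zero.2 hP) hx, ← sub_eq_add_neg, xCoord_neg,
      yCoord_neg hP, xCoord_sub hU hP h₁, hσ]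
    field_simp
    ring
  rw [k₂]
  linear_combination (xCoord P - xCoord (U - P)) * k₁

end Chord

end Coordinates

end WeierstrassCurve.Affine.Point

/-! ### Two-sided sequences with prescribed multiplicative second differences -/

section Sequences

variable {F : Type*} [Field F]

/-- A two-sided sequence with prescribed nonzero successive quotients. -/
lemma exists_int_seq_mul (g : ℤ → F) (hg : ∀ n, g n ≠ 0) {c : F} (hc : c ≠ 0) :
    ∃ f : ℤ → F, f 0 = c ∧ (∀ n, f n ≠ 0) ∧ ∀ n, f (n + 1) = f n * g n := by
  refine ⟨fun n ↦ if 0 ≤ n then c * ∏ i ∈ Finset.range n.toNat, g i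
    else c / ∏ i ∈ Finset.range (-n).toNat, g (-(i + 1)), by simp, fun n ↦ ?_, fun n ↦ ?_⟩
  · dsimp only
    split_ifs
    · exact mul_ne_zero hc (Finset.prod_ne_zero_iff.2 fun i _ ↦ hg _)
    · exact div_ne_zero hc (Finset.prod_ne_zero_iff.2 fun i _ ↦ hg _)
  · rcases lt_trichotomy n (-1) with h | rfl | h
    · obtain ⟨k, rfl⟩ : ∃ k : ℕ, n = -(k + 2) := ⟨(-n - 2).toNat, by omega⟩
      have e₁ : (-(-(k + 2 : ℤ))).toNat = k + 1 + 1 := by omega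
      have e₂ : (-(-(k + 2 : ℤ) + 1)).toNat = k + 1 := by omega
      dsimp only
      rw [if_neg (by omega), if_neg (by omega), e₁, e₂, Finset.prod_range_succ _ (k + 1)]
      have := hg (-((k + 1 : ℕ) + 1))
      have e₃ : (-(k + 2) : ℤ) = -((k + 1 : ℕ) + 1) := by push_cast; ring
      rw [e₃]
      have h2 : ∏ i ∈ Finset.range (k + 1), g (-((i : ℤ) + 1)) ≠ 0 :=
        Finset.prod_ne_zero_iff.2 fun i _ ↦ hg _
      field_simp
    · have := hg (-1)
      simp [this]
    · obtain ⟨k, rfl⟩ : ∃ k : ℕ, n = k := ⟨n.toNat, by omega⟩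
      have e₁ : ((k : ℤ) + 1).toNat = k + 1 := by omega
      dsimp only
      rw [if_pos (by omega), if_pos (by omega), e₁, Int.toNat_natCast, Finset.prod_range_succ,
        mul_assoc]

/-- A two-sided nowhere vanishing sequence can be given two consecutive values and arbitrary nonzero
multiplicative second differences `g`. -/
lemma exists_int_seq (g : ℤ → F) (hg : ∀ n, g n ≠ 0) {α β : F} (hα : α ≠ 0) (hβ : β ≠ 0) :
    ∃ f : ℤ → F, f 0 = α ∧ f 1 = β ∧ (∀ n, f n ≠ 0) ∧
      ∀ n, f (n + 1) * f (n - 1) = f n ^ 2 * g n := by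
  obtain ⟨r, hr0, hr, hrr⟩ := exists_int_seq_mul (fun n ↦ g (n + 1)) (fun n ↦ hg _)
    (div_ne_zero hβ hα)
  obtain ⟨f, hf0, hf, hff⟩ := exists_int_seq_mul r hr hα
  refine ⟨f, hf0, ?_, hf, fun n ↦ ?_⟩
  · rw [show (1 : ℤ) = 0 + 1 from rfl, hff, hf0, hr0, mul_div_cancel₀ _ hα]
  · have h₁ := hff n
    have h₂ := hff (n - 1)
    have h₃ := hrr (n - 1)
    rw [sub_add_cancel] at h₂ h₃
    rw [h₁, h₃, h₂]
    ring

/-- An odd sequence with prescribed second differences away from `0`. -/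
lemma exists_odd_int_seq (g : ℤ → F) (hg : ∀ n, 2 ≤ n → g n ≠ 0) (hg1 : g 1 = 0)
    (hneg : ∀ n, g (-n) = g n) {β : F} (hβ : β ≠ 0) :
    ∃ f : ℤ → F, f 1 = 1 ∧ f 2 = β ∧ (∀ n, f (-n) = - f n) ∧ (∀ n, n ≠ 0 → f n ≠ 0) ∧
      ∀ n, n ≠ 0 → f (n + 1) * f (n - 1) = f n ^ 2 * g n := by
  classical
  obtain ⟨s, hs0, hs1, hs, hss⟩ := exists_int_seq (fun n ↦ if 1 ≤ n then g (n + 1) else 1)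
    (fun n ↦ by
      split_ifs with h
      exacts [hg _ (by omega), one_ne_zero]) (one_ne_zero (α := F)) hβ
  set f : ℤ → F := fun n ↦ if 0 < n then s (n - 1) else if n < 0 then -s (-n - 1) else 0 with hf
  have hfneg : ∀ n, f (-n) = - f n := fun n ↦ by
    simp only [hf]
    rcases lt_trichotomy n 0 with h | rfl | h
    · rw [if_pos (by omega), if_neg (by omega), if_pos h, neg_neg]
    · simp
    · rw [if_neg (by omega), if_pos (by omega), if_pos h, neg_neg]
  have hpos : ∀ n, 0 < n → f (n + 1) * f (n - 1) = f n ^ 2 * g n := fun n hn ↦ by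
    rcases eq_or_lt_of_le (show 1 ≤ n by omega) with rfl | h
    · simp [hf, hg1]
    · have := hss (n - 1)
      rw [if_pos (by omega)] at this
      simp only [hf]
      rw [if_pos (by omega), if_pos (by omega), if_pos hn]
      convert this using 3 <;> ring_nf
  refine ⟨f, by simpa [hf] using hs0, by simpa [hf] using hs1, hfneg, fun n hn ↦ ?_, fun n hn ↦ ?_⟩
  · simp only [hf]
    split_ifs
    exacts [hs _, neg_ne_zero.2 (hs _), (hn (by omega)).elim]
  · rcases lt_or_gt_of_ne hn with h | h
    · have := hpos (-n) (by omega)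
      rw [hneg, hfneg, show -n + 1 = -(n - 1) by ring, show -n - 1 = -(n + 1) by ring, hfneg,
        hfneg] at this
      linear_combination this
    · exact hpos n h

lemma int_seq_unique_up {s t G : ℤ → F} {m : ℤ} (h₀ : s m = t m) (h₁ : s (m + 1) = t (m + 1))
    (hs : ∀ n, m ≤ n → s n ≠ 0) (rs : ∀ n, m < n → s (n + 1) * s (n - 1) = s n ^ 2 * G n)
    (rt : ∀ n, m < n → t (n + 1) * t (n - 1) = t n ^ 2 * G n) {n : ℤ} (hn : m ≤ n) :
    s n = t n := by
  suffices h : s n = t n ∧ s (n + 1) = t (n + 1) from h.1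
  induction n, hn using Int.leInduction with
  | base => exact ⟨h₀, h₁⟩
  | succ n hn ih =>
    refine ⟨ih.2, mul_right_cancel₀ (hs n hn) ?_⟩
    have e₁ := rs (n + 1) (by omega)
    have e₂ := rt (n + 1) (by omega)
    rw [add_sub_cancel_right] at e₁ e₂
    rw [e₁, ih.2, ← e₂, ih.1]

lemma int_seq_unique_down {s t G : ℤ → F} {m : ℤ} (h₀ : s m = t m) (h₁ : s (m - 1) = t (m - 1))
    (hs : ∀ n, n ≤ m → s n ≠ 0) (rs : ∀ n, n < m → s (n + 1) * s (n - 1) = s n ^ 2 * G n)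
    (rt : ∀ n, n < m → t (n + 1) * t (n - 1) = t n ^ 2 * G n) {n : ℤ} (hn : n ≤ m) :
    s n = t n := by
  have := int_seq_unique_up (s := fun k ↦ s (-k)) (t := fun k ↦ t (-k)) (G := fun k ↦ G (-k))
    (m := -m) (n := -n) (by simpa using h₀)
    (by simpa [show -(-m + 1) = m - 1 by ring] using h₁) (fun k hk ↦ hs _ (by omega))
    (fun k hk ↦ by
      have := rs (-k) (by omega)
      rw [show -(k + 1) = -k - 1 by ring, show -(k - 1) = -k + 1 by ring, mul_comm, this])
    (fun k hk ↦ by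
      have := rt (-k) (by omega)
      rw [show -(k + 1) = -k - 1 by ring, show -(k - 1) = -k + 1 by ring, mul_comm, this])
    (by omega)
  simpa using this

/-- A two-sided nowhere vanishing sequence is determined by two consecutive values and its
multiplicative second differences. Identities between products of net values are proved by
comparing the second differences of their two sides along a row or a column. -/
lemma int_seq_unique {s t G : ℤ → F} (h₀ : s 0 = t 0) (h₁ : s 1 = t 1)
    (hs : ∀ n, s n ≠ 0) (rs : ∀ n, s (n + 1) * s (n - 1) = s n ^ 2 * G n)
    (rt : ∀ n, t (n + 1) * t (n - 1) = t n ^ 2 * G n) (n : ℤ) : s n = t n := by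
  rcases le_total 0 n with h | h
  · exact int_seq_unique_up h₀ h₁ (fun _ _ ↦ hs _) (fun _ _ ↦ rs _) (fun _ _ ↦ rt _) h
  · exact int_seq_unique_down h₁ (by simpa using h₀) (fun _ _ ↦ hs _) (fun _ _ ↦ rs _)
      (fun _ _ ↦ rt _) (h.trans zero_le_one)

end Sequences

/-! ### Coordinates on the lattice spanned by two independent points -/

namespace WeierstrassCurve.Affine.Point

variable {F : Type*} [Field F] [DecidableEq F] {W : Affine F}

/-- The points `P` and `Q` are linearly independent over `ℤ`. -/
def Independent (P Q : W.Point) : Prop := ∀ a b : ℤ, a • P + b • Q = 0 → a = 0 ∧ b = 0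

/-- The `x`-coordinate of `aP + bQ`. -/
def latX (P Q : W.Point) (a b : ℤ) : F := xCoord (a • P + b • Q)

/-- The value of `ψ₂` at `aP + bQ`. -/
def latPsi (P Q : W.Point) (a b : ℤ) : F := psiTwo (a • P + b • Q)

lemma Independent.symm {P Q : W.Point} (h : Independent P Q) : Independent Q P :=
  fun a b hab ↦ (h b a (by rwa [add_comm])).symm

lemma latX_swap (P Q : W.Point) (a b : ℤ) : latX Q P b a = latX P Q a b := by
  rw [latX, latX, add_comm]

lemma latPsi_swap (P Q : W.Point) (a b : ℤ) : latPsi Q P b a = latPsi P Q a b := by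
  rw [latPsi, latPsi, add_comm]

lemma latX_neg (P Q : W.Point) (a b : ℤ) : latX P Q (-a) (-b) = latX P Q a b := by
  rw [latX, latX, neg_smul, neg_smul, ← neg_add, xCoord_neg]

lemma latPsi_neg (P Q : W.Point) (a b : ℤ) : latPsi P Q (-a) (-b) = -latPsi P Q a b := by
  rw [latPsi, latPsi, neg_smul, neg_smul, ← neg_add, psiTwo_neg]

section

variable {P Q : W.Point} (hPQ : Independent P Q)
include hPQ

lemma Independent.ne_zero {a b : ℤ} (h : a ≠ 0 ∨ b ≠ 0) : a • P + b • Q ≠ 0 := fun h0 ↦ by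
  have := hPQ a b h0
  omega

lemma latX_sub_ne_zero {a b c d : ℤ} (h₁ : a ≠ 0 ∨ b ≠ 0) (h₂ : c ≠ 0 ∨ d ≠ 0)
    (h₃ : a ≠ c ∨ b ≠ d) (h₄ : a ≠ -c ∨ b ≠ -d) : latX P Q a b - latX P Q c d ≠ 0 := by
  refine xCoord_sub_ne_zero (hPQ.ne_zero h₁) (hPQ.ne_zero h₂) ?_ ?_
  · rw [add_sub_add_comm, ← sub_smul, ← sub_smul]
    exact hPQ.ne_zero (by omega)
  · rw [add_add_add_comm, ← add_smul, ← add_smul]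
    exact hPQ.ne_zero (by omega)

lemma latPsi_ne_zero {a b : ℤ} (h : a ≠ 0 ∨ b ≠ 0) : latPsi P Q a b ≠ 0 := by
  refine psiTwo_ne_zero ?_
  rw [add_add_add_comm, ← add_smul, ← add_smul]
  exact hPQ.ne_zero (by omega)

/-- Since `w` is arbitrary, this encodes both the sum and the product of the `x`-coordinates of the
two points. -/
lemma latX_biquadratic {a b c d : ℤ} (h₁ : a ≠ 0 ∨ b ≠ 0) (h₂ : c ≠ 0 ∨ d ≠ 0)
    (h₃ : a ≠ c ∨ b ≠ d) (h₄ : a ≠ -c ∨ b ≠ -d) (w : F) :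
    (latX P Q a b - latX P Q c d) ^ 2 *
        ((w - latX P Q (a + c) (b + d)) * (w - latX P Q (a - c) (b - d)))
      = biquadratic W (latX P Q a b) (latX P Q c d) w := by
  have := sub_xCoord_add_mul_sub_xCoord_sub (hPQ.ne_zero h₁) (hPQ.ne_zero h₂)
    (latX_sub_ne_zero hPQ h₁ h₂ h₃ h₄) w
  rwa [add_add_add_comm, ← add_smul, ← add_smul, add_sub_add_comm, ← sub_smul, ← sub_smul] at this

lemma latX_sub_sub_latX_add {a b c d : ℤ} (h₁ : a ≠ 0 ∨ b ≠ 0) (h₂ : c ≠ 0 ∨ d ≠ 0)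
    (h₃ : a ≠ c ∨ b ≠ d) (h₄ : a ≠ -c ∨ b ≠ -d) :
    (latX P Q a b - latX P Q c d) ^ 2 * (latX P Q (a - c) (b - d) - latX P Q (a + c) (b + d))
      = latPsi P Q a b * latPsi P Q c d := by
  have := xCoord_sub_sub_xCoord_add (hPQ.ne_zero h₁) (hPQ.ne_zero h₂)
    (latX_sub_ne_zero hPQ h₁ h₂ h₃ h₄)
  rwa [add_add_add_comm, ← add_smul, ← add_smul, add_sub_add_comm, ← sub_smul, ← sub_smul] at this

/-- Exchanging the roles of the second and the third point in the biquadratic form. -/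
lemma latX_exchange {a b c d i j : ℤ} (h₁ : a ≠ 0 ∨ b ≠ 0) (h₂ : c ≠ 0 ∨ d ≠ 0)
    (h₃ : a ≠ c ∨ b ≠ d) (h₄ : a ≠ -c ∨ b ≠ -d) (h₅ : i ≠ 0 ∨ j ≠ 0) (h₆ : a ≠ i ∨ b ≠ j)
    (h₇ : a ≠ -i ∨ b ≠ -j) :
    (latX P Q a b - latX P Q c d) ^ 2 *
        ((latX P Q i j - latX P Q (a + c) (b + d)) * (latX P Q i j - latX P Q (a - c) (b - d)))
      = (latX P Q a b - latX P Q i j) ^ 2 *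
        ((latX P Q c d - latX P Q (a + i) (b + j)) *
          (latX P Q c d - latX P Q (a - i) (b - j))) := by
  rw [latX_biquadratic hPQ h₁ h₂ h₃ h₄, latX_biquadratic hPQ h₁ h₅ h₆ h₇, biquadratic_swap₂₃]

/-- The limiting case of `latX_exchange` in which the first and the third point coincide: the
product of a factor tending to zero and one tending to infinity becomes a square of `ψ₂`. -/
lemma latPsi_sq_mul {a b c d : ℤ} (h₁ : a ≠ 0 ∨ b ≠ 0) (h₂ : c ≠ 0 ∨ d ≠ 0)
    (h₃ : a ≠ c ∨ b ≠ d) (h₄ : a ≠ -c ∨ b ≠ -d) :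
    latPsi P Q a b ^ 2 * (latX P Q (a + a) (b + b) - latX P Q c d)
      = (latX P Q a b - latX P Q c d) ^ 2 *
        ((latX P Q a b - latX P Q (a + c) (b + d)) *
          (latX P Q a b - latX P Q (a - c) (b - d))) := by
  rw [latX_biquadratic hPQ h₁ h₂ h₃ h₄]
  have h0 : (a • P + b • Q) + (a • P + b • Q) ≠ 0 := by
    rw [add_add_add_comm, ← add_smul, ← add_smul]
    exact hPQ.ne_zero (by omega)
  have := psiTwo_sq_mul_sub h0 (latX P Q c d)
  rwa [add_add_add_comm, ← add_smul, ← add_smul] at this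

end

end WeierstrassCurve.Affine.Point

/-! ### Existence of the net of two independent points -/

namespace WeierstrassCurve.Affine.Point

variable {F : Type*} [Field F] [DecidableEq F] {W : Affine F}

/-- An array `N` which has the initial values of the net of `P` and `Q` and satisfies the
recurrence `N (u + w) N (u - w) = N u ^ 2 N w ^ 2 (x w - x u)` for `w = (1, 0)` and all `u`,
but for `w = (0, 1)` only if `u` lies in the first two columns. -/
structure IsRowNet (P Q : W.Point) (N : ℤ → ℤ → F) : Prop where
  row_odd : ∀ a, N (-a) 0 = -N a 0
  col_odd : ∀ b, N 0 (-b) = -N 0 b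
  ne_zero : ∀ a b, a ≠ 0 ∨ b ≠ 0 → N a b ≠ 0
  val₁₀ : N 1 0 = 1
  val₀₁ : N 0 1 = 1
  val₁₁ : N 1 1 = 1
  val₂₀ : N 2 0 = latPsi P Q 1 0
  val₀₂ : N 0 2 = latPsi P Q 0 1
  rec₁ : ∀ a b, a ≠ 0 ∨ b ≠ 0 →
    N (a + 1) b * N (a - 1) b = N a b ^ 2 * (latX P Q 1 0 - latX P Q a b)
  col₀ : ∀ b, b ≠ 0 → N 0 (b + 1) * N 0 (b - 1) = N 0 b ^ 2 * (latX P Q 0 1 - latX P Q 0 b)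
  col₁ : ∀ b, N 1 (b + 1) * N 1 (b - 1) = N 1 b ^ 2 * (latX P Q 0 1 - latX P Q 1 b)

/-- An odd array `N` which has the initial values of the net of `P` and `Q` and satisfies the
recurrence `N (u + w) N (u - w) = N u ^ 2 N w ^ 2 (x w - x u)` for `w = (1, 0)` and `w = (0, 1)`. -/
structure IsBasicNet (P Q : W.Point) (N : ℤ → ℤ → F) : Prop where
  odd : ∀ a b, N (-a) (-b) = -N a b
  ne_zero : ∀ a b, a ≠ 0 ∨ b ≠ 0 → N a b ≠ 0
  val₀₀ : N 0 0 = 0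
  val₁₀ : N 1 0 = 1
  val₀₁ : N 0 1 = 1
  val₁₁ : N 1 1 = 1
  val₂₀ : N 2 0 = latPsi P Q 1 0
  val₀₂ : N 0 2 = latPsi P Q 0 1
  rec₁ : ∀ a b, a ≠ 0 ∨ b ≠ 0 →
    N (a + 1) b * N (a - 1) b = N a b ^ 2 * (latX P Q 1 0 - latX P Q a b)
  rec₂ : ∀ a b, a ≠ 0 ∨ b ≠ 0 →
    N a (b + 1) * N a (b - 1) = N a b ^ 2 * (latX P Q 0 1 - latX P Q a b)

/-- The zeroth row and the first two columns are chosen by their own recurrences; every other row is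
then determined by its values in these columns. -/
lemma exists_isRowNet {P Q : W.Point} (hPQ : Independent P Q) :
    ∃ N : ℤ → ℤ → F, IsRowNet P Q N := by
  classical
  obtain ⟨r, r1, r2, rodd, rne, rrec⟩ := exists_odd_int_seq
    (fun a ↦ latX P Q 1 0 - latX P Q a 0)
    (fun a ha ↦ latX_sub_ne_zero hPQ (by omega) (by omega) (by omega) (by omega)) (sub_self _)
    (fun a ↦ by simpa using latX_neg P Q a 0) (latPsi_ne_zero hPQ (a := 1) (b := 0) (by omega))
  obtain ⟨c, c1, c2, codd, cne, crec⟩ := exists_odd_int_seq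
    (fun b ↦ latX P Q 0 1 - latX P Q 0 b)
    (fun a ha ↦ latX_sub_ne_zero hPQ (by omega) (by omega) (by omega) (by omega)) (sub_self _)
    (fun b ↦ by simpa using latX_neg P Q 0 b) (latPsi_ne_zero hPQ (a := 0) (b := 1) (by omega))
  obtain ⟨e, e0, e1, ene, erec⟩ := exists_int_seq (fun b ↦ latX P Q 0 1 - latX P Q 1 b)
    (fun b ↦ latX_sub_ne_zero hPQ (by omega) (by omega) (by omega) (by omega))
    (one_ne_zero (α := F)) (one_ne_zero (α := F))
  have hrow : ∀ b : ℤ, ∃ f : ℤ → F, b ≠ 0 → f 0 = c b ∧ f 1 = e b ∧ (∀ a, f a ≠ 0) ∧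
      ∀ a, f (a + 1) * f (a - 1) = f a ^ 2 * (latX P Q 1 0 - latX P Q a b) := fun b ↦ by
    by_cases hb : b = 0
    · exact ⟨fun _ ↦ 0, fun h ↦ (h hb).elim⟩
    · obtain ⟨f, h⟩ := exists_int_seq (fun a ↦ latX P Q 1 0 - latX P Q a b)
        (fun a ↦ latX_sub_ne_zero hPQ (by omega) (by omega) (by omega) (by omega))
        (cne b hb) (ene b)
      exact ⟨f, fun _ ↦ h⟩
  choose f hf using hrow
  have h0 : c 0 = 0 ∧ r 0 = 0 := by
    have h₁ := rrec 1 one_ne_zero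
    have h₂ := crec 1 one_ne_zero
    norm_num [r2, c2] at h₁ h₂
    exact ⟨h₂.resolve_left (latPsi_ne_zero hPQ (by omega)),
      h₁.resolve_left (latPsi_ne_zero hPQ (by omega))⟩
  have hcol0 : ∀ b, (if b = 0 then r 0 else f b 0) = c b := fun b ↦ by
    split_ifs with h
    exacts [by rw [h, h0.1, h0.2], (hf b h).1]
  have hcol1 : ∀ b, (if b = 0 then r 1 else f b 1) = e b := fun b ↦ by
    split_ifs with h
    exacts [by rw [h, r1, e0], (hf b h).2.1]
  refine ⟨fun a b ↦ if b = 0 then r a else f b a, fun a ↦ by simpa using rodd a, fun b ↦ ?_,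
    fun a b hab ↦ ?_, by simpa using r1, ?_, ?_, by simpa using r2, ?_, fun a b hab ↦ ?_,
    fun b hb ↦ ?_, fun b ↦ ?_⟩
  · simp only [hcol0, codd]
  · split_ifs with h
    exacts [rne a (by omega), (hf b h).2.2.1 a]
  · simp only [hcol0, c1]
  · simp only [hcol1, e1]
  · simp only [hcol0, c2]
  · split_ifs with h
    · rw [h]
      exact rrec a (by omega)
    · exact (hf b h).2.2.2 a
  · simp only [hcol0]
    exact crec b hb
  · simp only [hcol1]
    exact erec b

section

variable {P Q : W.Point} {N : ℤ → ℤ → F}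

lemma IsRowNet.val_one_neg_one (h : IsRowNet P Q N) :
    N 1 (-1) = latX P Q 0 1 - latX P Q 1 0 := by
  have := h.col₁ 0
  norm_num [h.val₁₀, h.val₁₁] at this
  exact this

variable (hPQ : Independent P Q)
include hPQ

/-- The recurrence at `(0, b)`, with the value at `(-1, b)` replaced by minus the one at `(1, -b)`.
It shows that row `b` and the negated reversed row `-b` agree in column `1`. -/
lemma IsRowNet.col_one_mul_col_one_neg (h : IsRowNet P Q N) {b : ℤ} (hb : b ≠ 0) :
    N 1 b * N 1 (-b) = N 0 b ^ 2 * (latX P Q 0 b - latX P Q 1 0) := by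
  have pos : ∀ b : ℤ, 1 ≤ b → N 1 b * N 1 (-b) = N 0 b ^ 2 * (latX P Q 0 b - latX P Q 1 0) := by
    intro b hb
    refine int_seq_unique_up (s := fun b ↦ N 1 b * N 1 (-b))
      (t := fun b ↦ N 0 b ^ 2 * (latX P Q 0 b - latX P Q 1 0))
      (G := fun b ↦ (latX P Q 0 1 - latX P Q 1 b) * (latX P Q 0 1 - latX P Q 1 (-b)))
      ?_ ?_ (fun n hn ↦ ?_) (fun n hn ↦ ?_) (fun n hn ↦ ?_) hb
    · simp only [h.val₁₁, h.val₀₁, h.val_one_neg_one]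
      ring
    · have e₁ := h.col₁ 1
      have e₂ := h.col₁ (-1)
      have e₃ := latPsi_sq_mul hPQ (a := 0) (b := 1) (c := 1) (d := 0) (by omega) (by omega)
        (by omega) (by omega)
      have e₄ := latX_neg P Q 1 (-1)
      norm_num [h.val₁₀, h.val₁₁, h.val_one_neg_one] at e₁ e₂ e₃ e₄
      norm_num [h.val₀₂, e₁, e₂]
      rw [e₃, e₄]
      ring
    · exact mul_ne_zero (h.ne_zero _ _ (by omega)) (h.ne_zero _ _ (by omega))
    · have e₁ := h.col₁ n
      have e₂ := h.col₁ (-n)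
      rw [show -(n + 1) = -n - 1 by ring, show -(n - 1) = -n + 1 by ring]
      linear_combination e₁ * (N 1 (-n + 1) * N 1 (-n - 1))
        + (N 1 n ^ 2 * (latX P Q 0 1 - latX P Q 1 n)) * e₂
    · have e₁ := h.col₀ n (by omega)
      have e₂ := latX_exchange hPQ (a := 0) (b := n) (c := 0) (d := 1) (i := 1) (j := 0) (by omega)
        (by omega) (by omega) (by omega) (by omega) (by omega) (by omega)
      have e₄ := latX_neg P Q 1 (-n)
      norm_num at e₂ e₄
      rw [← e₄]
      linear_combination (e₁ * (N 0 (n + 1) * N 0 (n - 1)) + e₁ *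
        (N 0 n ^ 2 * (latX P Q 0 1 - latX P Q 0 n))) * (latX P Q 0 (n + 1) - latX P Q 1 0) *
        (latX P Q 0 (n - 1) - latX P Q 1 0) + N 0 n ^ 4 * e₂
  rcases lt_or_gt_of_ne hb with h' | h'
  · have := pos (-b) (by omega)
    have e := latX_neg P Q 0 b
    simp only [_root_.neg_zero] at e
    rw [neg_neg, h.col_odd, e] at this
    linear_combination this
  · exact pos b (by omega)

lemma IsRowNet.odd (h : IsRowNet P Q N) (a b : ℤ) : N (-a) (-b) = -N a b := by
  by_cases hb : b = 0
  · rw [hb, _root_.neg_zero, h.row_odd]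
  rw [eq_neg_iff_add_eq_zero, add_comm, ← eq_neg_iff_add_eq_zero]
  refine int_seq_unique (s := fun a ↦ N a b) (t := fun a ↦ -N (-a) (-b))
    (G := fun a ↦ latX P Q 1 0 - latX P Q a b) ?_ ?_ (fun n ↦ h.ne_zero _ _ (by omega))
    (fun n ↦ h.rec₁ n b (by omega)) (fun n ↦ ?_) a
  · simp only [_root_.neg_zero, h.col_odd, neg_neg]
  · have e₁ := h.rec₁ 0 (-b) (by omega)
    have e₂ := h.col_one_mul_col_one_neg hPQ hb
    have e₃ := latX_neg P Q 0 b
    rw [_root_.neg_zero] at e₃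
    rw [h.col_odd, e₃, zero_add, zero_sub] at e₁
    refine mul_left_cancel₀ (h.ne_zero 1 (-b) (by omega)) ?_
    linear_combination e₁ + e₂
  · have e₁ := h.rec₁ (-n) (-b) (by omega)
    rw [latX_neg] at e₁
    rw [show -(n + 1) = -n - 1 by ring, show -(n - 1) = -n + 1 by ring]
    linear_combination e₁

lemma IsRowNet.rec₂ (h : IsRowNet P Q N) (a b : ℤ) (hab : a ≠ 0 ∨ b ≠ 0) :
    N a (b + 1) * N a (b - 1) = N a b ^ 2 * (latX P Q 0 1 - latX P Q a b) := by
  -- the sequences on both sides of the claim have the same second differences along a row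
  have hs : ∀ a b, (a ≠ 0 ∨ b ≠ -1) → (a ≠ 0 ∨ b ≠ 1) →
      (N (a + 1) (b + 1) * N (a + 1) (b - 1)) * (N (a - 1) (b + 1) * N (a - 1) (b - 1))
      = (N a (b + 1) * N a (b - 1)) ^ 2 *
        ((latX P Q 1 0 - latX P Q a (b + 1)) * (latX P Q 1 0 - latX P Q a (b - 1))) := by
    intro a b h₁ h₂
    have e₁ := h.rec₁ a (b + 1) (by omega)
    have e₂ := h.rec₁ a (b - 1) (by omega)
    linear_combination e₁ * (N (a + 1) (b - 1) * N (a - 1) (b - 1))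
      + N a (b + 1) ^ 2 * (latX P Q 1 0 - latX P Q a (b + 1)) * e₂
  have ht : ∀ a b, (a ≠ 0 ∨ b ≠ 0) → (a ≠ 0 ∨ b ≠ -1) → (a ≠ 0 ∨ b ≠ 1) → (a ≠ 1 ∨ b ≠ 0) →
      (a ≠ -1 ∨ b ≠ 0) →
      (N (a + 1) b ^ 2 * (latX P Q 0 1 - latX P Q (a + 1) b))
        * (N (a - 1) b ^ 2 * (latX P Q 0 1 - latX P Q (a - 1) b))
      = (N a b ^ 2 * (latX P Q 0 1 - latX P Q a b)) ^ 2 *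
        ((latX P Q 1 0 - latX P Q a (b + 1)) * (latX P Q 1 0 - latX P Q a (b - 1))) := by
    intro a b h₁ h₂ h₃ h₄ h₅
    have e₁ := h.rec₁ a b h₁
    have e₂ := latX_exchange hPQ (a := a) (b := b) (c := 1) (d := 0) (i := 0) (j := 1) (by omega)
        (by omega) (by omega) (by omega) (by omega) (by omega) (by omega)
    norm_num at e₂
    linear_combination (e₁ * (N (a + 1) b * N (a - 1) b) + e₁ *
        (N a b ^ 2 * (latX P Q 1 0 - latX P Q a b))) * (latX P Q 0 1 - latX P Q (a + 1) b) *
        (latX P Q 0 1 - latX P Q (a - 1) b) + N a b ^ 4 * e₂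
  have v₁ := h.val_one_neg_one
  have hcol : ∀ b : ℤ, b ≠ 0 → N 0 (b + 1) * N 0 (b - 1)
      = N 0 b ^ 2 * (latX P Q 0 1 - latX P Q 0 b) := h.col₀
  have base : ∀ b : ℤ, |b| ≤ 1 → N 2 (b + 1) * N 2 (b - 1)
      = N 2 b ^ 2 * (latX P Q 0 1 - latX P Q 2 b) := by
    intro b hb
    have v₂ := h.rec₁ 1 1 (by omega)
    have v₃ := h.rec₁ 1 (-1) (by omega)
    have v₄ := h.rec₁ 1 2 (by omega)
    have v₅ := h.rec₁ 1 (-2) (by omega)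
    have v₆ := h.col₁ 1
    have v₇ := h.col₁ (-1)
    have v₈ := h.col_odd 1
    have v₉ := h.col_odd 2
    norm_num [h.val₁₁, h.val₀₁, h.val₁₀, h.val₀₂] at v₂ v₆ v₇ v₈ v₉
    norm_num [v₈, v₉, h.val₀₂] at v₃ v₄ v₅
    have p₁ := latPsi_ne_zero hPQ (a := 0) (b := 1) (by omega)
    rw [abs_le] at hb
    obtain ⟨hb1, hb2⟩ := hb
    interval_cases b
    · have d₁ := latX_sub_sub_latX_add hPQ (a := 1) (b := -1) (c := 0) (d := 1) (by omega)
        (by omega) (by omega) (by omega)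
      have d₂ := latX_sub_sub_latX_add hPQ (a := 1) (b := -1) (c := 1) (d := 0) (by omega)
        (by omega) (by omega) (by omega)
      have d₃ := latX_neg P Q 0 1
      norm_num at d₁ d₂ d₃
      norm_num [h.val₂₀]
      rw [d₃] at d₂
      have w₁ : N 2 (-2) = N 1 (-1) ^ 4 * latPsi P Q 1 (-1) := by
        refine mul_right_cancel₀ p₁ ?_
        rw [v₇] at v₅
        linear_combination -v₅ + N 1 (-1) ^ 4 * d₁
      have w₂ : N 2 (-1) = -(N 1 (-1) ^ 2 * (latX P Q 1 0 - latX P Q 1 (-1))) := by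
        linear_combination -v₃
      rw [w₁, w₂]
      linear_combination -N 1 (-1) ^ 4 * d₂
    · have d₁ := latPsi_sq_mul hPQ (a := 1) (b := 0) (c := 0) (d := 1) (by omega) (by omega)
        (by omega) (by omega)
      norm_num at d₁
      norm_num [h.val₂₀, v₂]
      rw [v₁] at v₃
      linear_combination -(latX P Q 1 0 - latX P Q 1 1) * v₃ + d₁
    · have d₁ := latX_sub_sub_latX_add hPQ (a := 1) (b := 1) (c := 0) (d := 1) (by omega)
        (by omega) (by omega) (by omega)
      have d₂ := latX_sub_sub_latX_add hPQ (a := 1) (b := 1) (c := 1) (d := 0) (by omega)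
        (by omega) (by omega) (by omega)
      norm_num at d₁ d₂
      norm_num [h.val₂₀, v₂]
      have w₁ : N 2 2 = latPsi P Q 1 1 := by
        refine mul_right_cancel₀ p₁ ?_
        rw [v₆] at v₄
        linear_combination v₄ + d₁
      rw [w₁]
      linear_combination -d₂
  have pos : ∀ a b : ℤ, |b| ≤ 1 → 1 ≤ a → N a (b + 1) * N a (b - 1)
      = N a b ^ 2 * (latX P Q 0 1 - latX P Q a b) := by
    intro a b hb ha
    refine int_seq_unique_up (s := fun a ↦ N a (b + 1) * N a (b - 1))
      (t := fun a ↦ N a b ^ 2 * (latX P Q 0 1 - latX P Q a b)) (h.col₁ b) (base b hb)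
      (fun n hn ↦ mul_ne_zero (h.ne_zero _ _ (by omega)) (h.ne_zero _ _ (by omega)))
      (fun n hn ↦ hs n b (by omega) (by omega))
      (fun n hn ↦ ht n b (by omega) (by omega) (by omega) (by omega) (by omega)) ha
  by_cases hb : |b| ≤ 1
  · rcases lt_trichotomy a 0 with ha | rfl | ha
    · have := pos (-a) (-b) (by rwa [abs_neg]) (by omega)
      rw [show -b + 1 = -(b - 1) by ring, show -b - 1 = -(b + 1) by ring, h.odd hPQ, h.odd hPQ,
        h.odd hPQ, latX_neg] at this
      linear_combination this
    · exact h.col₀ b (by omega)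
    · exact pos a b hb ha
  · rw [abs_le] at hb
    refine int_seq_unique (s := fun a ↦ N a (b + 1) * N a (b - 1))
      (t := fun a ↦ N a b ^ 2 * (latX P Q 0 1 - latX P Q a b)) (h.col₀ b (by omega)) (h.col₁ b)
      (fun n ↦ mul_ne_zero (h.ne_zero _ _ (by omega)) (h.ne_zero _ _ (by omega)))
      (fun n ↦ hs n b (by omega) (by omega))
      (fun n ↦ ht n b (by omega) (by omega) (by omega) (by omega) (by omega)) a

lemma exists_isBasicNet : ∃ N : ℤ → ℤ → F, IsBasicNet P Q N := by
  obtain ⟨N, h⟩ := exists_isRowNet hPQ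
  refine ⟨N, h.odd hPQ, h.ne_zero, ?_, h.val₁₀, h.val₀₁, h.val₁₁, h.val₂₀, h.val₀₂, h.rec₁,
    h.rec₂ hPQ⟩
  have := h.rec₁ 1 0 (by omega)
  norm_num [h.val₂₀] at this
  exact this.resolve_left (latPsi_ne_zero hPQ (by omega))

end

end WeierstrassCurve.Affine.Point

/-! ### The recurrences of the net of two independent points -/

namespace WeierstrassCurve.Affine.Point

variable {F : Type*} [Field F] [DecidableEq F] {W : Affine F}

/-- The relation `N (u + w) N (u - w) = N u ^ 2 N w ^ 2 (x w - x u)` for `u = (a, b)`,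
`w = (c, d)`. -/
def NetRel (P Q : W.Point) (N : ℤ → ℤ → F) (a b c d : ℤ) : Prop :=
  N (a + c) (b + d) * N (a - c) (b - d)
    = N a b ^ 2 * N c d ^ 2 * (latX P Q c d - latX P Q a b)

namespace IsBasicNet

variable {P Q : W.Point} {N : ℤ → ℤ → F}

lemma swap (h : IsBasicNet P Q N) : IsBasicNet Q P fun a b ↦ N b a where
  odd a b := h.odd b a
  ne_zero a b hab := h.ne_zero b a hab.symm
  val₀₀ := h.val₀₀
  val₁₀ := h.val₀₁
  val₀₁ := h.val₁₀
  val₁₁ := h.val₁₁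
  val₂₀ := by rw [latPsi_swap]; exact h.val₀₂
  val₀₂ := by rw [latPsi_swap]; exact h.val₂₀
  rec₁ a b hab := by
    rw [latX_swap P Q, latX_swap P Q]
    exact h.rec₂ b a hab.symm
  rec₂ a b hab := by
    rw [latX_swap P Q, latX_swap P Q]
    exact h.rec₁ b a hab.symm

lemma rel_symm (h : IsBasicNet P Q N) {a b c d : ℤ} (H : NetRel P Q N a b c d) :
    NetRel P Q N c d a b := by
  rw [NetRel] at H ⊢
  rw [add_comm c, add_comm d, ← neg_sub a c, ← neg_sub b d, h.odd]
  linear_combination -H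

lemma rel_neg_left (h : IsBasicNet P Q N) {a b c d : ℤ} (H : NetRel P Q N a b c d) :
    NetRel P Q N (-a) (-b) c d := by
  rw [NetRel] at H ⊢
  rw [show -a + c = -(a - c) by ring, show -b + d = -(b - d) by ring,
    show -a - c = -(a + c) by ring, show -b - d = -(b + d) by ring, h.odd, h.odd, h.odd, latX_neg]
  linear_combination H

lemma rel_neg_right (h : IsBasicNet P Q N) {a b c d : ℤ} (H : NetRel P Q N a b c d) :
    NetRel P Q N a b (-c) (-d) :=
  h.rel_symm (h.rel_neg_left (h.rel_symm H))

lemma rel_swap {a b c d : ℤ} (H : NetRel Q P (fun a b ↦ N b a) b a d c) :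
    NetRel P Q N a b c d := by
  rw [NetRel, latX_swap P Q, latX_swap P Q] at H
  exact H

lemma val₁₂ (h : IsBasicNet P Q N) : N 1 2 = latX P Q 0 1 - latX P Q 1 1 := by
  have := h.rec₂ 1 1 (by omega)
  norm_num [h.val₁₀, h.val₁₁] at this
  exact this

lemma val₂₁ (h : IsBasicNet P Q N) : N 2 1 = latX P Q 1 0 - latX P Q 1 1 := by
  have := h.rec₁ 1 1 (by omega)
  norm_num [h.val₀₁, h.val₁₁] at this
  exact this

lemma val_one_neg_one (h : IsBasicNet P Q N) : N 1 (-1) = latX P Q 0 1 - latX P Q 1 0 := by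
  have := h.rec₂ 1 0 (by omega)
  norm_num [h.val₁₀, h.val₁₁] at this
  exact this

variable (hPQ : Independent P Q) (h : IsBasicNet P Q N)
include hPQ h

lemma val₂₂ : N 2 2 = latPsi P Q 1 1 := by
  have v₁ := h.rec₁ 1 2 (by omega)
  have d₁ := latX_sub_sub_latX_add hPQ (a := 1) (b := 1) (c := 0) (d := 1) (by omega)
    (by omega) (by omega) (by omega)
  norm_num [h.val₁₂, h.val₀₂] at v₁ d₁
  refine mul_right_cancel₀ (latPsi_ne_zero hPQ (a := 0) (b := 1) (by omega)) ?_
  linear_combination v₁ + d₁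

omit hPQ in
/-- Together with `shift_right` this says that both sides of the relation for `w = (1, 1)` have the
same multiplicative second differences along every column. -/
lemma shift_left {a b : ℤ} (h₁ : a ≠ -1 ∨ b ≠ -1) (h₂ : a ≠ 1 ∨ b ≠ 1) :
    (N (a + 1) (b + 1 + 1) * N (a - 1) (b + 1 - 1)) *
        (N (a + 1) (b - 1 + 1) * N (a - 1) (b - 1 - 1))
      = (N (a + 1) (b + 1) * N (a - 1) (b - 1)) ^ 2 *
        ((latX P Q 0 1 - latX P Q (a + 1) (b + 1)) *
          (latX P Q 0 1 - latX P Q (a - 1) (b - 1))) := by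
  have e₁ := h.rec₂ (a + 1) (b + 1) (by omega)
  have e₂ := h.rec₂ (a - 1) (b - 1) (by omega)
  rw [show b + 1 - 1 = b - 1 + 1 by ring] at e₁ ⊢
  linear_combination e₁ * (N (a - 1) (b - 1 + 1) * N (a - 1) (b - 1 - 1))
    + N (a + 1) (b + 1) ^ 2 * (latX P Q 0 1 - latX P Q (a + 1) (b + 1)) * e₂

lemma shift_right {a b : ℤ} (h₁ : a ≠ 0 ∨ b ≠ 0) (h₂ : a ≠ 0 ∨ b ≠ 1) (h₃ : a ≠ 0 ∨ b ≠ -1)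
    (h₄ : a ≠ 1 ∨ b ≠ 1) (h₅ : a ≠ -1 ∨ b ≠ -1) :
    (N a (b + 1) ^ 2 * N 1 1 ^ 2 * (latX P Q 1 1 - latX P Q a (b + 1)))
        * (N a (b - 1) ^ 2 * N 1 1 ^ 2 * (latX P Q 1 1 - latX P Q a (b - 1)))
      = (N a b ^ 2 * N 1 1 ^ 2 * (latX P Q 1 1 - latX P Q a b)) ^ 2 *
        ((latX P Q 0 1 - latX P Q (a + 1) (b + 1)) *
          (latX P Q 0 1 - latX P Q (a - 1) (b - 1))) := by
  have e₁ := h.rec₂ a b h₁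
  have e₂ := latX_exchange hPQ (a := a) (b := b) (c := 0) (d := 1) (i := 1) (j := 1) (by omega)
      (by omega) (by omega) (by omega) (by omega) (by omega) (by omega)
  rw [add_zero, sub_zero] at e₂
  rw [h.val₁₁]
  linear_combination (e₁ * (N a (b + 1) * N a (b - 1)) + e₁ *
      (N a b ^ 2 * (latX P Q 0 1 - latX P Q a b))) * (latX P Q 1 1 - latX P Q a (b + 1)) *
      (latX P Q 1 1 - latX P Q a (b - 1)) + N a b ^ 4 * e₂

lemma rel_one_one_col_zero {b : ℤ} (hb : b ≠ 0) : NetRel P Q N 0 b 1 1 := by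
  have pos : ∀ b : ℤ, 1 ≤ b → NetRel P Q N 0 b 1 1 := by
    intro b hb
    refine int_seq_unique_up (s := fun b ↦ N (0 + 1) (b + 1) * N (0 - 1) (b - 1))
      (t := fun b ↦ N 0 b ^ 2 * N 1 1 ^ 2 * (latX P Q 1 1 - latX P Q 0 b)) ?_ ?_
      (fun n hn ↦ mul_ne_zero (h.ne_zero _ _ (by omega)) (h.ne_zero _ _ (by omega)))
      (fun n hn ↦ h.shift_left (by omega) (by omega))
      (fun n hn ↦ h.shift_right hPQ (by omega) (by omega) (by omega) (by omega) (by omega)) hb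
    · have o := h.odd 1 0
      norm_num [h.val₁₀] at o
      norm_num [h.val₀₁, h.val₁₁, h.val₁₂, o]
    · have o := h.odd 1 (-1)
      have v := h.rec₂ 1 2 (by omega)
      have e := latPsi_sq_mul hPQ (a := 0) (b := 1) (c := 1) (d := 1) (by omega) (by omega)
        (by omega) (by omega)
      have e' := latX_neg P Q 1 0
      norm_num [h.val_one_neg_one, h.val₁₂, h.val₁₁] at o v e e'
      norm_num [h.val₀₂, h.val₁₁, o, v]
      rw [e'] at e
      linear_combination e
  rcases lt_or_gt_of_ne hb with h' | h'
  · simpa using h.rel_neg_left (pos (-b) (by omega))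
  · exact pos b (by omega)

lemma rel_one_one_col_one (b : ℤ) : NetRel P Q N 1 b 1 1 := by
  have r₀ : NetRel P Q N 1 0 1 1 := by
    have o := h.odd 0 1
    norm_num [h.val₀₁] at o
    norm_num [NetRel, h.val₁₁, h.val₁₀, h.val₂₁, o]
  rcases lt_trichotomy b 1 with hb | rfl | hb
  · refine int_seq_unique_down (m := 0) (s := fun b ↦ N (1 + 1) (b + 1) * N (1 - 1) (b - 1))
      (t := fun b ↦ N 1 b ^ 2 * N 1 1 ^ 2 * (latX P Q 1 1 - latX P Q 1 b)) r₀ ?_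
      (fun n hn ↦ mul_ne_zero (h.ne_zero _ _ (by omega)) (h.ne_zero _ _ (by omega)))
      (fun n hn ↦ h.shift_left (by omega) (by omega))
      (fun n hn ↦ h.shift_right hPQ (by omega) (by omega) (by omega) (by omega) (by omega))
      (by omega)
    have o := h.odd 0 2
    have d := latX_sub_sub_latX_add hPQ (a := 1) (b := 0) (c := 0) (d := 1) (by omega)
      (by omega) (by omega) (by omega)
    norm_num [h.val₀₂] at o d
    norm_num [h.val₁₁, h.val₂₀, o, h.val_one_neg_one]
    linear_combination d
  · norm_num [NetRel, h.val₀₀]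
  · have v₁₃ := h.rec₂ 1 2 (by omega)
    have v₂₃ := h.rec₂ 2 2 (by omega)
    have v₂₄ := h.rec₂ 2 3 (by omega)
    have e₁ := latPsi_sq_mul hPQ (a := 1) (b := 1) (c := 0) (d := 1) (by omega) (by omega)
      (by omega) (by omega)
    have d₁ := latX_sub_sub_latX_add hPQ (a := 1) (b := 2) (c := 1) (d := 1) (by omega)
      (by omega) (by omega) (by omega)
    have d₂ := latX_sub_sub_latX_add hPQ (a := 1) (b := 2) (c := 0) (d := 1) (by omega)
      (by omega) (by omega) (by omega)
    have n₁ := latX_sub_ne_zero hPQ (a := 1) (b := 0) (c := 1) (d := 1) (by omega) (by omega)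
      (by omega) (by omega)
    have n₂ := latPsi_ne_zero hPQ (a := 1) (b := 1) (by omega)
    norm_num [h.val₁₂, h.val₁₁, h.val₂₁, h.val₂₂ hPQ] at v₁₃ v₂₃ v₂₄ e₁ d₁ d₂
    have w₂₃ : N 2 3 = (latX P Q 1 1 - latX P Q 0 1) ^ 2 * (latX P Q 1 1 - latX P Q 1 2) := by
      refine mul_right_cancel₀ n₁ ?_
      linear_combination v₂₃ - e₁
    have w₂₄ : N 2 4 = (latX P Q 1 1 - latX P Q 0 1) ^ 4 * latPsi P Q 1 2 := by
      refine mul_right_cancel₀ n₂ ?_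
      rw [w₂₃] at v₂₄
      linear_combination v₂₄ + (latX P Q 1 1 - latX P Q 0 1) ^ 4 * d₁
    refine int_seq_unique_up (m := 2) (s := fun b ↦ N (1 + 1) (b + 1) * N (1 - 1) (b - 1))
      (t := fun b ↦ N 1 b ^ 2 * N 1 1 ^ 2 * (latX P Q 1 1 - latX P Q 1 b)) ?_ ?_
      (fun n hn ↦ mul_ne_zero (h.ne_zero _ _ (by omega)) (h.ne_zero _ _ (by omega)))
      (fun n hn ↦ h.shift_left (by omega) (by omega))
      (fun n hn ↦ h.shift_right hPQ (by omega) (by omega) (by omega) (by omega) (by omega))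
      (by omega)
    · simp only [Int.reduceAdd, Int.reduceSub, h.val₁₁, h.val₁₂, h.val₀₁, w₂₃]
      ring
    · norm_num [h.val₁₁, h.val₀₂, w₂₄, v₁₃]
      linear_combination -(latX P Q 1 1 - latX P Q 0 1) ^ 4 * d₂

lemma rel_one_one {a b : ℤ} (hab : a ≠ 0 ∨ b ≠ 0) : NetRel P Q N a b 1 1 := by
  by_cases ha : a = 0
  · exact ha ▸ h.rel_one_one_col_zero hPQ (by omega)
  by_cases ha1 : a = 1
  · exact ha1 ▸ h.rel_one_one_col_one hPQ b
  by_cases ha2 : a = -1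
  · simpa [ha2] using h.rel_neg_left (h.rel_one_one_col_one hPQ (-b))
  refine int_seq_unique (s := fun b ↦ N (a + 1) (b + 1) * N (a - 1) (b - 1))
    (t := fun b ↦ N a b ^ 2 * N 1 1 ^ 2 * (latX P Q 1 1 - latX P Q a b))
    (rel_swap (h.swap.rel_one_one_col_zero hPQ.symm ha))
    (rel_swap (h.swap.rel_one_one_col_one hPQ.symm a))
    (fun n ↦ mul_ne_zero (h.ne_zero _ _ (by omega)) (h.ne_zero _ _ (by omega)))
    (fun n ↦ h.shift_left (by omega) (by omega))
    (fun n ↦ h.shift_right hPQ (by omega) (by omega) (by omega) (by omega) (by omega)) b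

omit hPQ in
lemma good_neg {c d : ℤ} (H : ∀ a b, a ≠ 0 ∨ b ≠ 0 → NetRel P Q N a b c d) :
    ∀ a b, a ≠ 0 ∨ b ≠ 0 → NetRel P Q N a b (-c) (-d) :=
  fun a b hab ↦ h.rel_neg_right (H a b hab)

/-- The directions `w` in which the relation holds for all `u` are closed under `w₁ + w₂` as soon
as they contain `w₁ - w₂`. The positions `u` at which a factor to be cancelled vanishes are
covered by the symmetry of the relation in `u` and `w`. -/
lemma good_add {c d e f : ℤ} (h₁ : c ≠ 0 ∨ d ≠ 0) (h₂ : e ≠ 0 ∨ f ≠ 0) (h₃ : c ≠ e ∨ d ≠ f)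
    (h₄ : c ≠ -e ∨ d ≠ -f) (H₁ : ∀ a b, a ≠ 0 ∨ b ≠ 0 → NetRel P Q N a b c d)
    (H₂ : ∀ a b, a ≠ 0 ∨ b ≠ 0 → NetRel P Q N a b e f)
    (H₃ : ∀ a b, a ≠ 0 ∨ b ≠ 0 → NetRel P Q N a b (c - e) (d - f)) :
    ∀ a b, a ≠ 0 ∨ b ≠ 0 → NetRel P Q N a b (c + e) (d + f) := by
  intro a b hab
  by_cases k₁ : a = c ∧ b = d
  · rw [k₁.1, k₁.2]
    exact h.rel_symm (H₁ _ _ (by omega))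
  by_cases k₂ : a = -c ∧ b = -d
  · rw [k₂.1, k₂.2]
    exact h.rel_neg_left (h.rel_symm (H₁ _ _ (by omega)))
  by_cases k₃ : a = c - e ∧ b = d - f
  · rw [k₃.1, k₃.2]
    exact h.rel_symm (H₃ _ _ (by omega))
  by_cases k₄ : a = -(c - e) ∧ b = -(d - f)
  · rw [k₄.1, k₄.2]
    exact h.rel_neg_left (h.rel_symm (H₃ _ _ (by omega)))
  have r₁ := H₂ (a + c) (b + d) (by omega)
  have r₂ := H₂ (a - c) (b - d) (by omega)
  have r₃ := H₁ a b hab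
  have r₄ := H₃ a b hab
  have r₅ := H₂ c d h₁
  have q₁ := latX_biquadratic hPQ hab h₁ (by omega) (by omega) (latX P Q e f)
  have q₂ := latX_biquadratic hPQ h₁ h₂ h₃ h₄ (latX P Q a b)
  rw [biquadratic_swap₂₃, biquadratic_swap₁₂, ← q₁] at q₂
  simp only [NetRel] at r₁ r₂ r₃ r₄ r₅ ⊢
  have m₁ : N (a + (c - e)) (b + (d - f)) ≠ 0 := h.ne_zero _ _ (by omega)
  have m₂ : N (a - (c - e)) (b - (d - f)) ≠ 0 := h.ne_zero _ _ (by omega)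
  refine mul_right_cancel₀ (mul_ne_zero m₁ m₂) ?_
  rw [show a + c + e = a + (c + e) by ring, show b + d + f = b + (d + f) by ring,
    show a + c - e = a + (c - e) by ring, show b + d - f = b + (d - f) by ring] at r₁
  rw [show a - c + e = a - (c - e) by ring, show b - d + f = b - (d - f) by ring,
    show a - c - e = a - (c + e) by ring, show b - d - f = b - (d + f) by ring] at r₂
  generalize N (a + (c - e)) (b + (d - f)) = A at *
  generalize N (a - (c - e)) (b - (d - f)) = B at *
  generalize N (a + (c + e)) (b + (d + f)) = C at *
  generalize N (a - (c + e)) (b - (d + f)) = D at *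
  generalize N (a + c) (b + d) = A' at *
  generalize N (a - c) (b - d) = B' at *
  generalize N (c + e) (d + f) = C' at *
  generalize N (c - e) (d - f) = D' at *
  generalize latX P Q (a + c) (b + d) = x₁ at *
  generalize latX P Q (a - c) (b - d) = x₂ at *
  generalize latX P Q (c + e) (d + f) = x₃ at *
  generalize latX P Q (c - e) (d - f) = x₄ at *
  generalize latX P Q a b = x at *
  generalize latX P Q c d = y at *
  generalize latX P Q e f = z at *
  have t₁ : C * D * (A * B) = N e f ^ 4 * (N a b ^ 2 * N c d ^ 2 * (y - x)) ^ 2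
      * ((z - x₁) * (z - x₂)) := by
    rw [← r₃]
    linear_combination r₁ * (B * D) + A' ^ 2 * N e f ^ 2 * (z - x₁) * r₂
  have t₂ : (C' * D') ^ 2 = (N c d ^ 2 * N e f ^ 2 * (z - y)) ^ 2 := by rw [r₅]
  rw [t₁, r₄]
  linear_combination -N a b ^ 4 * (x₃ - x) * (x₄ - x) * t₂ - N a b ^ 4 * N c d ^ 4 * N e f ^ 4 * q₂

/-- The case `w₁ = w₂` of `good_add`, in which the value of `N` at `2w` has to be known. -/
lemma good_two_mul {c d : ℤ} (h₁ : c ≠ 0 ∨ d ≠ 0)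
    (H : ∀ a b, a ≠ 0 ∨ b ≠ 0 → NetRel P Q N a b c d)
    (hN : N (c + c) (d + d) = N c d ^ 4 * latPsi P Q c d) :
    ∀ a b, a ≠ 0 ∨ b ≠ 0 → NetRel P Q N a b (c + c) (d + d) := by
  intro a b hab
  by_cases k₁ : a = c ∧ b = d
  · rw [k₁.1, k₁.2]
    exact h.rel_symm (H _ _ (by omega))
  by_cases k₂ : a = -c ∧ b = -d
  · rw [k₂.1, k₂.2]
    exact h.rel_neg_left (h.rel_symm (H _ _ (by omega)))
  have r₁ := H (a + c) (b + d) (by omega)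
  have r₂ := H (a - c) (b - d) (by omega)
  have r₃ := H a b hab
  have q := latPsi_sq_mul hPQ h₁ hab (by omega) (by omega)
  have e := latX_neg P Q (a - c) (b - d)
  rw [neg_sub, neg_sub] at e
  simp only [NetRel] at r₁ r₂ r₃ ⊢
  rw [hN]
  refine mul_right_cancel₀ (pow_ne_zero 2 (h.ne_zero a b hab)) ?_
  rw [add_assoc, add_assoc, add_sub_cancel_right, add_sub_cancel_right] at r₁
  rw [sub_sub, sub_sub, sub_add_cancel, sub_add_cancel] at r₂
  rw [add_comm c a, add_comm d b, e] at q
  generalize N (a + (c + c)) (b + (d + d)) = A at *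
  generalize N (a - (c + c)) (b - (d + d)) = B at *
  generalize N (a + c) (b + d) = A' at *
  generalize N (a - c) (b - d) = B' at *
  generalize latX P Q (a + c) (b + d) = x₁ at *
  generalize latX P Q (a - c) (b - d) = x₂ at *
  have t₁ : A * B * N a b ^ 2 = N c d ^ 4 * (N a b ^ 2 * N c d ^ 2 *
      (latX P Q c d - latX P Q a b)) ^ 2 * ((latX P Q c d - x₁) * (latX P Q c d - x₂)) := by
    rw [← r₃]
    linear_combination r₁ * (N a b * B) + A' ^ 2 * N c d ^ 2 * (latX P Q c d - x₁) * r₂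
  rw [t₁]
  linear_combination -N a b ^ 4 * N c d ^ 8 * q

lemma good_row_zero (n : ℕ) : ∀ a b, a ≠ 0 ∨ b ≠ 0 → NetRel P Q N a b (n + 1) 0 := by
  have H₁ : ∀ a b, a ≠ 0 ∨ b ≠ 0 → NetRel P Q N a b 1 0 := fun a b hab ↦ by
    rw [NetRel, h.val₁₀, add_zero, sub_zero, h.rec₁ a b hab]
    ring
  induction n using Nat.twoStepInduction with
  | zero => simpa using H₁
  | one =>
    have := h.good_two_mul hPQ (c := 1) (d := 0) (by omega) H₁ (by norm_num [h.val₁₀, h.val₂₀])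
    simpa using this
  | more n ih₁ ih₂ =>
    have := h.good_add hPQ (c := n + 1 + 1) (d := 0) (e := 1) (f := 0) (by omega) (by omega)
      (by omega) (by omega) (by simpa using ih₂) H₁ (by simpa using ih₁)
    rw [show ((n + 2 : ℕ) : ℤ) + 1 = n + 1 + 1 + 1 by push_cast; ring]
    simpa using this

lemma good_row (n : ℤ) (hn : n ≠ 0) : ∀ a b, a ≠ 0 ∨ b ≠ 0 → NetRel P Q N a b n 0 := by
  obtain ⟨k, rfl | rfl⟩ : ∃ k : ℕ, n = k + 1 ∨ n = -(k + 1) := ⟨n.natAbs - 1, by omega⟩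
  · exact h.good_row_zero hPQ k
  · simpa using h.good_neg (h.good_row_zero hPQ k)

lemma good_col (n : ℤ) (hn : n ≠ 0) : ∀ a b, a ≠ 0 ∨ b ≠ 0 → NetRel P Q N a b 0 n :=
  fun a b hab ↦ rel_swap (h.swap.good_row hPQ.symm n hn b a hab.symm)

lemma good_col_one (n : ℤ) : ∀ a b, a ≠ 0 ∨ b ≠ 0 → NetRel P Q N a b 1 n := by
  suffices H : (∀ a b, a ≠ 0 ∨ b ≠ 0 → NetRel P Q N a b 1 n) ∧
      (∀ a b, a ≠ 0 ∨ b ≠ 0 → NetRel P Q N a b 1 (n + 1)) from H.1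
  induction n using Int.induction_on with
  | zero => exact ⟨h.good_row hPQ 1 one_ne_zero, fun a b hab ↦ h.rel_one_one hPQ hab⟩
  | succ n ih =>
    refine ⟨ih.2, ?_⟩
    have := h.good_add hPQ (c := 1) (d := n + 1) (e := 0) (f := 1) (by omega) (by omega)
      (by omega) (by omega) ih.2 (h.good_col hPQ 1 one_ne_zero) (by simpa using ih.1)
    simpa using this
  | pred n ih =>
    rw [sub_add_cancel]
    refine ⟨?_, ih.1⟩
    have := h.good_add hPQ (c := 1) (d := -n) (e := 0) (f := -1) (by omega) (by omega)
      (by omega) (by omega) ih.1 (h.good_col hPQ (-1) (by omega)) (by simpa using ih.2)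
    simpa [sub_eq_add_neg] using this

/-- The relation holds for all pairs of nonzero lattice points. -/
theorem rel {a b c d : ℤ} (hab : a ≠ 0 ∨ b ≠ 0) (hcd : c ≠ 0 ∨ d ≠ 0) : NetRel P Q N a b c d := by
  by_cases hd : d = 0
  · rw [hd]
    exact h.good_row hPQ c (by omega) a b hab
  suffices H : (∀ a b, a ≠ 0 ∨ b ≠ 0 → NetRel P Q N a b c d) ∧
      (∀ a b, a ≠ 0 ∨ b ≠ 0 → NetRel P Q N a b (c + 1) d) from H.1 a b hab
  clear hcd
  induction c using Int.induction_on with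
  | zero => exact ⟨h.good_col hPQ d hd, h.good_col_one hPQ d⟩
  | succ n ih =>
    refine ⟨ih.2, ?_⟩
    have := h.good_add hPQ (c := n + 1) (d := d) (e := 1) (f := 0) (by omega) (by omega)
      (by omega) (by omega) ih.2 (h.good_row hPQ 1 one_ne_zero) (by simpa using ih.1)
    simpa using this
  | pred n ih =>
    rw [sub_add_cancel]
    refine ⟨?_, ih.1⟩
    have := h.good_add hPQ (c := -n) (d := d) (e := -1) (f := 0) (by omega) (by omega)
      (by omega) (by omega) ih.1 (h.good_row hPQ (-1) (by omega)) (by simpa using ih.2)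
    simpa [sub_eq_add_neg] using this

/-- The relation for `u + (1, 0)` and `u - (1, 0)` expresses `N (2u) N (2, 0)` by a difference of
`x`-coordinates, which factors into values of `ψ₂`. -/
lemma two_mul_eq {a b : ℤ} (hab : a ≠ 0 ∨ b ≠ 0) :
    N (a + a) (b + b) = N a b ^ 4 * latPsi P Q a b := by
  by_cases k₁ : a = 1 ∧ b = 0
  · rw [k₁.1, k₁.2]
    norm_num [h.val₁₀, h.val₂₀]
  by_cases k₂ : a = -1 ∧ b = 0
  · have o := h.odd 2 0
    have o' := h.odd 1 0
    have e := latPsi_neg P Q 1 0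
    rw [k₂.1, k₂.2]
    norm_num at o o' e
    norm_num [o, o', e, h.val₁₀, h.val₂₀]
  have r := h.rel hPQ (a := a + 1) (b := b) (c := a - 1) (d := b) (by omega) (by omega)
  have r' := h.rec₁ a b hab
  have d₁ := latX_sub_sub_latX_add hPQ (a := a) (b := b) (c := 1) (d := 0) hab
      (by omega) (by omega) (by omega)
  rw [NetRel, show a + 1 + (a - 1) = a + a by ring, show a + 1 - (a - 1) = 2 by ring, sub_self,
    h.val₂₀] at r
  rw [add_zero, sub_zero] at d₁
  refine mul_right_cancel₀ (latPsi_ne_zero hPQ (a := 1) (b := 0) (by omega)) ?_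
  rw [r]
  linear_combination (r' * (N (a + 1) b * N (a - 1) b) + r' *
    (N a b ^ 2 * (latX P Q 1 0 - latX P Q a b))) * (latX P Q (a - 1) b - latX P Q (a + 1) b)
    + N a b ^ 4 * d₁

end IsBasicNet

end WeierstrassCurve.Affine.Point

/-! ### The net of two independent points is the net polynomial -/

namespace WeierstrassCurve.Affine.Point

variable {F : Type*} [Field F] [DecidableEq F] {W : Affine F}

/-- The relation `N (u + p + q) N (u - p) N (u - q) = N u ^ 3 ℓ u` for `u = (a, b)`, `p = (1, 0)`
and `q = (0, 1)`, where `ℓ` is the equation of the line through `P` and `Q`. -/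
def ChordRel (P Q : W.Point) (N : ℤ → ℤ → F) (a b : ℤ) : Prop :=
  N (a + 1) (b + 1) * N (a - 1) b * N a (b - 1) = N a b ^ 3 * chord P Q (a • P + b • Q)

lemma Independent.left_ne_zero {P Q : W.Point} (hPQ : Independent P Q) : P ≠ 0 := by
  simpa using hPQ.ne_zero (a := 1) (b := 0) (by omega)

lemma Independent.xCoord_sub_ne_zero {P Q : W.Point} (hPQ : Independent P Q) :
    xCoord P - xCoord Q ≠ 0 := by
  simpa [latX] using latX_sub_ne_zero hPQ (a := 1) (b := 0) (c := 0) (d := 1) (by omega) (by omega)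
    (by omega) (by omega)

namespace IsBasicNet

variable {P Q : W.Point} {N : ℤ → ℤ → F}

section

variable (hPQ : Independent P Q)
include hPQ

lemma chordRel_swap {a b : ℤ} (H : ChordRel Q P (fun a b ↦ N b a) b a) : ChordRel P Q N a b := by
  rw [ChordRel, ← chord_comm hPQ.xCoord_sub_ne_zero, add_comm (b • Q)] at H
  rw [ChordRel]
  linear_combination H

variable (h : IsBasicNet P Q N)
include h

/-- The relation is carried from `u - (1, 0)` to `u` by `chord_mul_shift`, as long as the factors
to be cancelled are nonzero. -/
lemma chordRel_step_left {a b : ℤ} (h₀ : a ≠ 0 ∨ b ≠ 0) (h₁ : a ≠ 1 ∨ b ≠ 0) (h₂ : a ≠ -1 ∨ b ≠ 0)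
    (h₃ : a ≠ 0 ∨ b ≠ 1) (h₄ : a ≠ 0 ∨ b ≠ -1) (h₅ : a ≠ 2 ∨ b ≠ 0) (h₆ : a ≠ 1 ∨ b ≠ 1)
    (h₇ : a ≠ 1 ∨ b ≠ -1) (H : ChordRel P Q N (a - 1) b) : ChordRel P Q N a b := by
  have r₁ := h.rec₁ a (b + 1) (by omega)
  have r₂ := h.rec₁ (a - 1) b (by omega)
  have r₃ := h.rec₂ a b (by omega)
  have r₄ := h.rec₂ (a - 1) b (by omega)
  have n₁ := latX_sub_ne_zero hPQ (a := a) (b := b) (c := 1) (d := 0) (by omega) (by omega)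
    (by omega) (by omega)
  have n₂ := latX_sub_ne_zero hPQ (a := a) (b := b) (c := 0) (d := 1) (by omega) (by omega)
    (by omega) (by omega)
  have e := chord_mul_shift hPQ.left_ne_zero hPQ.symm.left_ne_zero hPQ.xCoord_sub_ne_zero
    (hPQ.ne_zero h₀) (by simpa [latX] using n₁) (by simpa [latX] using n₂)
  rw [show a • P + b • Q - P = (a - 1) • P + b • Q by rw [sub_smul, one_smul]; abel,
    show a • P + b • Q + Q = a • P + (b + 1) • Q by rw [add_smul, one_smul]; abel] at e
  have k₁ := h.ne_zero (a - 1) (b + 1) (by omega)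
  have k₂ := h.ne_zero a (b + 1) (by omega)
  have k₃ := h.ne_zero (a - 1 - 1) b (by omega)
  have k₄ := h.ne_zero (a - 1) (b - 1) (by omega)
  simp only [ChordRel, latX, one_smul, zero_smul, add_zero, zero_add, sub_add_cancel] at *
  refine mul_right_cancel₀ (mul_ne_zero (mul_ne_zero k₁ k₂) (mul_ne_zero k₃ k₄)) ?_
  generalize N (a + 1) (b + 1) = A at *
  generalize N (a - 1) b = B at *
  generalize N a (b - 1) = C at *
  generalize N a b = D at *
  generalize N (a - 1) (b + 1) = E at *
  generalize N a (b + 1) = G at *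
  generalize N (a - 1 - 1) b = H' at *
  generalize N (a - 1) (b - 1) = K at *
  generalize chord P Q (a • P + b • Q) = l at *
  generalize chord P Q ((a - 1) • P + b • Q) = l' at *
  generalize xCoord P - xCoord (a • P + (b + 1) • Q) = α at *
  generalize xCoord P - xCoord ((a - 1) • P + b • Q) = β at *
  generalize xCoord Q - xCoord (a • P + b • Q) = γ at *
  generalize xCoord Q - xCoord ((a - 1) • P + b • Q) = δ at *
  calc A * B * C * (E * G * (H' * K)) = (A * E) * (G * C) * (H' * K) * B := by ring
    _ = G * D ^ 2 * B * (α * γ) * (G * H' * K) := by rw [r₁, r₃]; ring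
    _ = G * D ^ 2 * B ^ 4 * (l' * (α * γ)) := by rw [H]; ring
    _ = G * D ^ 2 * l * (B ^ 2 * β) * (B ^ 2 * δ) := by rw [← e]; ring
    _ = D ^ 3 * l * (E * G * (H' * K)) := by rw [← r₂, ← r₄]; ring

lemma chordRel_step_right {a b : ℤ} (h₀ : a ≠ 0 ∨ b ≠ 0) (h₁ : a ≠ 1 ∨ b ≠ 0) (h₂ : a ≠ -1 ∨ b ≠ 0)
    (h₃ : a ≠ 0 ∨ b ≠ 1) (h₄ : a ≠ 0 ∨ b ≠ -1) (h₅ : a ≠ 0 ∨ b ≠ 2) (h₆ : a ≠ 1 ∨ b ≠ 1)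
    (h₇ : a ≠ -1 ∨ b ≠ 1) (H : ChordRel P Q N a (b - 1)) : ChordRel P Q N a b :=
  chordRel_swap hPQ <| h.swap.chordRel_step_left hPQ.symm (by omega) (by omega) (by omega)
    (by omega) (by omega) (by omega) (by omega) (by omega) (chordRel_swap hPQ.symm H)

/-- The product of the values of the line at opposite points is a product of differences of
`x`-coordinates, so the relation at `u` gives the one at `-u`. -/
lemma chordRel_neg {a b : ℤ} (h₀ : a ≠ 0 ∨ b ≠ 0) (h₁ : a ≠ 1 ∨ b ≠ 0) (h₂ : a ≠ 0 ∨ b ≠ 1)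
    (h₃ : a ≠ -1 ∨ b ≠ -1) (H : ChordRel P Q N a b) : ChordRel P Q N (-a) (-b) := by
  have r₁ := h.rec₁ a b h₀
  have r₂ := h.rec₂ a b h₀
  have r₃ := h.rel_one_one hPQ h₀
  have e := chord_mul_chord_neg hPQ.left_ne_zero hPQ.symm.left_ne_zero hPQ.xCoord_sub_ne_zero
    (hPQ.ne_zero h₀)
  have k₁ := h.ne_zero (a + 1) (b + 1) (by omega)
  have k₂ := h.ne_zero (a - 1) b (by omega)
  have k₃ := h.ne_zero a (b - 1) (by omega)
  simp only [NetRel, h.val₁₁, latX, one_smul, zero_smul, add_zero, zero_add] at r₁ r₂ r₃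
  rw [ChordRel] at H ⊢
  rw [show -a + 1 = -(a - 1) by ring, show -b + 1 = -(b - 1) by ring,
    show -a - 1 = -(a + 1) by ring, show -b - 1 = -(b + 1) by ring, h.odd, h.odd, h.odd, h.odd,
    neg_smul, neg_smul, ← neg_add]
  refine mul_left_cancel₀ (mul_ne_zero (mul_ne_zero k₁ k₂) k₃) ?_
  calc _ = -((N (a + 1) (b + 1) * N (a - 1) (b - 1)) * (N (a + 1) b * N (a - 1) b)
        * (N a (b + 1) * N a (b - 1))) := by ring
    _ = -N a b ^ 6 * (chord P Q (a • P + b • Q) * chord P Q (-(a • P + b • Q))) := by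
      rw [r₁, r₂, r₃, e]; ring
    _ = _ := by rw [H]; ring

omit hPQ in
lemma chordRel_one_zero : ChordRel P Q N 1 0 := by
  norm_num [ChordRel, h.val₀₀, chord]

lemma chordRel_neg_one_zero : ChordRel P Q N (-1) 0 := by
  have o₁ := h.odd 2 0
  have o₂ := h.odd 1 1
  have o₃ := h.odd 1 0
  norm_num [h.val₁₁, h.val₂₀, h.val₁₀] at o₁ o₂ o₃
  norm_num [ChordRel, h.val₀₁, o₁, o₂, o₃, chord_neg_left hPQ.left_ne_zero, latPsi]

lemma chordRel_one_one : ChordRel P Q N 1 1 := by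
  norm_num [ChordRel, h.val₀₁, h.val₁₀, h.val₁₁, h.val₂₂ hPQ, latPsi,
    chord_add hPQ.left_ne_zero hPQ.symm.left_ne_zero hPQ.xCoord_sub_ne_zero]

lemma chordRel_neg_one_neg_one : ChordRel P Q N (-1) (-1) := by
  have e := chord_sub_chord_neg (P := P) (Q := Q) (U := P + Q)
    (by simpa using hPQ.ne_zero (a := 1) (b := 1) (by omega))
  rw [chord_add hPQ.left_ne_zero hPQ.symm.left_ne_zero hPQ.xCoord_sub_ne_zero] at e
  have e' : chord P Q (-(P + Q)) = 0 := by linear_combination -e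
  rw [ChordRel, neg_smul, neg_smul, ← neg_add, one_smul, one_smul, e']
  norm_num [h.val₀₀]

lemma chordRel_one_neg_one : ChordRel P Q N 1 (-1) := by
  have o := h.odd 0 1
  have r := h.rec₂ 1 (-1) (by omega)
  have e := chord_sub hPQ.left_ne_zero hPQ.symm.left_ne_zero hPQ.xCoord_sub_ne_zero
  norm_num [h.val₀₁, h.val₁₀, h.val_one_neg_one, latX] at o r
  norm_num [ChordRel, h.val_one_neg_one, latX, h.val₂₀, o, r, latPsi]
  rw [← sub_eq_add_neg P] at *
  linear_combination -(xCoord Q - xCoord P) ^ 2 * e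

lemma chordRel_two (a : ℤ) : ChordRel P Q N a 2 := by
  have s : ChordRel P Q N 1 2 := h.chordRel_step_right hPQ (by omega) (by omega) (by omega)
    (by omega) (by omega) (by omega) (by omega) (by omega) (by simpa using h.chordRel_one_one hPQ)
  have up : ∀ b m a : ℤ, 2 ≤ b.natAbs → ChordRel P Q N m b → m ≤ a → ChordRel P Q N a b := by
    intro b m a hb hm ha
    induction a, ha using Int.leInduction with
    | base => exact hm
    | succ a ha ih =>
      refine h.chordRel_step_left hPQ ?_ ?_ ?_ ?_ ?_ ?_ ?_ ?_ (by simpa using ih) <;> omega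
  rcases le_total 1 a with ha | ha
  · exact up 2 1 a (by norm_num) s ha
  · have := up (-2) (-1) (-a) (by norm_num) (h.chordRel_neg hPQ (by omega) (by omega) (by omega)
      (by omega) s) (by omega)
    simpa using h.chordRel_neg hPQ (by omega) (by omega) (by omega) (by omega) this

/-- Every nonzero lattice point except those with both coordinates at most `1` is reached from
`(1, 1)` by steps along which the relation propagates. -/
theorem chordRel {a b : ℤ} (hab : a ≠ 0 ∨ b ≠ 0) : ChordRel P Q N a b := by
  have col : ∀ a b : ℤ, 2 ≤ a.natAbs → -2 ≤ b → ChordRel P Q N a b := by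
    intro a b ha hb
    induction b, hb using Int.leInduction with
    | base =>
      simpa using h.chordRel_neg hPQ (by omega) (by omega) (by omega) (by omega)
        (h.chordRel_two hPQ (-a))
    | succ b hb ih =>
      refine h.chordRel_step_right hPQ ?_ ?_ ?_ ?_ ?_ ?_ ?_ ?_ (by simpa using ih) <;> omega
  have col' : ∀ a b : ℤ, 2 ≤ a.natAbs → ChordRel P Q N a b := by
    intro a b ha
    rcases le_total (-2) b with hb | hb
    · exact col a b ha hb
    · simpa using h.chordRel_neg hPQ (by omega) (by omega) (by omega) (by omega)
        (col (-a) (-b) (by omega) (by omega))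
  by_cases ha : 2 ≤ a.natAbs
  · exact col' a b ha
  by_cases hb : 2 ≤ b.natAbs
  · have row : ∀ a : ℤ, -2 ≤ a → ChordRel P Q N a b := by
      intro a ha
      induction a, ha using Int.leInduction with
      | base => exact col' _ _ (by norm_num)
      | succ a ha ih =>
        refine h.chordRel_step_left hPQ ?_ ?_ ?_ ?_ ?_ ?_ ?_ ?_ (by simpa using ih) <;> omega
    exact row a (by omega)
  obtain ⟨ha₁, ha₂⟩ : -1 ≤ a ∧ a ≤ 1 := by omega
  obtain ⟨hb₁, hb₂⟩ : -1 ≤ b ∧ b ≤ 1 := by omega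
  interval_cases a <;> interval_cases b
  · exact h.chordRel_neg_one_neg_one hPQ
  · exact h.chordRel_neg_one_zero hPQ
  · exact chordRel_swap hPQ (h.swap.chordRel_one_neg_one hPQ.symm)
  · exact chordRel_swap hPQ (h.swap.chordRel_neg_one_zero hPQ.symm)
  · omega
  · exact chordRel_swap hPQ h.swap.chordRel_one_zero
  · exact h.chordRel_one_neg_one hPQ
  · exact h.chordRel_one_zero
  · exact h.chordRel_one_one hPQ

/-- The difference of `chordRel` at `u` and at `-u`: the values of a line at opposite points differ
by `ψ₂`, and `N (2u) = N u ^ 4 ψ₂`. -/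
lemma two_mul_eq_sub (a b : ℤ) : N (a + a) (b + b) = N a b *
    (N (a + 1) (b + 1) * N (a - 1) b * N a (b - 1)
      - N (a + 1) b * N a (b + 1) * N (a - 1) (b - 1)) := by
  by_cases hab : a ≠ 0 ∨ b ≠ 0
  · have c₁ := h.chordRel hPQ hab
    have c₂ := h.chordRel hPQ (a := -a) (b := -b) (by omega)
    have e := chord_sub_chord_neg (P := P) (Q := Q) (hPQ.ne_zero hab)
    rw [ChordRel] at c₁ c₂
    rw [show -a + 1 = -(a - 1) by ring, show -b + 1 = -(b - 1) by ring,
      show -a - 1 = -(a + 1) by ring, show -b - 1 = -(b + 1) by ring, h.odd, h.odd, h.odd, h.odd,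
      neg_smul, neg_smul, ← neg_add] at c₂
    rw [h.two_mul_eq hPQ hab, latPsi, ← e]
    linear_combination -N a b * c₁ - N a b * c₂
  · obtain ⟨rfl, rfl⟩ : a = 0 ∧ b = 0 := by omega
    simp [h.val₀₀]

/-- The elliptic net recurrence with last index zero: the differences of `x`-coordinates in the
three terms add up to zero. -/
lemma cyclic_rel (a b c d e f : ℤ) :
    N (a + c) (b + d) * N (a - c) (b - d) * N e f ^ 2
      + N (c + e) (d + f) * N (c - e) (d - f) * N a b ^ 2
      + N (e + a) (f + b) * N (e - a) (f - b) * N c d ^ 2 = 0 := by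
  by_cases h₁ : a ≠ 0 ∨ b ≠ 0
  · by_cases h₂ : c ≠ 0 ∨ d ≠ 0
    · by_cases h₃ : e ≠ 0 ∨ f ≠ 0
      · have r₁ := h.rel hPQ h₁ h₂
        have r₂ := h.rel hPQ h₂ h₃
        have r₃ := h.rel hPQ h₃ h₁
        rw [NetRel] at r₁ r₂ r₃
        rw [r₁, r₂, r₃]
        ring
      · obtain ⟨rfl, rfl⟩ : e = 0 ∧ f = 0 := by omega
        simp only [h.val₀₀, add_zero, sub_zero, zero_add, zero_sub, h.odd]
        ring
    · obtain ⟨rfl, rfl⟩ : c = 0 ∧ d = 0 := by omega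
      simp only [h.val₀₀, add_zero, sub_zero, zero_add, zero_sub, h.odd]
      ring
  · obtain ⟨rfl, rfl⟩ : a = 0 ∧ b = 0 := by omega
    simp only [h.val₀₀, add_zero, sub_zero, zero_add, zero_sub, h.odd]
    ring

/-- The net satisfies every recurrence used in the definition of `netRec`, and it has the same
values at the indices at which that recursion stops. -/
theorem eq_netRec (a b : ℤ) :
    N a b = netRec (N 1 (-1)) (N 2 0) (N 0 2) (N 2 1) (N 1 2) (N 2 2) a b := by
  have rel := h.cyclic_rel hPQ
  have odd := h.odd
  have h00 := h.val₀₀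
  have h10 := h.val₁₀
  have h01 := h.val₀₁
  have h11 := h.val₁₁
  have h0m : N 0 (-1) = -1 := by simpa [h01] using odd 0 1
  have h0m2 : N 0 (-2) = -N 0 2 := by simpa using odd 0 2
  have hm1 : N (-1) 0 = -1 := by simpa [h10] using odd 1 0
  have w1 : N 2 (-1) = N 2 0 * N 0 2 - N 2 1 * N 1 (-1) ^ 2 := by
    have h := rel 1 0 1 (-1) 1 1
    norm_num at h
    rw [h0m2, h01, h10, h11] at h
    linear_combination h
  have w2 : N 1 (-2) = N 1 2 * N 1 (-1) ^ 2 - N 2 0 * N 0 2 := by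
    have h := rel 0 1 (-1) 1 1 1
    have o1 := odd 1 (-2)
    have o2 := odd 2 0
    have o3 := odd 1 (-1)
    norm_num at h o1 o2 o3
    rw [o1, o2, o3, h10, h01, h11] at h
    linear_combination -h
  have w3 : N 2 (-2) = N 1 (-1) * (N 0 2 * N 2 (-1) - N 2 0 * N 1 (-2)) := by
    have h := h.two_mul_eq_sub hPQ 1 (-1)
    norm_num at h
    rw [h0m2, h0m, h10] at h
    linear_combination h
  fun_induction netRec (N 1 (-1)) (N 2 0) (N 0 2) (N 2 1) (N 1 2) (N 2 2) a b with
  | case1 a b h =>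
    obtain ⟨ha, hb⟩ := h
    rw [abs_le] at ha hb
    have hodd := odd a b
    obtain ⟨ha1, ha2⟩ := ha
    obtain ⟨hb1, hb2⟩ := hb
    interval_cases a <;> interval_cases b <;>
      try simp only [Int.reduceNeg, neg_neg, _root_.neg_zero, h00, h10, h01, h11, w1, w2, w3]
        at hodd
    all_goals simp [netHalf, h00, h10, h01, h11, h0m, h0m2, hm1, w1, w2, w3]
    all_goals linear_combination hodd
  | case2 a b _ ha hb ih1 ih2 ih3 ih4 ih5 ih6 ih7 =>
    simp only [← ih1, ← ih2, ← ih3, ← ih4, ← ih5, ← ih6, ← ih7]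
    rw [← h.two_mul_eq_sub hPQ, show a / 2 + a / 2 = a by omega, show b / 2 + b / 2 = b by omega]
  | case3 a b h ha hb ih1 ih2 ih3 ih4 ih5 ih6 =>
    simp only [← ih1, ← ih2, ← ih3, ← ih4, ← ih5, ← ih6]
    clear ih1 ih2 ih3 ih4 ih5 ih6
    have ea : a = 2 * (a / 2) := by omega
    have eb : b = 2 * (b / 2) + 1 := by omega
    generalize a / 2 = m at ea ⊢
    generalize b / 2 = n at eb ⊢
    subst ea eb
    have h := rel m (n + 1) m n 1 0
    have o := odd (m - 1) (n + 1)
    simp only [sub_self, add_sub_cancel_left, h10, h01] at h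
    linear_combination (norm := ring_nf) h - N (m + 1) (n + 1) * N m n ^ 2 * o
  | case4 a b h ha hb ih1 ih2 ih3 ih4 ih5 ih6 =>
    simp only [← ih1, ← ih2, ← ih3, ← ih4, ← ih5, ← ih6]
    clear ih1 ih2 ih3 ih4 ih5 ih6
    have ea : a = 2 * (a / 2) + 1 := by omega
    have eb : b = 2 * (b / 2) := by omega
    generalize a / 2 = m at ea ⊢
    generalize b / 2 = n at eb ⊢
    subst ea eb
    have h := rel (m + 1) n m n 0 1
    have o := odd (m + 1) (n - 1)
    simp only [sub_self, add_sub_cancel_left, h10, h01] at h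
    linear_combination (norm := ring_nf) h - N (m + 1) (n + 1) * N m n ^ 2 * o
  | case5 a b h ha hb hab ih1 ih2 ih3 ih4 ih5 ih6 =>
    simp only [← ih1, ← ih2, ← ih3, ← ih4, ← ih5, ← ih6]
    clear ih1 ih2 ih3 ih4 ih5 ih6
    have ea : a = 2 * (a / 2) + 1 := by omega
    have eb : b = 2 * (b / 2) + 1 := by omega
    generalize a / 2 = m at ea ⊢
    generalize b / 2 = n at eb ⊢
    subst ea eb
    have h := rel (m + 1) (n + 1) m n 1 0
    have o := odd m (n + 1)
    simp only [add_sub_cancel_left, h10, h11] at h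
    linear_combination (norm := ring_nf) h - N (m + 2) (n + 1) * N m n ^ 2 * o
  | case6 a b h ha hb hab ih1 ih2 ih3 ih4 ih5 ih6 =>
    simp only [← ih1, ← ih2, ← ih3, ← ih4, ← ih5, ← ih6]
    clear ih1 ih2 ih3 ih4 ih5 ih6
    have ea : a = 2 * (a / 2) + 1 := by omega
    have eb : b = 2 * (b / 2) + 1 := by omega
    generalize a / 2 = m at ea ⊢
    generalize b / 2 = n at eb ⊢
    subst ea eb
    have h := rel (m + 1) (n + 1) m n 0 1
    have o := odd (m + 1) n
    simp only [add_sub_cancel_left, h01, h11] at h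
    linear_combination (norm := ring_nf) h - N (m + 1) (n + 2) * N m n ^ 2 * o

theorem eq_netPolynomial (a b : ℤ) : N a b = netPolynomial W P Q a b := by
  have hP := hPQ.left_ne_zero
  have hQ := hPQ.symm.left_ne_zero
  have hx := hPQ.xCoord_sub_ne_zero
  have e₁ := xCoord_add hP hQ hx
  have e₂ := yCoord_add hP hQ hx
  have e₃ := psiTwo_eq (add_ne_zero_of_xCoord hx)
  rw [h.eq_netRec hPQ, h.val_one_neg_one, h.val₂₁, h.val₁₂, h.val₂₀, h.val₀₂, h.val₂₂ hPQ]
  simp only [latX, latPsi, one_smul, zero_smul, add_zero, zero_add]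
  rcases P with _ | ⟨x₁, y₁, h₁⟩
  · exact (hP rfl).elim
  rcases Q with _ | ⟨x₂, y₂, h₂⟩
  · exact (hQ rfl).elim
  rw [e₂] at e₃
  simp only [xCoord_some, yCoord_some, psiTwo_some] at *
  have hx' : x₂ - x₁ ≠ 0 := by rw [← neg_sub]; exact neg_ne_zero.2 hx
  have hl : (y₁ - y₂) / (x₁ - x₂) = (y₂ - y₁) / (x₂ - x₁) := by
    rw [← neg_sub y₂, ← neg_sub x₂, neg_div_neg_eq]
  rw [hl] at e₁ e₃
  rw [netPolynomial]
  congr 1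
  · rw [e₁]; ring
  · rw [e₁]; ring
  · rw [e₃, eq_div_iff hx', e₁]
    field_simp
    ring

end

end IsBasicNet

end WeierstrassCurve.Affine.Point

/-! ### The quasi-parallelogram law of the local height at independent points -/

namespace WeierstrassCurve.Affine.Point

open WithZero

section Valuation

variable {L : Type*} [Field L] [Valued L ℤᵐ⁰]

/-- The additive valuation of `x` as a real number; only its values at nonzero elements matter. -/
noncomputable def ord (x : L) : ℝ := addVal (Valued.v x)

lemma ord_mul {x y : L} (hx : x ≠ 0) (hy : y ≠ 0) : ord (x * y) = ord x + ord y := by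
  rw [ord, ord, ord, addVal, addVal, addVal, map_mul, log_mul (by simpa) (by simpa)]
  push_cast
  ring

lemma ord_pow (x : L) (n : ℕ) : ord (x ^ n) = n * ord x := by
  rw [ord, ord, addVal, addVal, map_pow, log_pow]
  push_cast
  simp

lemma ord_one : ord (1 : L) = 0 := by
  simp [ord, addVal]

lemma ord_neg (x : L) : ord (-x) = ord x := by
  rw [ord, ord, Valuation.map_neg]

/-- `max 1 |x|`. -/
noncomputable def size (x : L) : ℤᵐ⁰ := max 1 (Valued.v x)

lemma one_le_size (x : L) : 1 ≤ size x := le_max_left _ _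

lemma size_ne_zero (x : L) : size x ≠ 0 := (zero_lt_one.trans_le (one_le_size x)).ne'

lemma size_mul_size_le (x y : L) :
    size x * size y ≤ max 1 (max (Valued.v (x + y)) (Valued.v (x * y))) := by
  rw [size, size]
  rcases le_or_gt (Valued.v x) 1 with hx | hx <;> rcases le_or_gt (Valued.v y) 1 with hy | hy
  · rw [max_eq_left hx, max_eq_left hy, one_mul]
    exact le_max_left _ _
  · rw [max_eq_left hx, max_eq_right hy.le, one_mul,
      Valuation.map_add_eq_of_lt_right _ (hx.trans_lt hy)]
    exact (le_max_left _ _).trans (le_max_right _ _)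
  · rw [max_eq_right hx.le, max_eq_left hy, mul_one,
      Valuation.map_add_eq_of_lt_left _ (hy.trans_lt hx)]
    exact (le_max_left _ _).trans (le_max_right _ _)
  · rw [max_eq_right hx.le, max_eq_right hy.le, ← map_mul]
    exact (le_max_right _ _).trans (le_max_right _ _)

lemma v_monomial_le {c x y : L} {K : ℤᵐ⁰} (hc : Valued.v c ≤ K) {i j : ℕ} (hi : i ≤ 2)
    (hj : j ≤ 2) : Valued.v (c * x ^ i * y ^ j) ≤ K * size x ^ 2 * size y ^ 2 := by
  rw [map_mul, map_mul, map_pow, map_pow]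
  exact mul_le_mul' (mul_le_mul' hc ((pow_le_pow_left' (le_max_right _ _) i).trans
    (pow_le_pow_right' (one_le_size x) hi))) ((pow_le_pow_left' (le_max_right _ _) j).trans
    (pow_le_pow_right' (one_le_size y) hj))

variable [DecidableEq L]

/-- The addition formulas bound the sizes of the `x`-coordinates of `A + B` and `A - B` from above.
No lower bound is needed. -/
lemma exists_size_mul_size_le (W : Affine L) : ∃ K : ℤᵐ⁰, K ≠ 0 ∧ ∀ A B : W.Point, A ≠ 0 → B ≠ 0 →
    xCoord A - xCoord B ≠ 0 → Valued.v (xCoord A - xCoord B) ^ 2 *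
      (size (xCoord (A + B)) * size (xCoord (A - B)))
        ≤ K * size (xCoord A) ^ 2 * size (xCoord B) ^ 2 := by
  obtain ⟨K, k₀, k₁, k₂, k₃, k₄, k₅⟩ : ∃ K : ℤᵐ⁰, 1 ≤ K ∧ Valued.v (2 : L) ≤ K ∧
      Valued.v W.b₂ ≤ K ∧ Valued.v W.b₄ ≤ K ∧ Valued.v W.b₆ ≤ K ∧ Valued.v W.b₈ ≤ K :=
    ⟨max 1 (max (Valued.v (2 : L)) (max (Valued.v W.b₂) (max (Valued.v W.b₄)
      (max (Valued.v W.b₆) (Valued.v W.b₈))))), by simp⟩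
  refine ⟨K, (zero_lt_one.trans_le k₀).ne', fun A B hA hB h ↦ ?_⟩
  have e₁ := xCoord_add_add_xCoord_sub hA hB h
  have e₂ := xCoord_add_mul_xCoord_sub hA hB h
  refine (mul_le_mul_right (size_mul_size_le _ _) _).trans ?_
  generalize xCoord A = x at *
  generalize xCoord B = y at *
  have m₀ : Valued.v (1 : L) ≤ K := by simpa
  rw [mul_max, mul_max, ← map_pow, ← map_mul, ← map_mul, e₁, e₂, mul_one]
  refine max_le ?_ (max_le ?_ ?_)
  · rw [show (x - y) ^ 2 = 1 * x ^ 2 * y ^ 0 + -2 * x ^ 1 * y ^ 1 + 1 * x ^ 0 * y ^ 2 by ring]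
    refine Valuation.map_add_le _ (Valuation.map_add_le _ (v_monomial_le m₀ ?_ ?_)
      (v_monomial_le (by rwa [Valuation.map_neg]) ?_ ?_)) (v_monomial_le m₀ ?_ ?_) <;> norm_num
  · rw [show 2 * (x + y) * (x * y) + W.b₂ * (x * y) + W.b₄ * (x + y) + W.b₆
      = 2 * x ^ 2 * y ^ 1 + 2 * x ^ 1 * y ^ 2 + W.b₂ * x ^ 1 * y ^ 1 + W.b₄ * x ^ 1 * y ^ 0
        + W.b₄ * x ^ 0 * y ^ 1 + W.b₆ * x ^ 0 * y ^ 0 by ring]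
    refine Valuation.map_add_le _ (Valuation.map_add_le _ (Valuation.map_add_le _
      (Valuation.map_add_le _ (Valuation.map_add_le _ (v_monomial_le k₁ ?_ ?_)
      (v_monomial_le k₁ ?_ ?_)) (v_monomial_le k₂ ?_ ?_)) (v_monomial_le k₃ ?_ ?_))
      (v_monomial_le k₃ ?_ ?_)) (v_monomial_le k₄ ?_ ?_) <;> norm_num
  · rw [show (x * y) ^ 2 - W.b₄ * (x * y) - W.b₆ * (x + y) - W.b₈
      = 1 * x ^ 2 * y ^ 2 + -W.b₄ * x ^ 1 * y ^ 1 + -W.b₆ * x ^ 1 * y ^ 0 + -W.b₆ * x ^ 0 * y ^ 1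
        + -W.b₈ * x ^ 0 * y ^ 0 by ring]
    rw [← Valuation.map_neg] at k₃ k₄ k₅
    refine Valuation.map_add_le _ (Valuation.map_add_le _ (Valuation.map_add_le _
      (Valuation.map_add_le _ (v_monomial_le m₀ ?_ ?_) (v_monomial_le k₃ ?_ ?_))
      (v_monomial_le k₄ ?_ ?_)) (v_monomial_le k₄ ?_ ?_)) (v_monomial_le k₅ ?_ ?_) <;> norm_num

end Valuation

section Generic

variable {L : Type*} [Field L] [DecidableEq L] {W : Affine L}

/-- The point `A` has infinite order. -/
def NonTorsion (A : W.Point) : Prop := ∀ n : ℤ, n • A = 0 → n = 0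

/-- `A`, `B`, `A + B` and `A - B` have infinite order. -/
structure Generic (A B : W.Point) : Prop where
  left : NonTorsion A
  right : NonTorsion B
  add : NonTorsion (A + B)
  sub : NonTorsion (A - B)

lemma NonTorsion.ne_zero {A : W.Point} (h : NonTorsion A) : A ≠ 0 := by
  rintro rfl
  exact one_ne_zero (h 1 (smul_zero _))

lemma NonTorsion.add_self {A : W.Point} (h : NonTorsion A) : NonTorsion (A + A) := fun n hn ↦ by
  have := h (n + n) (by rw [← hn]; module)
  omega

lemma Generic.xCoord_sub_ne_zero {A B : W.Point} (h : Generic A B) : xCoord A - xCoord B ≠ 0 :=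
  Point.xCoord_sub_ne_zero h.left.ne_zero h.right.ne_zero h.sub.ne_zero h.add.ne_zero

lemma Generic.add_sub {A B : W.Point} (h : Generic A B) : Generic (A + B) (A - B) where
  left := h.add
  right := h.sub
  add := by
    rw [show A + B + (A - B) = A + A by abel]
    exact h.left.add_self
  sub := by
    rw [show A + B - (A - B) = B + B by abel]
    exact h.right.add_self

lemma Independent.nonTorsion {P Q : W.Point} (h : Independent P Q) {a b : ℤ} (hab : a ≠ 0 ∨ b ≠ 0) :
    NonTorsion (a • P + b • Q) := fun n hn ↦ by
  have := h (n * a) (n * b) (by rw [← hn]; module)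
  simp only [mul_eq_zero] at this
  omega

lemma Independent.generic {P Q : W.Point} (h : Independent P Q) {a b c d : ℤ}
    (h₁ : a ≠ 0 ∨ b ≠ 0) (h₂ : c ≠ 0 ∨ d ≠ 0) (h₃ : a ≠ c ∨ b ≠ d) (h₄ : a ≠ -c ∨ b ≠ -d) :
    Generic (a • P + b • Q) (c • P + d • Q) where
  left := h.nonTorsion h₁
  right := h.nonTorsion h₂
  add := by
    rw [add_add_add_comm, ← add_smul, ← add_smul]
    exact h.nonTorsion (by omega)
  sub := by
    rw [add_sub_add_comm, ← sub_smul, ← sub_smul]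
    exact h.nonTorsion (by omega)

end Generic

section Height

variable {L : Type*} [Field L] [DecidableEq L] [Valued L ℤᵐ⁰] {W : Affine L}

/-- The normalised height `lam(P) - u(Δ) / 12`. -/
noncomputable def tildeHeight (lam : W.Point → ℝ) (A : W.Point) : ℝ :=
  lam A - (1 / 12 : ℝ) * ord W.Δ

/-- The defect of the quasi-parallelogram law
`λ(A + B) + λ(A - B) = 2 λ(A) + 2 λ(B) + ν(x(A) - x(B))`. -/
noncomputable def defect (lam : W.Point → ℝ) (A B : W.Point) : ℝ :=
  tildeHeight lam (A + B) + tildeHeight lam (A - B) - 2 * tildeHeight lam A - 2 * tildeHeight lam B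
    - ord (xCoord A - xCoord B)

variable {lam : W.Point → ℝ} (hlam : IsLocalNeronHeight W lam)
include hlam

lemma tildeHeight_add_self {A : W.Point} (hA : A + A ≠ 0) :
    tildeHeight lam (A + A) = 4 * tildeHeight lam A + ord (psiTwo A) := by
  rcases A with _ | ⟨x, y, h⟩
  · exact (hA (add_zero _)).elim
  rw [← two_smul ℕ] at hA ⊢
  rw [tildeHeight, tildeHeight, hlam.duplication x y h hA, ord, ord, psiTwo_some]
  ring

/-- Up to a bounded function the local height is half the logarithm of `max(1, |x|)`: near the point
at infinity by its limit behaviour, elsewhere by its boundedness. -/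
lemma exists_abs_sub_log_size_le : ∃ M : ℝ, ∀ A : W.Point, A ≠ 0 →
    |lam A - (1 / 2 : ℝ) * log (size (xCoord A))| ≤ M := by
  obtain ⟨c, hc⟩ := hlam.limit
  obtain ⟨N, hN⟩ := hc 1 one_pos
  obtain ⟨B, hB⟩ := hlam.bounded (max N 0)
  refine ⟨max (B + (1 / 2 : ℝ) * (max N 0 : ℤ)) (1 + |c|), fun A hA ↦ ?_⟩
  rcases A with _ | ⟨x, y, h⟩
  · exact (hA rfl).elim
  rw [xCoord_some]
  rcases le_or_gt (Valued.v x) (exp (max N 0)) with hx | hx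
  · refine le_max_of_le_left ((abs_sub _ _).trans (add_le_add (hB x y h hx) ?_))
    have h₁ : 0 ≤ log (size x) := by
      rw [← log_one, log_le_log one_ne_zero (size_ne_zero x)]
      exact one_le_size x
    have h₂ : log (size x) ≤ max N 0 := by
      rw [log_le_iff_le_exp (size_ne_zero x), size, max_le_iff]
      refine ⟨?_, hx⟩
      rw [← exp_zero, exp_le_exp]
      exact le_max_right _ _
    rw [abs_of_nonneg (by positivity)]
    gcongr
  · refine le_max_of_le_right ?_
    have h₁ : (1 : ℤᵐ⁰) ≤ Valued.v x := by
      refine le_trans ?_ hx.le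
      rw [← exp_zero, exp_le_exp]
      exact le_max_right _ _
    have h₂ := hN x y h ((exp_le_exp.2 (le_max_left _ _)).trans_lt hx)
    rw [size, max_eq_right h₁]
    rw [addVal] at h₂
    push_cast at h₂
    rw [abs_lt] at h₂
    rw [abs_le]
    have h₃ := neg_abs_le c
    have h₄ := le_abs_self c
    constructor <;> linarith

/-- The height `λ` is replaced by half the logarithm of the size of `x`, and
`exists_size_mul_size_le` is applied. -/
lemma exists_defect_le : ∃ C : ℝ, ∀ A B : W.Point, A ≠ 0 → B ≠ 0 →
    xCoord A - xCoord B ≠ 0 → defect lam A B ≤ C := by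
  obtain ⟨M, hM⟩ := exists_abs_sub_log_size_le hlam
  obtain ⟨K, hK, h⟩ := exists_size_mul_size_le W
  refine ⟨6 * M + (1 / 2 : ℝ) * log K + (1 / 6 : ℝ) * ord W.Δ, fun A B hA hB hx ↦ ?_⟩
  have h₁ := abs_le.1 (hM A hA)
  have h₂ := abs_le.1 (hM B hB)
  have h₃ := abs_le.1 (hM _ (add_ne_zero_of_xCoord hx))
  have h₄ := abs_le.1 (hM _ (sub_ne_zero_of_xCoord hx))
  have h₅ := h A B hA hB hx
  have hd : Valued.v (xCoord A - xCoord B) ≠ 0 := by simpa using hx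
  have hs := @size_ne_zero L _ _
  rw [← log_le_log (mul_ne_zero (pow_ne_zero _ hd) (mul_ne_zero (hs _) (hs _)))
    (mul_ne_zero (mul_ne_zero hK (pow_ne_zero _ (hs _))) (pow_ne_zero _ (hs _))),
    log_mul (pow_ne_zero _ hd) (mul_ne_zero (hs _) (hs _)), log_mul (hs _) (hs _),
    log_mul (mul_ne_zero hK (pow_ne_zero _ (hs _))) (pow_ne_zero _ (hs _)),
    log_mul hK (pow_ne_zero _ (hs _)), log_pow, log_pow, log_pow] at h₅
  have h₆ : (2 * log (Valued.v (xCoord A - xCoord B)) + (log (size (xCoord (A + B)))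
      + log (size (xCoord (A - B)))) : ℝ) ≤ log K + 2 * log (size (xCoord A))
      + 2 * log (size (xCoord B)) := by
    simp only [nsmul_eq_mul, Nat.cast_ofNat] at h₅
    exact_mod_cast h₅
  simp only [defect, tildeHeight, ord, addVal]
  push_cast
  linarith [h₁.1, h₂.1, h₃.2, h₄.2]

/-- By the duplication formula the defect is multiplied by `-2` when `(A, B)` is replaced by
`(A + B, A - B)`. Iterating this makes a nonzero defect arbitrarily large, against
`exists_defect_le`. -/
lemma defect_add_sub {A B : W.Point} (hA : A + A ≠ 0) (hB : B + B ≠ 0)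
    (hx : xCoord A - xCoord B ≠ 0) : defect lam (A + B) (A - B) = -2 * defect lam A B := by
  have hA0 : A ≠ 0 := by rintro rfl; exact hA (add_zero _)
  have hB0 : B ≠ 0 := by rintro rfl; exact hB (add_zero _)
  have e := xCoord_sub_sub_xCoord_add hA0 hB0 hx
  have k₁ := psiTwo_ne_zero hA
  have k₂ := psiTwo_ne_zero hB
  have k₃ : xCoord (A - B) - xCoord (A + B) ≠ 0 := fun h0 ↦
    mul_ne_zero k₁ k₂ (by rw [← e, h0, mul_zero])
  have o := congrArg ord e
  rw [ord_mul (pow_ne_zero 2 hx) k₃, ord_mul k₁ k₂, ord_pow,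
    ← ord_neg (xCoord (A - B) - _), neg_sub] at o
  have d₁ := tildeHeight_add_self hlam hA
  have d₂ := tildeHeight_add_self hlam hB
  rw [defect, defect, show A + B + (A - B) = A + A by abel, show A + B - (A - B) = B + B by abel,
    d₁, d₂]
  push_cast at o
  linarith

lemma pow_mul_defect_le {C : ℝ} (hC : ∀ A B : W.Point, A ≠ 0 → B ≠ 0 →
    xCoord A - xCoord B ≠ 0 → defect lam A B ≤ C) (n : ℕ) :
    ∀ A B : W.Point, Generic A B → (-2) ^ n * defect lam A B ≤ C := by
  induction n with
  | zero =>
    intro A B h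
    simpa using hC A B h.left.ne_zero h.right.ne_zero h.xCoord_sub_ne_zero
  | succ n ih =>
    intro A B h
    have := ih _ _ h.add_sub
    rw [defect_add_sub hlam h.left.add_self.ne_zero h.right.add_self.ne_zero
      h.xCoord_sub_ne_zero] at this
    rw [pow_succ]
    linarith

/-- Passing from `(A, B)` to `(A + B, A - B)` multiplies the defect by `-2`, so that a defect which
is bounded above vanishes. -/
theorem defect_eq_zero {A B : W.Point} (h : Generic A B) : defect lam A B = 0 := by
  obtain ⟨C, hC⟩ := exists_defect_le hlam
  have key := fun n ↦ pow_mul_defect_le hlam hC n A B h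
  have aux : ∀ x : ℝ, (∀ n : ℕ, 4 ^ n * x ≤ C) → x ≤ 0 := by
    intro x hx
    by_contra! h0
    obtain ⟨n, hn⟩ := pow_unbounded_of_one_lt (C / x) (by norm_num : (1 : ℝ) < 4)
    rw [div_lt_iff₀ h0] at hn
    exact (hx n).not_gt hn
  refine le_antisymm (aux _ fun n ↦ ?_) ?_
  · have := key (2 * n)
    rwa [pow_mul, show (-2 : ℝ) ^ 2 = 4 by norm_num] at this
  · have : -2 * defect lam A B ≤ 0 := aux _ fun n ↦ by
      have := key (2 * n + 1)
      rw [pow_succ, pow_mul, show (-2 : ℝ) ^ 2 = 4 by norm_num] at this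
      linarith
    linarith

/-- The symmetry of the height is no part of its definition; it follows from the vanishing of the
defect at `(A, B)` and at `(B, A)`, if there is an independent second point. -/
lemma tildeHeight_neg {A B : W.Point} (h : Independent A B) :
    tildeHeight lam (-A) = tildeHeight lam A := by
  have e₁ : defect lam (A + B) B = 0 := defect_eq_zero hlam <| by
    simpa using h.generic (a := 1) (b := 1) (c := 0) (d := 1) (by omega) (by omega) (by omega)
      (by omega)
  have e₂ : defect lam B (A + B) = 0 := defect_eq_zero hlam <| by
    simpa using h.generic (a := 0) (b := 1) (c := 1) (d := 1) (by omega) (by omega) (by omega)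
      (by omega)
  have e₃ := ord_neg (xCoord (A + B) - xCoord B)
  rw [defect] at e₁ e₂
  rw [neg_sub] at e₃
  rw [add_sub_cancel_right] at e₁
  rw [show B - (A + B) = -A by abel, add_comm B] at e₂
  linarith

end Height

lemma eq_zero_of_second_difference {f : ℤ → ℝ} (h₀ : f 0 = 0) (h₁ : f 1 = 0)
    (h : ∀ n, f (n + 1) + f (n - 1) = 2 * f n) (n : ℤ) : f n = 0 := by
  suffices H : f n = 0 ∧ f (n + 1) = 0 from H.1
  induction n using Int.induction_on with
  | zero => exact ⟨h₀, by simpa using h₁⟩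
  | succ n ih =>
    refine ⟨ih.2, ?_⟩
    have := h (n + 1)
    rw [add_sub_cancel_right] at this
    linarith [ih.1, ih.2]
  | pred n ih =>
    rw [sub_add_cancel]
    exact ⟨by linarith [h (-n), ih.1, ih.2], ih.1⟩

section Formula

variable {L : Type*} [Field L] [DecidableEq L] [Valued L ℤᵐ⁰] {W : Affine L}

/-- The difference between the two sides of the height formula for a net `N`. -/
noncomputable def netDefect (lam : W.Point → ℝ) (P Q : W.Point) (N : ℤ → ℤ → L) (a b : ℤ) : ℝ :=
  if a = 0 ∧ b = 0 then 0 else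
    tildeHeight lam (a • P + b • Q) - a ^ 2 * tildeHeight lam P - b ^ 2 * tildeHeight lam Q
      - a * b * (tildeHeight lam (P + Q) - tildeHeight lam P - tildeHeight lam Q) - ord (N a b)

variable {lam : W.Point → ℝ} (hlam : IsLocalNeronHeight W lam) {P Q : W.Point}
include hlam

/-- The quasi-parallelogram law `defect_eq_zero` and the recurrence of the net for `w = (1, 0)` have
the same second differences, so their difference is affine along every row. -/
lemma netDefect_row (hPQ : Independent P Q) {N : ℤ → ℤ → L} (h : IsBasicNet P Q N) (a b : ℤ) :
    netDefect lam P Q N (a + 1) b + netDefect lam P Q N (a - 1) b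
      = 2 * netDefect lam P Q N a b := by
  by_cases h₀ : a = 0 ∧ b = 0
  · rw [h₀.1, h₀.2, netDefect, netDefect, netDefect]
    have o := h.odd 1 0
    norm_num at o
    norm_num [o, ord_neg, h.val₁₀, tildeHeight_neg hlam hPQ, ord_one]
  by_cases h₁ : a = 1 ∧ b = 0
  · have e := tildeHeight_add_self hlam (A := P)
      (by simpa [two_smul] using hPQ.ne_zero (a := 2) (b := 0) (by omega))
    rw [h₁.1, h₁.2, netDefect, netDefect, netDefect]
    norm_num [h.val₁₀, ord_one, h.val₂₀, latPsi]
    rw [two_smul, e]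
    ring
  by_cases h₂ : a = -1 ∧ b = 0
  · have h2P : P + P ≠ 0 := by
      simpa [two_smul] using hPQ.ne_zero (a := 2) (b := 0) (by omega)
    have e := tildeHeight_add_self hlam h2P
    have e' := tildeHeight_neg hlam (A := P + P) (B := Q) fun a b hab ↦ by
      have := hPQ (2 * a) b (by rw [← hab]; module)
      omega
    have o := h.odd 1 0
    have o' := h.odd 2 0
    norm_num at o o'
    rw [h₂.1, h₂.2, netDefect, netDefect, netDefect]
    norm_num [o, o', ord_neg, h.val₁₀, ord_one, h.val₂₀, latPsi, tildeHeight_neg hlam hPQ]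
    rw [two_smul, e', e]
    ring
  have g := h.ne_zero
  have r := congrArg ord (h.rec₁ a b (by omega))
  have hx := latX_sub_ne_zero hPQ (a := 1) (b := 0) (c := a) (d := b) (by omega) (by omega)
    (by omega) (by omega)
  rw [ord_mul (g _ _ (by omega)) (g _ _ (by omega)),
    ord_mul (pow_ne_zero _ (g _ _ (by omega))) hx, ord_pow, ← ord_neg (_ - _), neg_sub] at r
  have d := defect_eq_zero hlam (hPQ.generic (a := a) (b := b) (c := 1) (d := 0) (by omega)
    (by omega) (by omega) (by omega))
  rw [defect, ← latX, ← latX] at d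
  rw [netDefect, netDefect, netDefect, if_neg (by omega), if_neg (by omega), if_neg (by omega)]
  rw [show a • P + b • Q + ((1 : ℤ) • P + (0 : ℤ) • Q) = (a + 1) • P + b • Q by module,
    show a • P + b • Q - ((1 : ℤ) • P + (0 : ℤ) • Q) = (a - 1) • P + b • Q by module,
    one_smul, zero_smul, add_zero] at d
  push_cast at r ⊢
  linarith

omit hlam in
lemma netDefect_swap (N : ℤ → ℤ → L) (a b : ℤ) :
    netDefect lam Q P (fun a b ↦ N b a) b a = netDefect lam P Q N a b := by
  rw [netDefect, netDefect, add_comm, add_comm Q]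
  by_cases h : a = 0 ∧ b = 0
  · rw [if_pos h, if_pos h.symm]
  · rw [if_neg h, if_neg fun h' ↦ h h'.symm]
    ring

lemma netDefect_eq_zero (hPQ : Independent P Q) {N : ℤ → ℤ → L} (h : IsBasicNet P Q N) (a b : ℤ) :
    netDefect lam P Q N a b = 0 := by
  have col : ∀ a b, netDefect lam P Q N a (b + 1) + netDefect lam P Q N a (b - 1)
      = 2 * netDefect lam P Q N a b := fun a b ↦ by
    simpa only [netDefect_swap] using netDefect_row hlam hPQ.symm h.swap b a
  have v₀₀ : netDefect lam P Q N 0 0 = 0 := by simp [netDefect]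
  have v₀₁ : netDefect lam P Q N 0 1 = 0 := by simp [netDefect, h.val₀₁, ord_one]
  have v₁₀ : netDefect lam P Q N 1 0 = 0 := by simp [netDefect, h.val₁₀, ord_one]
  have v₁₁ : netDefect lam P Q N 1 1 = 0 := by simp [netDefect, h.val₁₁, ord_one]
  exact eq_zero_of_second_difference (f := fun a ↦ netDefect lam P Q N a b)
    (eq_zero_of_second_difference (f := fun b ↦ netDefect lam P Q N 0 b) v₀₀ v₀₁ (col 0) b)
    (eq_zero_of_second_difference (f := fun b ↦ netDefect lam P Q N 1 b) v₁₀ v₁₁ (col 1) b)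
    (fun a ↦ netDefect_row hlam hPQ h a b) a

/-- The asserted height formula for independent points. -/
theorem tildeHeight_eq_of_independent (hPQ : Independent P Q) {a b : ℤ} (hab : a ≠ 0 ∨ b ≠ 0) :
    netPolynomial W P Q a b ≠ 0 ∧ tildeHeight lam (a • P + b • Q)
      = a ^ 2 * tildeHeight lam P + b ^ 2 * tildeHeight lam Q
        + a * b * (tildeHeight lam (P + Q) - tildeHeight lam P - tildeHeight lam Q)
        + ord (netPolynomial W P Q a b) := by
  obtain ⟨N, h⟩ := exists_isBasicNet hPQ
  have e := netDefect_eq_zero hlam hPQ h a b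
  rw [← h.eq_netPolynomial hPQ]
  refine ⟨h.ne_zero a b hab, ?_⟩
  rw [netDefect, if_neg (by omega)] at e
  linarith

end Formula

end WeierstrassCurve.Affine.Point

/-! ### Torsion points are countable -/

namespace WeierstrassCurve.Affine.Point

section Torsion

variable {L : Type*} [Field L] (W : Affine L)

/-- Polynomials `(A, B)` with `A(t) / B(t) = x(2ⁿ P)`, where `t = 1 / x(P)`. -/
noncomputable def dupPoly : ℕ → L[X] × L[X]
  | 0 => (1, X)
  | n + 1 =>
    ((dupPoly n).1 ^ 4 - C W.b₄ * ((dupPoly n).1 ^ 2 * (dupPoly n).2 ^ 2)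
        - C (2 * W.b₆) * ((dupPoly n).1 * (dupPoly n).2 ^ 3) - C W.b₈ * (dupPoly n).2 ^ 4,
      4 * ((dupPoly n).1 ^ 3 * (dupPoly n).2) + C W.b₂ * ((dupPoly n).1 ^ 2 * (dupPoly n).2 ^ 2)
        + C (2 * W.b₄) * ((dupPoly n).1 * (dupPoly n).2 ^ 3) + C W.b₆ * (dupPoly n).2 ^ 4)

/-- Near `t = 0`, that is, near the point at infinity, `x(2ⁿ P)⁻¹ = 4ⁿ t + O(t²)`. So the rational
functions `x(2ⁿ P)` for different `n` are distinct, and they agree at finitely many `t` only. -/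
lemma eval_zero_dupPoly (n : ℕ) :
    (dupPoly W n).1.eval 0 = 1 ∧ (dupPoly W n).2.eval 0 = 0 ∧
      (derivative (dupPoly W n).2).eval 0 = 4 ^ n := by
  induction n with
  | zero => simp [dupPoly]
  | succ n ih =>
    obtain ⟨h₁, h₂, h₃⟩ := ih
    refine ⟨?_, ?_, ?_⟩
    · simp [dupPoly, h₁, h₂]
    · simp [dupPoly, h₂]
    · simp [dupPoly, h₁, h₂, h₃, pow_succ']

lemma dupPoly_snd_ne_zero [CharZero L] (n : ℕ) : (dupPoly W n).2 ≠ 0 := fun h ↦ by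
  have := (eval_zero_dupPoly W n).2.2
  rw [h, derivative_zero, eval_zero] at this
  exact pow_ne_zero n (by norm_num : (4 : L) ≠ 0) this.symm

lemma dupPoly_cross_ne_zero [CharZero L] {i j : ℕ} (h : i ≠ j) :
    (dupPoly W i).1 * (dupPoly W j).2 - (dupPoly W j).1 * (dupPoly W i).2 ≠ 0 := fun h0 ↦ by
  have := congrArg (fun p ↦ (derivative p).eval 0) h0
  obtain ⟨h₁, h₂, h₃⟩ := eval_zero_dupPoly W i
  obtain ⟨k₁, k₂, k₃⟩ := eval_zero_dupPoly W j
  simp only [derivative_sub, derivative_mul, eval_sub, eval_add, eval_mul, h₁, h₂, h₃, k₁, k₂, k₃,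
    derivative_zero, eval_zero] at this
  have h' : (4 : L) ^ j = 4 ^ i := by linear_combination this
  exact h (Nat.pow_right_injective (le_refl 2 |>.trans (by norm_num : 2 ≤ 4))
    (by exact_mod_cast h'.symm))

variable {W} [DecidableEq L]

lemma eval_dupPoly {A : W.Point} (hx : xCoord A ≠ 0) (n : ℕ) (h : 2 ^ n • A ≠ 0) :
    (dupPoly W n).2.eval (xCoord A)⁻¹ ≠ 0 ∧
      xCoord (2 ^ n • A) * (dupPoly W n).2.eval (xCoord A)⁻¹
        = (dupPoly W n).1.eval (xCoord A)⁻¹ := by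
  induction n with
  | zero => simp [dupPoly, hx]
  | succ n ih =>
    rw [pow_succ', mul_smul, two_smul] at h ⊢
    have h' : 2 ^ n • A ≠ 0 := fun h0 ↦ h (by rw [h0, add_zero])
    obtain ⟨ih₁, ih₂⟩ := ih h'
    have e₁ := psiTwo_sq_mul_xCoord_add_self h
    have e₂ := psiTwo_sq h'
    have e₃ := psiTwo_ne_zero h
    simp only [dupPoly, eval_add, eval_sub, eval_mul, eval_pow, eval_C, eval_ofNat]
    rw [← ih₂]
    generalize xCoord (2 ^ n • A) = x at *
    generalize (dupPoly W n).2.eval (xCoord A)⁻¹ = t at *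
    have e : 4 * ((x * t) ^ 3 * t) + W.b₂ * ((x * t) ^ 2 * t ^ 2) + 2 * W.b₄ * (x * t * t ^ 3)
        + W.b₆ * t ^ 4 = psiTwo (2 ^ n • A) ^ 2 * t ^ 4 := by
      rw [e₂]
      ring
    rw [e]
    refine ⟨mul_ne_zero (pow_ne_zero _ e₃) (pow_ne_zero _ ih₁), ?_⟩
    linear_combination t ^ 4 * e₁

lemma eval_dupPoly_eq_zero {A : W.Point} (hx : xCoord A ≠ 0) (n : ℕ) (h : 2 ^ n • A ≠ 0)
    (h' : 2 ^ (n + 1) • A = 0) : (dupPoly W (n + 1)).2.eval (xCoord A)⁻¹ = 0 := by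
  obtain ⟨e₁, e₂⟩ := eval_dupPoly hx n h
  rw [pow_succ', mul_smul, two_smul] at h'
  have e₃ := psiTwo_sq h
  have e₄ : psiTwo (2 ^ n • A) = 0 := by
    have := congrArg yCoord (eq_neg_of_add_eq_zero_left h')
    rw [yCoord_neg h] at this
    rw [psiTwo_eq h]
    linear_combination this
  rw [e₄] at e₃
  simp only [dupPoly, eval_add, eval_mul, eval_pow, eval_C, eval_ofNat]
  rw [← e₂]
  linear_combination -(eval (xCoord A)⁻¹ (dupPoly W n).2) ^ 4 * e₃

lemma countable_setOf_xCoord {s : Set L} (hs : s.Countable) :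
    {A : W.Point | xCoord A ∈ s}.Countable := by
  have : {A : W.Point | xCoord A ∈ s} ⊆ {0} ∪ ⋃ x ∈ s, {A : W.Point | A ≠ 0 ∧ xCoord A = x} := by
    intro A hA
    by_cases h0 : A = 0
    · exact Or.inl h0
    · exact Or.inr (Set.mem_biUnion hA ⟨h0, rfl⟩)
  refine (Set.Countable.union (Set.countable_singleton 0) (hs.biUnion fun x _ ↦ ?_)).mono this
  rcases Set.eq_empty_or_nonempty {A : W.Point | A ≠ 0 ∧ xCoord A = x} with h | ⟨A, hA0, hA⟩
  · rw [h]
    exact Set.countable_empty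
  · refine (Set.toFinite {A, -A}).countable.mono fun B hB ↦ ?_
    exact (xCoord_eq_iff hB.1 hA0).1 (hB.2.trans hA.symm)

lemma countable_setOf_eval {f : L[X]} (hf : f ≠ 0) :
    {A : W.Point | f.eval (xCoord A)⁻¹ = 0}.Countable := by
  have : {x : L | f.eval x⁻¹ = 0}.Countable := by
    have h := (f.rootSet_finite L).countable.image (fun x ↦ x⁻¹)
    refine h.mono fun x hx ↦ (Set.mem_image _ _ _).2 ⟨x⁻¹, ?_, inv_inv x⟩
    rw [mem_rootSet]
    exact ⟨hf, by simpa using hx⟩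
  exact countable_setOf_xCoord this

lemma exists_pow_smul_eq {A : W.Point} {n : ℤ} (hn : n ≠ 0) (h : n • A = 0) :
    ∃ i j : ℕ, i < j ∧ 2 ^ i • A = 2 ^ j • A := by
  have hA : IsOfFinAddOrder A := isOfFinAddOrder_iff_zsmul_eq_zero.2 ⟨n, hn, h⟩
  have hf : (AddSubgroup.zmultiples A : Set W.Point).Finite :=
    finite_zmultiples.2 hA
  obtain ⟨i, j, hij, e⟩ := hf.exists_lt_map_eq_of_forall_mem (f := fun i : ℕ ↦ 2 ^ i • A)
    fun i ↦ AddSubgroup.nsmul_mem_zmultiples A _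
  exact ⟨i, j, hij, e⟩

/-- If `A` is torsion, then `x(2ᵐ A) = x(2ⁿ A)` for some `m ≠ n` or some `2ⁿ A` is zero, which
restricts `x(A)` to the zeros of countably many nonzero polynomials. -/
theorem countable_torsion [CharZero L] : {A : W.Point | ¬ NonTorsion A}.Countable := by
  have : {A : W.Point | ¬ NonTorsion A} ⊆ {A | xCoord A ∈ ({0} : Set L)} ∪
      ((⋃ n : ℕ, {A : W.Point | (dupPoly W n).2.eval (xCoord A)⁻¹ = 0}) ∪
      ⋃ p : {p : ℕ × ℕ // p.1 ≠ p.2}, {A : W.Point |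
        ((dupPoly W p.1.1).1 * (dupPoly W p.1.2).2
          - (dupPoly W p.1.2).1 * (dupPoly W p.1.1).2).eval (xCoord A)⁻¹ = 0}) := by
    intro A hA
    simp only [NonTorsion, Set.mem_ofPred_eq, not_forall] at hA
    obtain ⟨n, hn, hn0⟩ := hA
    by_cases hx : xCoord A = 0
    · exact Or.inl hx
    refine Or.inr ?_
    obtain ⟨i, j, hij, e⟩ := exists_pow_smul_eq hn0 hn
    by_cases h : ∃ k, 2 ^ k • A = 0
    · left
      classical
      have hk := Nat.find_spec h
      have hk' := fun m ↦ Nat.find_min h (m := m)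
      rcases hm : Nat.find h with _ | m
      · rw [hm] at hk
        refine (hx ?_).elim
        rw [pow_zero, one_smul] at hk
        rw [hk]
        rfl
      · rw [hm] at hk hk'
        exact Set.mem_iUnion.2 ⟨m + 1, eval_dupPoly_eq_zero hx m (hk' m (by omega)) hk⟩
    · right
      push Not at h
      refine Set.mem_iUnion.2 ⟨⟨(i, j), hij.ne⟩, ?_⟩
      have h₁ := (eval_dupPoly hx i (h i)).2
      have h₂ := (eval_dupPoly hx j (h j)).2
      rw [← e] at h₂
      simp only [Set.mem_ofPred_eq, eval_sub, eval_mul, ← h₁, ← h₂]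
      ring
  refine Set.Countable.mono this (.union (countable_setOf_xCoord (Set.countable_singleton 0))
    (.union (Set.countable_iUnion fun n ↦ countable_setOf_eval (dupPoly_snd_ne_zero W n))
      (Set.countable_iUnion fun p ↦ countable_setOf_eval (dupPoly_cross_ne_zero W p.2))))

lemma countable_setOf_zsmul_eq [CharZero L] {n : ℤ} (hn : n ≠ 0) (R : W.Point) :
    {A : W.Point | n • A = R}.Countable := by
  rcases Set.eq_empty_or_nonempty {A : W.Point | n • A = R} with h | ⟨A, hA⟩
  · rw [h]
    exact Set.countable_empty
  · rw [Set.mem_ofPred_eq] at hA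
    refine (countable_torsion.image fun B ↦ B + A).mono fun B hB ↦ ?_
    rw [Set.mem_ofPred_eq] at hB
    have h : ¬ NonTorsion (B - A) := fun h ↦ hn (h n (by rw [smul_sub, hA, hB, sub_self]))
    exact (Set.mem_image _ _ _).2 ⟨B - A, h, sub_add_cancel B A⟩

lemma countable_setOf_not_independent [CharZero L] {P : W.Point} (hP : NonTorsion P) :
    {Q : W.Point | ¬ Independent P Q}.Countable := by
  have : {Q : W.Point | ¬ Independent P Q} ⊆ ⋃ p : {p : ℤ × ℤ // p.2 ≠ 0},
      {Q : W.Point | p.1.2 • Q = -(p.1.1 • P)} := by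
    intro Q hQ
    simp only [Independent, Set.mem_ofPred_eq, not_forall] at hQ
    obtain ⟨a, b, h, h'⟩ := hQ
    have hb : b ≠ 0 := by
      rintro rfl
      rw [zero_smul, add_zero] at h
      exact h' ⟨hP a h, rfl⟩
    exact Set.mem_iUnion.2 ⟨⟨(a, b), hb⟩, eq_neg_of_add_eq_zero_right h⟩
  exact .mono this (Set.countable_iUnion fun p ↦ countable_setOf_zsmul_eq p.2 _)

end Torsion

end WeierstrassCurve.Affine.Point

/-! ### Independent pairs of points are dense -/

namespace WeierstrassCurve.Affine.Point

open Filter Topology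

section Density

variable {L : Type*} [NontriviallyNormedField L] [CompleteSpace L]

/-- A nondegenerate zero of `f` in the plane can be perturbed so that its image under a coordinate
avoids a given countable set. -/
lemma exists_zero_near {f : L × L → L} {f' ℓ : L × L →L[L] L} {a : L × L}
    (hf : HasStrictFDerivAt f f' a) (hs : Function.Surjective (ℓ.prod f')) (ha : f a = 0)
    {U : Set (L × L)} (hU : U ∈ 𝓝 a) {T : Set L} (hT : T.Countable) :
    ∃ b ∈ U, f b = 0 ∧ ℓ b ∉ T := by
  have hm := (ℓ.hasStrictFDerivAt.prodMk hf).map_nhds_eq_of_surj (LinearMap.range_eq_top.2 hs)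
  have h₁ := image_mem_map (m := fun b ↦ (ℓ b, f b)) hU
  rw [hm, ha] at h₁
  have h₂ : ∀ᶠ x in 𝓝 (ℓ a), (x, (0 : L)) ∈ (fun b ↦ (ℓ b, f b)) '' U :=
    (Continuous.prodMk_left (0 : L)).continuousAt.eventually_mem h₁
  obtain ⟨x, hx, hxT⟩ := (hT.dense_compl L).inter_nhds_nonempty h₂
  obtain ⟨b, hb, e⟩ := hxT
  have e₁ : ℓ b = x := congrArg Prod.fst e
  have e₂ : f b = 0 := congrArg Prod.snd e
  exact ⟨b, hb, e₂, fun h ↦ hx (e₁ ▸ h)⟩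

variable {W : Affine L} [W.IsElliptic]

omit [CompleteSpace L] [W.IsElliptic] in
lemma hasStrictFDerivAt_equation (a : L × L) : HasStrictFDerivAt
    (fun p : L × L ↦ p.2 ^ 2 + W.a₁ * p.1 * p.2 + W.a₃ * p.2
      - (p.1 ^ 3 + W.a₂ * p.1 ^ 2 + W.a₄ * p.1 + W.a₆))
    ((W.a₁ * a.2 - (3 * a.1 ^ 2 + 2 * W.a₂ * a.1 + W.a₄)) • ContinuousLinearMap.fst L L L
      + (2 * a.2 + W.a₁ * a.1 + W.a₃) • ContinuousLinearMap.snd L L L) a := by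
  have h₁ : HasStrictFDerivAt (fun p : L × L ↦ p.1) (ContinuousLinearMap.fst L L L) a :=
    hasStrictFDerivAt_fst
  have h₂ : HasStrictFDerivAt (fun p : L × L ↦ p.2) (ContinuousLinearMap.snd L L L) a :=
    hasStrictFDerivAt_snd
  have h := (((h₂.pow 2).add ((h₁.const_mul W.a₁).mul h₂)).add (h₂.const_mul W.a₃)).sub
    ((((h₁.pow 3).add ((h₁.pow 2).const_mul W.a₂)).add (h₁.const_mul W.a₄)).add_const W.a₆)
  refine HasStrictFDerivAt.congr_fderiv (f := fun p : L × L ↦ _) h ?_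
  ext <;> simp
  ring

/-- By the implicit function theorem one of the coordinates is a local parameter near a nonsingular
point, so that every neighbourhood of it contains uncountably many points. -/
lemma exists_point_near {A : W.Point} (hA : A ≠ 0) {U : Set (L × L)}
    (hU : U ∈ 𝓝 (xCoord A, yCoord A)) {S : Set W.Point} (hS : S.Countable) :
    ∃ B : W.Point, B ≠ 0 ∧ B ∉ S ∧ (xCoord B, yCoord B) ∈ U := by
  have hd := hasStrictFDerivAt_equation (W := W) (xCoord A, yCoord A)
  have e := equation_coords hA
  have mk : ∀ b : L × L, b.2 ^ 2 + W.a₁ * b.1 * b.2 + W.a₃ * b.2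
      - (b.1 ^ 3 + W.a₂ * b.1 ^ 2 + W.a₄ * b.1 + W.a₆) = 0 → W.Nonsingular b.1 b.2 := fun b hb ↦
    equation_iff_nonsingular.1 ((W.equation_iff ..).2 (by linear_combination hb))
  rcases ((W.nonsingular_iff' ..).1 (nonsingular_coords hA)).2 with h | h
  · obtain ⟨b, hb, hf, hbT⟩ := exists_zero_near (ℓ := ContinuousLinearMap.snd L L L) hd
      (fun p ↦ ⟨((p.2 - (2 * yCoord A + W.a₁ * xCoord A + W.a₃) * p.1)
        / (W.a₁ * yCoord A - (3 * xCoord A ^ 2 + 2 * W.a₂ * xCoord A + W.a₄)), p.1), by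
          ext
          · simp
          · simp [mul_div_cancel₀ _ h]⟩) (by linear_combination e) hU (hS.image yCoord)
    exact ⟨.some b.1 b.2 (mk b hf), some_ne_zero _, fun hS ↦ hbT (Set.mem_image_of_mem yCoord hS),
      hb⟩
  · obtain ⟨b, hb, hf, hbT⟩ := exists_zero_near (ℓ := ContinuousLinearMap.fst L L L) hd
      (fun p ↦ ⟨(p.1, (p.2 - (W.a₁ * yCoord A - (3 * xCoord A ^ 2 + 2 * W.a₂ * xCoord A + W.a₄))
        * p.1) / (2 * yCoord A + W.a₁ * xCoord A + W.a₃)), by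
          ext
          · simp
          · simp [mul_div_cancel₀ _ h]⟩) (by linear_combination e) hU (hS.image xCoord)
    exact ⟨.some b.1 b.2 (mk b hf), some_ne_zero _, fun hS ↦ hbT (Set.mem_image_of_mem xCoord hS),
      hb⟩

variable [DecidableEq L] [CharZero L]

/-- The filter on pairs of points which are independent and close to `(P, Q)`. -/
def nhdsIndependent {L : Type*} [Field L] [DecidableEq L] [TopologicalSpace L] {W : Affine L}
    (P Q : W.Point) : Filter (W.Point × W.Point) :=
  comap (fun p ↦ ((xCoord p.1, yCoord p.1), (xCoord p.2, yCoord p.2)))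
    (𝓝 ((xCoord P, yCoord P), (xCoord Q, yCoord Q))) ⊓ 𝓟 {p | Independent p.1 p.2}

/-- Pairs of affine points are limits of pairs of independent points: a point close to `P` is chosen
outside the torsion, then a point close to `Q` outside a countable set of points which depend on
it. -/
lemma nhdsIndependent_neBot {P Q : W.Point} (hP : P ≠ 0) (hQ : Q ≠ 0) :
    (nhdsIndependent P Q).NeBot := by
  rw [nhdsIndependent, inf_principal_neBot_iff]
  intro s hs
  obtain ⟨t, ht, hts⟩ := mem_comap.1 hs
  rw [nhds_prod_eq] at ht
  obtain ⟨U, hU, V, hV, hUV⟩ := mem_prod_iff.1 ht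
  obtain ⟨A, hA0, hA, hAU⟩ := exists_point_near hP hU countable_torsion
  rw [Set.mem_ofPred_eq, not_not] at hA
  obtain ⟨B, hB0, hB, hBV⟩ := exists_point_near hQ hV (countable_setOf_not_independent hA)
  rw [Set.mem_ofPred_eq, not_not] at hB
  exact ⟨(A, B), hts (hUV ⟨hAU, hBV⟩), hB⟩

/-- A point none of whose translates by the lattice of `P` and `Q` is its own negative. -/
lemma exists_point_add_ne_neg {P Q : W.Point} (hP : P ≠ 0) :
    ∃ T : W.Point, ∀ a b : ℤ, (2 : ℤ) • T ≠ a • P + b • Q := by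
  have hc : (⋃ p : ℤ × ℤ, {T : W.Point | (2 : ℤ) • T = p.1 • P + p.2 • Q}).Countable :=
    Set.countable_iUnion fun p ↦ countable_setOf_zsmul_eq two_ne_zero _
  obtain ⟨T, -, hT, -⟩ := exists_point_near hP univ_mem hc
  exact ⟨T, fun a b h ↦ hT (Set.mem_iUnion.2 ⟨(a, b), h⟩)⟩

end Density

lemma netPolynomial_eq {L : Type*} [Field L] {W : Affine L} {P Q : W.Point}
    (hP : P ≠ 0) (hQ : Q ≠ 0) (a b : ℤ) :
    netPolynomial W P Q a b =
      let l := (yCoord Q - yCoord P) / (xCoord Q - xCoord P)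
      let t₁ := 2 * xCoord P + xCoord Q - l ^ 2 - W.a₁ * l + W.a₂
      let t₂ := 2 * xCoord Q + xCoord P - l ^ 2 - W.a₁ * l + W.a₂
      netRec (xCoord Q - xCoord P) (psiTwo P) (psiTwo Q) t₁ t₂
        ((t₁ * psiTwo Q - t₂ * psiTwo P) / (xCoord Q - xCoord P)) a b := by
  rcases P with _ | ⟨x₁, y₁, h₁⟩
  · exact (hP rfl).elim
  rcases Q with _ | ⟨x₂, y₂, h₂⟩
  · exact (hQ rfl).elim
  rfl

/-! ### Continuity of the group law and of net polynomials -/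

section Continuity

variable {L : Type*} [Field L] [TopologicalSpace L] {W : Affine L} {ι : Type*} {f : Filter ι}

/-- The points `A i` are eventually affine and converge to the affine point `B`. -/
structure TendstoPoint (A : ι → W.Point) (f : Filter ι) (B : W.Point) : Prop where
  ne_zero : ∀ᶠ i in f, A i ≠ 0
  lim_ne_zero : B ≠ 0
  x : Tendsto (fun i ↦ xCoord (A i)) f (𝓝 (xCoord B))
  y : Tendsto (fun i ↦ yCoord (A i)) f (𝓝 (yCoord B))

lemma tendstoPoint_const {B : W.Point} (hB : B ≠ 0) : TendstoPoint (fun _ ↦ B) f B :=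
  ⟨.of_forall fun _ ↦ hB, hB, tendsto_const_nhds, tendsto_const_nhds⟩

lemma TendstoPoint.congr {A A' : ι → W.Point} {B : W.Point} (h : TendstoPoint A f B)
    (e : ∀ i, A i = A' i) : TendstoPoint A' f B := by
  rwa [← funext e]

variable [IsTopologicalRing L]

lemma TendstoPoint.neg [DecidableEq L] {A : ι → W.Point} {B : W.Point} (h : TendstoPoint A f B) :
    TendstoPoint (fun i ↦ -A i) f (-B) where
  ne_zero := h.ne_zero.mono fun i hi ↦ neg_ne_zero.2 hi
  lim_ne_zero := neg_ne_zero.2 h.lim_ne_zero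
  x := by simpa only [xCoord_neg] using h.x
  y := by
    rw [yCoord_neg h.lim_ne_zero]
    refine Tendsto.congr' (h.ne_zero.mono fun i hi ↦ (yCoord_neg hi).symm) ?_
    exact ((h.y.neg.sub (h.x.const_mul _)).sub_const _)

variable [T2Space L] [ContinuousInv₀ L] [DecidableEq L]

lemma TendstoPoint.add {A A' : ι → W.Point} {B B' : W.Point} (h : TendstoPoint A f B)
    (h' : TendstoPoint A' f B') (hB : xCoord B - xCoord B' ≠ 0) :
    TendstoPoint (fun i ↦ A i + A' i) f (B + B') := by
  have hx := (h.x.sub h'.x).eventually_ne hB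
  have hl : Tendsto (fun i ↦ (yCoord (A i) - yCoord (A' i)) / (xCoord (A i) - xCoord (A' i))) f
      (𝓝 ((yCoord B - yCoord B') / (xCoord B - xCoord B'))) :=
    (h.y.sub h'.y).div (h.x.sub h'.x) hB
  have X : Tendsto (fun i ↦ xCoord (A i + A' i)) f (𝓝 (xCoord (B + B'))) := by
    rw [xCoord_add h.lim_ne_zero h'.lim_ne_zero hB]
    refine Tendsto.congr' ?_
      (((((hl.pow 2).add (hl.const_mul W.a₁)).sub_const W.a₂).sub h.x).sub h'.x)
    filter_upwards [h.ne_zero, h'.ne_zero, hx] with i h₁ h₂ h₃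
    rw [xCoord_add h₁ h₂ h₃]
  refine ⟨hx.mono fun i ↦ add_ne_zero_of_xCoord, add_ne_zero_of_xCoord hB, X, ?_⟩
  rw [yCoord_add h.lim_ne_zero h'.lim_ne_zero hB]
  refine Tendsto.congr' ?_
    (((h.y.add (hl.mul (X.sub h.x))).neg.sub (X.const_mul W.a₁)).sub_const W.a₃)
  filter_upwards [h.ne_zero, h'.ne_zero, hx] with i h₁ h₂ h₃
  rw [yCoord_add h₁ h₂ h₃]

/-- The group law is continuous at `aP + bQ` if this is an affine point. All partial sums are
shifted by a point `T` outside the lattice of `P` and `Q`, so that only additions of points with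
different `x`-coordinates occur. -/
lemma TendstoPoint.smul_add_smul {A A' : ι → W.Point} {P Q T : W.Point} (h : TendstoPoint A f P)
    (h' : TendstoPoint A' f Q) (hT : ∀ a b : ℤ, (2 : ℤ) • T ≠ a • P + b • Q) {a b : ℤ}
    (hab : a • P + b • Q ≠ 0) : TendstoPoint (fun i ↦ a • A i + b • A' i) f (a • P + b • Q) := by
  have hT₁ : ∀ a b : ℤ, T ≠ a • P + b • Q := fun a b e ↦
    hT (2 * a) (2 * b) (by nth_rewrite 1 [e]; module)
  have step : ∀ (a b c d : ℤ) (S : ι → W.Point), c • P + d • Q ≠ 0 →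
      TendstoPoint S f (c • P + d • Q) →
      TendstoPoint (fun i ↦ T + (a • A i + b • A' i)) f (T + (a • P + b • Q)) →
      TendstoPoint (fun i ↦ T + (a • A i + b • A' i) + S i) f
        (T + ((a + c) • P + (b + d) • Q)) := by
    intro a b c d S hcd hS H
    rw [show T + ((a + c) • P + (b + d) • Q) = T + (a • P + b • Q) + (c • P + d • Q) by module]
    refine H.add hS (xCoord_sub_ne_zero H.lim_ne_zero hcd (fun e ↦ hT₁ (c - a) (d - b) ?_)
      fun e ↦ hT₁ (-(a + c)) (-(b + d)) ?_)
    · rw [← sub_eq_zero, ← e]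
      module
    · rw [← sub_eq_zero, ← e]
      module
  have hP := h.lim_ne_zero
  have hQ := h'.lim_ne_zero
  have row : ∀ a : ℤ, TendstoPoint (fun i ↦ T + (a • A i + (0 : ℤ) • A' i)) f
      (T + (a • P + (0 : ℤ) • Q)) := by
    intro a
    induction a using Int.induction_on with
    | zero =>
      have hT0 : T ≠ 0 := by simpa using hT₁ 0 0
      simpa using tendstoPoint_const hT0
    | succ n ih =>
      have := step n 0 1 0 A (by simpa using hP) (by simpa using h) ih
      rw [add_zero] at this
      exact this.congr fun i ↦ by module
    | pred n ih =>
      have := step (-n) 0 (-1) 0 (fun i ↦ -A i) (by simpa using hP) (by simpa using h.neg) ih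
      rw [add_zero, ← sub_eq_add_neg] at this
      exact this.congr fun i ↦ by module
  have all : ∀ a b : ℤ, TendstoPoint (fun i ↦ T + (a • A i + b • A' i)) f
      (T + (a • P + b • Q)) := by
    intro a b
    induction b using Int.induction_on with
    | zero => exact row a
    | succ n ih =>
      have := step a n 0 1 A' (by simpa using hQ) (by simpa using h') ih
      rw [add_zero] at this
      exact this.congr fun i ↦ by module
    | pred n ih =>
      have := step a (-n) 0 (-1) (fun i ↦ -A' i) (by simpa using hQ) (by simpa using h'.neg) ih
      rw [add_zero, ← sub_eq_add_neg] at this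
      exact this.congr fun i ↦ by module
  have hT0 : -T ≠ 0 := neg_ne_zero.2 (by simpa using hT₁ 0 0)
  have := (all a b).add (tendstoPoint_const hT0) (xCoord_sub_ne_zero (all a b).lim_ne_zero hT0
    (fun e ↦ hT (-a) (-b) ?_) fun e ↦ hab ?_)
  · rw [show T + (a • P + b • Q) + -T = a • P + b • Q by abel] at this
    exact this.congr fun i ↦ by abel
  · rw [← sub_eq_zero, ← e]
    module
  · rw [← e]
    abel

omit [T2Space L] [ContinuousInv₀ L] [DecidableEq L] in
lemma tendsto_netRec {d c₁ c₂ t₁ t₂ s : ι → L} {d' c₁' c₂' t₁' t₂' s' : L}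
    (hd : Tendsto d f (𝓝 d')) (hc₁ : Tendsto c₁ f (𝓝 c₁')) (hc₂ : Tendsto c₂ f (𝓝 c₂'))
    (ht₁ : Tendsto t₁ f (𝓝 t₁')) (ht₂ : Tendsto t₂ f (𝓝 t₂')) (hs : Tendsto s f (𝓝 s'))
    (a b : ℤ) : Tendsto (fun i ↦ netRec (d i) (c₁ i) (c₂ i) (t₁ i) (t₂ i) (s i) a b) f
      (𝓝 (netRec d' c₁' c₂' t₁' t₂' s' a b)) := by
  have half : ∀ a b : ℤ, Tendsto (fun i ↦ netHalf (d i) (c₁ i) (c₂ i) (t₁ i) (t₂ i) (s i) a b) f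
      (𝓝 (netHalf d' c₁' c₂' t₁' t₂' s' a b)) := by
    intro a b
    have e₁ := (hc₁.mul hc₂).sub (ht₁.mul (hd.pow 2))
    have e₂ := (ht₂.mul (hd.pow 2)).sub (hc₁.mul hc₂)
    have e₃ := hd.mul ((hc₂.mul e₁).sub (hc₁.mul e₂))
    unfold netHalf
    split <;> first | assumption | exact tendsto_const_nhds
  fun_induction netRec d' c₁' c₂' t₁' t₂' s' a b with
  | case1 a b h =>
    simp_rw [netRec.eq_def _ _ _ _ _ _ a b, dif_pos h]
    exact (half _ _).sub (half _ _)
  | case2 a b h ha hb ih1 ih2 ih3 ih4 ih5 ih6 ih7 =>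
    simp_rw [netRec.eq_def _ _ _ _ _ _ a b, dif_neg h, if_pos ha, if_pos hb]
    exact ih1.mul (((ih2.mul ih3).mul ih4).sub ((ih5.mul ih6).mul ih7))
  | case3 a b h ha hb ih1 ih2 ih3 ih4 ih5 ih6 =>
    simp_rw [netRec.eq_def _ _ _ _ _ _ a b, dif_neg h, if_pos ha, if_neg hb]
    exact ((ih1.mul ih2).mul (ih3.pow 2)).sub ((ih4.mul ih5).mul (ih6.pow 2))
  | case4 a b h ha hb ih1 ih2 ih3 ih4 ih5 ih6 =>
    simp_rw [netRec.eq_def _ _ _ _ _ _ a b, dif_neg h, if_neg ha, if_pos hb]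
    exact ((ih1.mul ih2).mul (ih3.pow 2)).sub ((ih4.mul ih5).mul (ih6.pow 2))
  | case5 a b h ha hb hab ih1 ih2 ih3 ih4 ih5 ih6 =>
    simp_rw [netRec.eq_def _ _ _ _ _ _ a b, dif_neg h, if_neg ha, if_neg hb, if_pos hab]
    exact ((ih1.mul ih2).mul (ih3.pow 2)).sub ((ih4.mul ih5).mul (ih6.pow 2))
  | case6 a b h ha hb hab ih1 ih2 ih3 ih4 ih5 ih6 =>
    simp_rw [netRec.eq_def _ _ _ _ _ _ a b, dif_neg h, if_neg ha, if_neg hb, if_neg hab]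
    exact ((ih1.mul ih2).mul (ih3.pow 2)).sub ((ih4.mul ih5).mul (ih6.pow 2))

omit [T2Space L] [ContinuousInv₀ L] [DecidableEq L] in
lemma TendstoPoint.psiTwo {A : ι → W.Point} {B : W.Point} (h : TendstoPoint A f B) :
    Tendsto (fun i ↦ psiTwo (A i)) f (𝓝 (psiTwo B)) := by
  rw [psiTwo_eq h.lim_ne_zero]
  refine Tendsto.congr' (h.ne_zero.mono fun i hi ↦ (psiTwo_eq hi).symm) ?_
  exact ((h.y.const_mul 2).add (h.x.const_mul W.a₁)).add_const W.a₃

omit [T2Space L] [DecidableEq L] in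
lemma TendstoPoint.netPolynomial {A A' : ι → W.Point} {P Q : W.Point} (h : TendstoPoint A f P)
    (h' : TendstoPoint A' f Q) (hPQ : xCoord Q - xCoord P ≠ 0) (a b : ℤ) :
    Tendsto (fun i ↦ netPolynomial W (A i) (A' i) a b) f (𝓝 (netPolynomial W P Q a b)) := by
  rw [netPolynomial_eq h.lim_ne_zero h'.lim_ne_zero]
  refine Tendsto.congr' (f₁ := fun i ↦ _) (h.ne_zero.mp <| h'.ne_zero.mono fun i h₁ h₂ ↦
    (netPolynomial_eq h₂ h₁ a b).symm) ?_
  have hd := h'.x.sub h.x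
  have hl := (h'.y.sub h.y).div hd hPQ
  have ht₁ := ((((h.x.const_mul 2).add h'.x).sub (hl.pow 2)).sub (hl.const_mul W.a₁)).add_const W.a₂
  have ht₂ := ((((h'.x.const_mul 2).add h.x).sub (hl.pow 2)).sub (hl.const_mul W.a₁)).add_const W.a₂
  exact tendsto_netRec hd h.psiTwo h'.psiTwo ht₁ ht₂
    (((ht₁.mul h'.psiTwo).sub (ht₂.mul h.psiTwo)).div hd hPQ) a b

end Continuity

end WeierstrassCurve.Affine.Point

/-! ### The height formula over the completion -/

namespace WeierstrassCurve.Affine.Point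

open Filter Topology WithZero

section Limit

variable {L : Type*} [Field L] [DecidableEq L] [Valued L ℤᵐ⁰] {W : Affine L}

lemma tendstoPoint_fst {P Q : W.Point} (hP : P ≠ 0) :
    TendstoPoint Prod.fst (nhdsIndependent P Q) P where
  ne_zero := mem_inf_of_right fun _ hp ↦ Independent.left_ne_zero hp
  lim_ne_zero := hP
  x := tendsto_inf_left ((continuous_fst.fst.tendsto _).comp tendsto_comap)
  y := tendsto_inf_left ((continuous_fst.snd.tendsto _).comp tendsto_comap)

lemma tendstoPoint_snd {P Q : W.Point} (hQ : Q ≠ 0) :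
    TendstoPoint Prod.snd (nhdsIndependent P Q) Q where
  ne_zero := mem_inf_of_right fun _ hp ↦ (Independent.symm hp).left_ne_zero
  lim_ne_zero := hQ
  x := tendsto_inf_left ((continuous_snd.fst.tendsto _).comp tendsto_comap)
  y := tendsto_inf_left ((continuous_snd.snd.tendsto _).comp tendsto_comap)

variable {lam : W.Point → ℝ} (hlam : IsLocalNeronHeight W lam)
include hlam

lemma TendstoPoint.tildeHeight {ι : Type*} {f : Filter ι} {A : ι → W.Point} {B : W.Point}
    (h : TendstoPoint A f B) :
    Tendsto (fun i ↦ tildeHeight lam (A i)) f (𝓝 (tildeHeight lam B)) := by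
  refine Tendsto.sub_const ?_ _
  classical
  let base : {p : L × L // W.Nonsingular p.1 p.2} :=
    ⟨(xCoord B, yCoord B), nonsingular_coords h.lim_ne_zero⟩
  let g : ι → {p : L × L // W.Nonsingular p.1 p.2} := fun i ↦
    if hi : A i ≠ 0 then ⟨(xCoord (A i), yCoord (A i)), nonsingular_coords hi⟩ else base
  have hg : Tendsto g f (𝓝 base) := by
    rw [tendsto_subtype_rng]
    refine Tendsto.congr' ?_ (h.x.prodMk_nhds h.y)
    filter_upwards [h.ne_zero] with i hi
    simp only [g, dif_pos hi]
  have H := (hlam.continuous.tendsto base).comp hg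
  have e : lam B = lam (.some base.1.1 base.1.2 base.2) := congrArg lam (eq_some h.lim_ne_zero)
  rw [e]
  refine Tendsto.congr' ?_ H
  filter_upwards [h.ne_zero] with i hi
  simp only [g, Function.comp, dif_pos hi]
  exact congrArg lam (eq_some hi).symm

open scoped WithZeroTopology in
/-- The height formula passes to limits of independent pairs. The net polynomial does not vanish at
the limit, because its valuation stays bounded. -/
theorem tildeHeight_eq (hv : Function.Surjective (Valued.v : L → ℤᵐ⁰)) {P Q T : W.Point}
    (hP : P ≠ 0) (hQ : Q ≠ 0) (hx : xCoord P - xCoord Q ≠ 0) (hne : (nhdsIndependent P Q).NeBot)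
    (hT : ∀ a b : ℤ, (2 : ℤ) • T ≠ a • P + b • Q) {a b : ℤ} (hab : a • P + b • Q ≠ 0) :
    netPolynomial W P Q a b ≠ 0 ∧ tildeHeight lam (a • P + b • Q)
      = a ^ 2 * tildeHeight lam P + b ^ 2 * tildeHeight lam Q
        + a * b * (tildeHeight lam (P + Q) - tildeHeight lam P - tildeHeight lam Q)
        + ord (netPolynomial W P Q a b) := by
  have h₁ := tendstoPoint_fst (Q := Q) hP
  have h₂ := tendstoPoint_snd (P := P) hQ
  have tP := h₁.tildeHeight hlam
  have tQ := h₂.tildeHeight hlam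
  have tS := (h₁.add h₂ hx).tildeHeight hlam
  have tR := (h₁.smul_add_smul h₂ hT hab).tildeHeight hlam
  have tN := h₁.netPolynomial h₂ (by rwa [← neg_sub, neg_ne_zero]) a b
  have hab' : a ≠ 0 ∨ b ≠ 0 := by
    by_contra! h
    exact hab (by rw [h.1, h.2, zero_smul, zero_smul, add_zero])
  have key : ∀ᶠ p in nhdsIndependent P Q, netPolynomial W p.1 p.2 a b ≠ 0 ∧
      ord (netPolynomial W p.1 p.2 a b) = Point.tildeHeight lam (a • p.1 + b • p.2)
        - a ^ 2 * Point.tildeHeight lam p.1 - b ^ 2 * Point.tildeHeight lam p.2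
        - a * b * (Point.tildeHeight lam (p.1 + p.2) - Point.tildeHeight lam p.1
          - Point.tildeHeight lam p.2) := by
    refine mem_inf_of_right fun p hp ↦ ?_
    obtain ⟨e₁, e₂⟩ := tildeHeight_eq_of_independent hlam hp hab'
    exact ⟨e₁, by linarith⟩
  have tO := ((tR.sub (tP.const_mul (a ^ 2 : ℝ))).sub (tQ.const_mul (b ^ 2 : ℝ))).sub
    (((tS.sub tP).sub tQ).const_mul (a * b : ℝ))
  have tO' := tO.congr' (key.mono fun p hp ↦ hp.2.symm)
  have hN : netPolynomial W P Q a b ≠ 0 := by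
    intro h0
    rw [h0] at tN
    obtain ⟨m, hm⟩ := exists_int_gt (Point.tildeHeight lam (a • P + b • Q)
      - a ^ 2 * Point.tildeHeight lam P - b ^ 2 * Point.tildeHeight lam Q
      - a * b * (Point.tildeHeight lam (P + Q) - Point.tildeHeight lam P - Point.tildeHeight lam Q))
    have hc := ((Valued.continuous_valuation_of_surjective hv).tendsto 0).comp tN
    rw [_root_.map_zero, WithZeroTopology.tendsto_zero] at hc
    obtain ⟨p, ⟨hp, -⟩, hp', hp''⟩ := (key.and ((hc (exp (-m)) exp_ne_zero).and
      (tO'.eventually_lt_const hm))).exists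
    rw [Function.comp, ← log_lt_iff_lt_exp (by simpa using hp)] at hp'
    rw [ord, addVal] at hp''
    have : -log (Valued.v (netPolynomial W p.1 p.2 a b)) < m := by exact_mod_cast hp''
    omega
  refine ⟨hN, ?_⟩
  have hc : ∀ᶠ p in nhdsIndependent P Q,
      ord (netPolynomial W p.1 p.2 a b) = ord (netPolynomial W P Q a b) := by
    filter_upwards [tN (Valued.locally_const (by simpa using hN))] with p hp
    rw [ord, ord]
    exact congrArg _ (congrArg addVal hp)
  have := tendsto_nhds_unique (tO'.congr' hc) tendsto_const_nhds
  linarith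

end Limit

/-! ### Base change to the completion -/

lemma map_netRec {R S : Type*} [CommRing R] [CommRing S] (φ : R →+* S) (d c₁ c₂ t₁ t₂ s : R)
    (a b : ℤ) : φ (netRec d c₁ c₂ t₁ t₂ s a b)
      = netRec (φ d) (φ c₁) (φ c₂) (φ t₁) (φ t₂) (φ s) a b := by
  have half : ∀ a b : ℤ, φ (netHalf d c₁ c₂ t₁ t₂ s a b)
      = netHalf (φ d) (φ c₁) (φ c₂) (φ t₁) (φ t₂) (φ s) a b := by
    intro a b
    unfold netHalf
    split <;> simp
  fun_induction netRec d c₁ c₂ t₁ t₂ s a b with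
  | case1 a b h => rw [netRec.eq_def (φ d), dif_pos h, map_sub, half, half]
  | case2 a b h ha hb ih1 ih2 ih3 ih4 ih5 ih6 ih7 =>
    rw [netRec.eq_def (φ d), dif_neg h, if_pos ha, if_pos hb]
    simp only [map_mul, map_sub, ih1, ih2, ih3, ih4, ih5, ih6, ih7]
  | case3 a b h ha hb ih1 ih2 ih3 ih4 ih5 ih6 =>
    rw [netRec.eq_def (φ d), dif_neg h, if_pos ha, if_neg hb]
    simp only [map_mul, map_sub, map_pow, ih1, ih2, ih3, ih4, ih5, ih6]
  | case4 a b h ha hb ih1 ih2 ih3 ih4 ih5 ih6 =>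
    rw [netRec.eq_def (φ d), dif_neg h, if_neg ha, if_pos hb]
    simp only [map_mul, map_sub, map_pow, ih1, ih2, ih3, ih4, ih5, ih6]
  | case5 a b h ha hb hab ih1 ih2 ih3 ih4 ih5 ih6 =>
    rw [netRec.eq_def (φ d), dif_neg h, if_neg ha, if_neg hb, if_pos hab]
    simp only [map_mul, map_sub, map_pow, ih1, ih2, ih3, ih4, ih5, ih6]
  | case6 a b h ha hb hab ih1 ih2 ih3 ih4 ih5 ih6 =>
    rw [netRec.eq_def (φ d), dif_neg h, if_neg ha, if_neg hb, if_neg hab]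
    simp only [map_mul, map_sub, map_pow, ih1, ih2, ih3, ih4, ih5, ih6]

lemma netPolynomial_baseChange {K L : Type*} [Field K] [Field L] [Algebra K L] [DecidableEq K]
    [DecidableEq L] (W : WeierstrassCurve K) (P Q : Affine.Point (W⁄K)) (a b : ℤ) :
    netPolynomial (W⁄L) (baseChange K L P) (baseChange K L Q) a b
      = algebraMap K L (netPolynomial (W⁄K) P Q a b) := by
  rcases P with _ | ⟨x₁, y₁, h₁⟩
  · exact (_root_.map_zero _).symm
  rcases Q with _ | ⟨x₂, y₂, h₂⟩
  · exact (_root_.map_zero _).symm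
  simp [baseChange, map, netPolynomial, map_netRec, Algebra.ofId_apply, map_ofNat (algebraMap K L)]

section NumberField

variable {K : Type*} [Field K] [NumberField K] [DecidableEq K] (W : WeierstrassCurve K)
  [W.IsElliptic] (v : HeightOneSpectrum (𝓞 K)) [DecidableEq (v.adicCompletion K)]
  {lam : Affine.Point (W⁄(v.adicCompletion K)) → ℝ}

omit [DecidableEq K] [DecidableEq (v.adicCompletion K)] in
lemma valued_algebraMap (x : K) :
    Valued.v (algebraMap K (v.adicCompletion K) x) = v.valuation K x :=
  HeightOneSpectrum.valuedAdicCompletion_eq_valuation' v x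

omit [W.IsElliptic] in
lemma normalisedHeight_eq_tildeHeight (P : Affine.Point (W⁄K)) :
    normalisedHeight W v lam P = tildeHeight lam (baseChange K (v.adicCompletion K) P) := by
  rw [normalisedHeight, tildeHeight, ord, ← valued_algebraMap,
    show WeierstrassCurve.Δ (W⁄(v.adicCompletion K)) = _ from
      W.map_Δ (algebraMap K (v.adicCompletion K))]

/-- The asserted formula over a number field, from the one over its completion. -/
theorem normalisedHeight_eq (hlam : IsLocalNeronHeight (W⁄(v.adicCompletion K)) lam)
    {P Q : Affine.Point (W⁄K)} (hP : P ≠ 0) (hQ : Q ≠ 0) (h₁ : P ≠ Q) (h₂ : P ≠ -Q) {a b : ℤ}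
    (hab : a • P + b • Q ≠ 0) :
    netPolynomial (W⁄K) P Q a b ≠ 0 ∧
      normalisedHeight W v lam (a • P + b • Q) =
        a ^ 2 * normalisedHeight W v lam P + b ^ 2 * normalisedHeight W v lam Q
        + a * b * (normalisedHeight W v lam (P + Q) - normalisedHeight W v lam P
            - normalisedHeight W v lam Q)
        + addVal (v.valuation K (netPolynomial (W⁄K) P Q a b)) := by
  let _ : NontriviallyNormedField (v.adicCompletion K) :=
    Valued.toNontriviallyNormedField (v.adicCompletion K) ℤᵐ⁰
  have : (W⁄(v.adicCompletion K)).IsElliptic :=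
    inferInstanceAs (W.map (algebraMap K (v.adicCompletion K))).IsElliptic
  have : CharZero (v.adicCompletion K) :=
    charZero_of_injective_algebraMap (algebraMap K (v.adicCompletion K)).injective
  have hi : ∀ A : Affine.Point (W⁄K), A ≠ 0 → baseChange K (v.adicCompletion K) A ≠ 0 :=
    fun A hA h ↦ hA (map_injective _ (h.trans (_root_.map_zero _).symm))
  have kP := hi P hP
  have kQ := hi Q hQ
  have hx := xCoord_sub_ne_zero kP kQ (by rw [← map_sub]; exact hi _ (sub_ne_zero.2 h₁))
    (by rw [← map_add]; exact hi _ fun h ↦ h₂ (eq_neg_of_add_eq_zero_left h))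
  obtain ⟨T, hT⟩ := exists_point_add_ne_neg
    (Q := baseChange K (v.adicCompletion K) Q) kP
  have key := tildeHeight_eq hlam (HeightOneSpectrum.valuedAdicCompletion_surjective K v) kP kQ hx
    (nhdsIndependent_neBot kP kQ) hT (a := a) (b := b)
    (by rw [← map_zsmul, ← map_zsmul, ← map_add]; exact hi _ hab)
  rw [← map_zsmul, ← map_zsmul, ← map_add, ← map_add, netPolynomial_baseChange, ord,
    valued_algebraMap] at key
  simp only [normalisedHeight_eq_tildeHeight]
  exact ⟨fun h ↦ key.1 (by rw [h, _root_.map_zero]), key.2⟩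

end NumberField

end WeierstrassCurve.Affine.Point

/-! ### Complex multiplication -/

namespace WeierstrassCurve.Affine.Point

/-- A nonzero element of an order does not annihilate a point of infinite order, because it divides
a nonzero integer. -/
lemma ringHom_apply_ne_zero {F G : Type*} [Field F] [NumberField F] [AddCommGroup G]
    {O : Subalgebra ℤ F} (θ : O →+* AddMonoid.End G) {β : O} (hβ : β ≠ 0) {A : G}
    (hA : ¬ IsOfFinAddOrder A) : θ β A ≠ 0 := fun h ↦ by
  have hF : IsAlgebraic ℤ (β : F) :=
    (IsFractionRing.isAlgebraic_iff ℤ ℚ F).2 (Algebra.IsAlgebraic.isAlgebraic (β : F))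
  have hO : IsAlgebraic ℤ β :=
    (isAlgebraic_algebraMap_iff (R := ℤ) (S := O) (A := F) Subtype.val_injective).1 hF
  obtain ⟨n, hn, γ, e⟩ := hO.exists_nonzero_dvd (mem_nonZeroDivisors_of_ne_zero hβ)
  refine hA (isOfFinAddOrder_iff_zsmul_eq_zero.2 ⟨n, hn, ?_⟩)
  have e' := congrArg (fun α ↦ θ α A) e
  rw [mul_comm] at e'
  simpa [h] using e'

end WeierstrassCurve.Affine.Point

theorem mainTheorem4 {K : Type*} [Field K] [NumberField K] [DecidableEq K]
    [DecidableEq (AlgebraicClosure K)] (W : WeierstrassCurve K) [W.IsElliptic]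
    (v : HeightOneSpectrum (𝓞 K)) [DecidableEq (v.adicCompletion K)]
    (lam : Affine.Point (W⁄(v.adicCompletion K)) → ℝ)
    (hlam : IsLocalNeronHeight (W⁄(v.adicCompletion K)) lam) :
    (∀ P Q : Affine.Point (W⁄K), P ≠ 0 → Q ≠ 0 → P ≠ Q → P ≠ -Q →
      ∀ a b : ℤ, a • P + b • Q ≠ 0 →
        netPolynomial (W⁄K) P Q a b ≠ 0 ∧
        normalisedHeight W v lam (a • P + b • Q) =
          a ^ 2 * normalisedHeight W v lam P + b ^ 2 * normalisedHeight W v lam Q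
          + a * b * (normalisedHeight W v lam (P + Q) - normalisedHeight W v lam P
              - normalisedHeight W v lam Q)
          + addVal (v.valuation K (netPolynomial (W⁄K) P Q a b))) ∧
    (∀ (F : Type*) [Field F] [NumberField F] [IsTotallyComplex F],
      Module.finrank ℚ F = 2 →
      ∀ (O : Subalgebra ℤ F) (ω : O), IsIntegral ℤ (ω : F) → (ω : F) ∉ (algebraMap ℚ F).range →
        O = Algebra.adjoin ℤ {(ω : F)} →
      ∀ θ : O →+* AddMonoid.End (Affine.Point (W⁄(AlgebraicClosure K))),
        IsEndIsomorphism (W⁄(AlgebraicClosure K)) θ →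
      ∀ P Q : Affine.Point (W⁄K), ¬ IsOfFinAddOrder P →
        Affine.Point.baseChange (W' := W) K (AlgebraicClosure K) Q
          = θ ω (Affine.Point.baseChange (W' := W) K (AlgebraicClosure K) P) →
      ∀ (a b : ℤ) (α : O), α = a + b * ω → α ≠ 0 →
        ∃ R S : Affine.Point (W⁄K),
          Affine.Point.baseChange (W' := W) K (AlgebraicClosure K) R
            = θ α (Affine.Point.baseChange (W' := W) K (AlgebraicClosure K) P) ∧
          Affine.Point.baseChange (W' := W) K (AlgebraicClosure K) S
            = θ (1 + ω) (Affine.Point.baseChange (W' := W) K (AlgebraicClosure K) P) ∧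
          netPolynomial (W⁄K) P Q a b ≠ 0 ∧
          normalisedHeight W v lam R =
            a ^ 2 * normalisedHeight W v lam P + b ^ 2 * normalisedHeight W v lam Q
            + a * b * (normalisedHeight W v lam S - normalisedHeight W v lam P
                - normalisedHeight W v lam Q)
            + addVal (v.valuation K (netPolynomial (W⁄K) P Q a b))) := by
  refine ⟨fun P Q hP hQ h₁ h₂ a b hab ↦
    WeierstrassCurve.Affine.Point.normalisedHeight_eq W v hlam hP hQ h₁ h₂ hab, ?_⟩
  intro F _ _ _ _ O ω _ hω _ θ _ P Q hP hQ a b α hα hα0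
  have hi : Function.Injective (Affine.Point.baseChange (W' := W) K (AlgebraicClosure K)) :=
    Affine.Point.map_injective _
  have hP' : ¬ IsOfFinAddOrder (Affine.Point.baseChange (W' := W) K (AlgebraicClosure K) P) :=
    fun h ↦ hP ((hi.isOfFinAddOrder_iff).1 h)
  have act : ∀ c d : ℤ, Affine.Point.baseChange (W' := W) K (AlgebraicClosure K) (c • P + d • Q)
      = θ (c + d * ω) (Affine.Point.baseChange (W' := W) K (AlgebraicClosure K) P) := by
    intro c d
    rw [map_add, map_zsmul, map_zsmul, hQ, map_add, map_mul, map_intCast, map_intCast]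
    rfl
  have ne : ∀ c d : ℤ, (c : O) + d * ω ≠ 0 → c • P + d • Q ≠ 0 := by
    intro c d hcd h0
    refine WeierstrassCurve.Affine.Point.ringHom_apply_ne_zero θ hcd hP' ?_
    rw [← act, h0, map_zero]
  -- `ω` is irrational, so that `ω` and `ω ± 1` are nonzero.
  have hω' : ∀ c d : ℤ, d ≠ 0 → (c : O) + d * ω ≠ 0 := by
    intro c d hd h0
    refine hω ⟨-c / d, ?_⟩
    have h0' : (c : F) + d * ω = 0 := by exact_mod_cast congrArg (Subtype.val) h0
    have hd' : (d : F) ≠ 0 := by exact_mod_cast hd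
    simp only [map_div₀, map_neg, map_intCast]
    field_simp
    linear_combination -h0'
  have hP0 : P ≠ 0 := by
    rintro rfl
    exact hP IsOfFinAddOrder.zero
  have hQ0 : Q ≠ 0 := by simpa using ne 0 1 (hω' 0 1 one_ne_zero)
  have h₁ : P ≠ Q := by
    intro h
    refine ne 1 (-1) (hω' 1 (-1) (by norm_num)) ?_
    rw [h]
    module
  have h₂ : P ≠ -Q := by
    intro h
    refine ne 1 1 (hω' 1 1 one_ne_zero) ?_
    rw [h]
    module
  refine ⟨a • P + b • Q, P + Q, ?_, ?_, ?_⟩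
  · rw [act, hα]
  · simpa using act 1 1
  · exact WeierstrassCurve.Affine.Point.normalisedHeight_eq W v hlam hP0 hQ0 h₁ h₂
      (ne a b (hα ▸ hα0))
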